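/- Let $k$ be a finite field with $q=|k|$ elements, let $n\ge 1$, $G=\mathrm{GL}_n(k)$, and let $\lambda,\mu$ be partitions of $n$. **Notation.** For a partition $\lambda=(\lambda_1\ge\dots\ge\lambda_l>0)$ of $n$ let $X_\lambda$ be the set of $\lambda$-flags, i.e. chains $k^n=X^0\supset X^1\supset\dots\supset X^{l}=0$ with $\dim X^{i-1}/X^{i}=\lambda_i$; put $X^i=0$ for $i>l=l(\lambda)$. Let $\mathcal F_\lambda$ be the $G$-representation of $\mathbb Q$-valued functions on $X_\lambda$. Write $\nu\le\lambda$ if $\nu_1+\dots+\nu_i\ge\lambda_1+\dots+\lambda_i$ for all $i$, and let $\lambda\wedge\mu$ be the meet in this order. The intersection matrix of $(X,Y)\in X_\lambda\times X_\mu$ is given by $a_{ij}=\dim\bigl(X^{i-1}\cap Y^{j-1}\bigr)/\bigl(X^{i-1}\cap Y^{j}+X^{i}\cap Y^{j-1}\bigr)$. A $\nu$-flag $Z$ is permissibly embedded in a $\lambda$-flag $X$ if $l(\nu)\le l(\lambda)$, $Z^i\subset X^i$ for all $i$, and the tableau of shape $\nu$ whose $i$-th row contains $a_{ij}$ entries $j$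 (in weakly increasing order), where $(a_{ij})$ is the intersection matrix of $(Z,X)$, is semistandard. Let $(X_\nu\times_G X_\lambda)^\circ$ be the set of $G$-orbits of pairs $(Z,X)$ such that $Z$ is permissibly embedded in $X$. For a $G$-orbit $\Omega\subset X_\lambda\times X_\mu$ let $\mathbf g_\Omega:\mathcal F_\mu\to\mathcal F_\lambda$, $(\mathbf g_\Omega f)(x)=\sum_{y:(x,y)\in\Omega}f(y)$, and let $\Omega^{\rm op}=\{(y,x):(x,y)\in\Omega\}$. For $\nu\le\lambda\wedge\mu$, $\Omega_1\in(X_\nu\times_GX_\lambda)^\circ$ and $\Omega_2\in(X_\nu\times_GX_\mu)^\circ$ put $$\mathbf c^\nu_{\Omega_1\Omega_2}=\mathbf g_{\Omega_1^{\rm op}}\circ\mathbf g_{\Omega_2}\in\mathrm{Hom}_G(\mathcal F_\mu,\mathcal F_\lambda).$$ Let $\mathcal H=\mathcal H_{\mathbb Q,q}(S_n)$ be the Iwahori–Hecke algebra with standard basis $T_w$ ($w\in S_n$), where $T_wT_s=T_{ws}$ if $\ell(ws)>\ell(w)$ and $T_wT_s=qT_{ws}+(q-1)T_w$ otherwise,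 for $s=(i,i+1)$; permutations act on the right. Let $T_w^\star=T_{w^{-1}}$ and $m_\nu=\sum_{w\in S_\nu}T_w$, with $S_\nu$ the Young subgroup preserving the consecutive blocks of sizes $\nu_1,\nu_2,\dots$. Let $\phi^\nu$ be the $\nu$-tableau with $1,\dots,n$ entered in order along the rows; for a standard $\nu$-tableau $\theta$ define $d(\theta)\in S_n$ by $\theta=\phi^\nu d(\theta)$, and let $\lambda(\theta)$ be obtained from $\theta$ by replacing each entry by the index of the row of $\phi^\lambda$ containing it. For semistandard $\nu$-tableaux $\Theta_1$ of type $\lambda$ and $\Theta_2$ of type $\mu$ put $m_{\Theta_1\Theta_2}=\sum T_{d(\theta_1)}^\star m_\nu T_{d(\theta_2)}$, the sum being over all pairs of standard $\nu$-tableaux with $\lambda(\theta_1)=\Theta_1$ and $\mu(\theta_2)=\Theta_2$. These elements, for $\nu\le\lambda\wedge\mu$, form the Murphy–Dipper–James basis of $m_\lambda\mathcal H m_\mu$. For a $G$-map $A:\mathcal F_\mu\to\mathcal F_\lambda$, $(Af)(x)=\sum_yK(x,y)f(y)$, let $\hat A\in\mathrm{End}_G(\mathcal F_{(1^n)})$ be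 the map whose kernel is the pull-back of $K$ along the maps $X_{(1^n)}\to X_\lambda$ and $X_{(1^n)}\to X_\mu$ that forget part of a complete flag. Let $P_\nu\subset G$ be the stabilizer of the standard $\nu$-flag and $B\subset G$ the group of invertible upper triangular matrices. **Theorem.** 1. The family $(\mathbf c^\nu_{\Omega_1\Omega_2})$, indexed by all $\nu\le\lambda\wedge\mu$, $\Omega_1\in(X_\nu\times_GX_\lambda)^\circ$, $\Omega_2\in(X_\nu\times_GX_\mu)^\circ$, is a $\mathbb Q$-basis of $\mathrm{Hom}_G(\mathcal F_\mu,\mathcal F_\lambda)$. 2. This basis is the Murphy–Dipper–James basis. Precisely: for all partitions $\nu,\kappa$ of $n$, sending an orbit to the tableau attached to its intersection matrix is a bijection from $(X_\nu\times_GX_\kappa)^\circ$ onto the semistandard $\nu$-tableaux of type $\kappa$. There are an isomorphism of $\mathbb Q$-algebras $\Phi:\mathcal H\to\mathrm{End}_G(\mathcal F_{(1^n)})$ taking each $T_w$ to $\mathbf g_{\Omega_w}$, where $\Omega_w$ is the orbit whose intersection matrix is the permutation matrix of $w$ (with $a_{ij}=1$ iff $w$ sends $i$ to $j$), and a linear isomorphism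 $\Psi:m_\lambda\mathcal Hm_\mu\to\mathrm{Hom}_G(\mathcal F_\mu,\mathcal F_\lambda)$ with $\widehat{\Psi(h)}=\Phi(h)$ for all $h$. If $\Omega_1,\Omega_2$ correspond to $\Theta_1,\Theta_2$, then $$\Psi(m_{\Theta_1\Theta_2})=\mathbf c^\nu_{\Omega_1\Omega_2},$$ and the product of $\mathbf g_{\Omega_1^{\rm op}}$ and $\mathbf g_{\Omega_2}$ formed inside the Hecke algebra satisfies $$\hat{\mathbf g}_{\Omega_1^{\rm op}}\,\hat{\mathbf g}_{\Omega_2}=\frac{|P_\nu|}{|B|}\,\Phi(m_{\Theta_1\Theta_2}).$$ -/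

import Mathlib

noncomputable section

namespace FlagHecke

open scoped Classical

/-! ### Partitions -/

/-- The parts of the partition `lam`, listed in non-increasing order and padded by zeros:
`row lam i` is the part usually written `λ_{i+1}`. -/
def row {n : ℕ} (lam : n.Partition) (i : ℕ) : ℕ :=
  (lam.parts.sort (· ≥ ·)).getD i 0

/-- `λ_1 + ⋯ + λ_i`. -/
def partialSum {n : ℕ} (lam : n.Partition) (i : ℕ) : ℕ :=
  ∑ j ∈ Finset.range i, row lam j

/-- The length (number of parts) of a partition. -/
def len {n : ℕ} (lam : n.Partition) : ℕ := Multiset.card lam.parts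

/-- The opposite dominance order: `ν ≤ lam` iff `ν_1 + ⋯ + ν_i ≥ λ_1 + ⋯ + λ_i` for all `i`. -/
def OppDomLE {n : ℕ} (ν lam : n.Partition) : Prop :=
  ∀ i, partialSum lam i ≤ partialSum ν i

/-- The partition `(1, 1, …, 1)` of `n`. -/
def ones (n : ℕ) : n.Partition where
  parts := Multiset.replicate n 1
  parts_pos := fun h => by rw [Multiset.eq_of_mem_replicate h]; exact one_pos
  parts_sum := by simp

theorem sum_range_getD (l : List ℕ) (m : ℕ) (h : l.length ≤ m) :
    ∑ j ∈ Finset.range m, l.getD j 0 = l.sum := by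
  induction l generalizing m with
  | nil => simp
  | cons a l ih =>
    obtain ⟨m, rfl⟩ : ∃ m', m = m' + 1 := ⟨m - 1, by simp at h; omega⟩
    rw [Finset.sum_range_succ', List.sum_cons, add_comm]
    simp only [List.getD_cons_succ, List.getD_cons_zero]
    rw [ih m (by simpa using h)]

theorem len_le {n : ℕ} (lam : n.Partition) : len lam ≤ n := by
  have h : Multiset.card lam.parts • 1 ≤ lam.parts.sum :=
    Multiset.card_nsmul_le_sum fun x hx => lam.parts_pos hx
  rw [lam.parts_sum] at h
  simpa [len] using h

theorem partialSum_top {n : ℕ} (lam : n.Partition) : partialSum lam n = n := by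
  unfold partialSum row
  rw [sum_range_getD _ n (by simpa [len] using len_le lam)]
  conv_rhs => rw [← lam.parts_sum]
  rw [← Multiset.sum_coe, Multiset.sort_eq]

theorem sum_row {n : ℕ} (lam : n.Partition) : ∑ i : Fin n, row lam i = n := by
  rw [Fin.sum_univ_eq_sum_range]
  exact partialSum_top lam

theorem partialSum_le {n : ℕ} (lam : n.Partition) (i : Fin (n + 1)) : partialSum lam i ≤ n := by
  conv_rhs => rw [← partialSum_top lam]
  exact Finset.sum_le_sum_of_subset (Finset.range_subset_range.2 (Nat.lt_succ_iff.1 i.2))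

theorem row_ones {n : ℕ} (i : Fin n) : row (ones n) i = 1 := by
  have h : (Multiset.replicate n 1 : Multiset ℕ).sort (· ≥ ·) = List.replicate n 1 := by
    rw [List.eq_replicate_iff]
    refine ⟨by simp, fun b hb => ?_⟩
    rw [Multiset.mem_sort] at hb
    exact Multiset.eq_of_mem_replicate hb
  simp [row, ones, h]

/-! ### Tableaux -/

/-- The boxes of the Young diagram of `ν`; the box `⟨i, c⟩` lies in row `i` and column `c`
(both counted from `0`). -/
abbrev Cell {n : ℕ} (ν : n.Partition) : Type := (i : Fin n) × Fin (row ν i)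

/-- The tableau `φ^ν`: the labels are entered in increasing order from left to right along the
successive rows.  Labels are counted from `0`, so they run through `Fin n`. -/
def rowReading {n : ℕ} (ν : n.Partition) : Cell ν ≃ Fin n :=
  finSigmaFinEquiv.trans (finCongr (sum_row ν))

/-- The (index of the) row of `φ^ν` that contains `r`; thus the fibres of `block ν` are the
sets `{ν_1 + ⋯ + ν_{j-1} + 1, …, ν_1 + ⋯ + ν_j}`, with labels counted from `0`. -/
def block {n : ℕ} (ν : n.Partition) (r : Fin n) : Fin n := ((rowReading ν).symm r).1

/-- A standard tableau: every label occurs once, and labels strictly increase along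
rows and down columns. -/
def IsStandard {n : ℕ} {ν : n.Partition} (θ : Cell ν ≃ Fin n) : Prop :=
  (∀ (i : Fin n) (c c' : Fin (row ν i)), c < c' → θ ⟨i, c⟩ < θ ⟨i, c'⟩) ∧
  (∀ (i i' : Fin n) (c : Fin (row ν i)) (c' : Fin (row ν i')),
    i < i' → (c : ℕ) = c' → θ ⟨i, c⟩ < θ ⟨i', c'⟩)

/-- A semistandard tableau: labels weakly increase along rows and strictly increase down
columns. -/
def IsSemistandard {n : ℕ} {ν : n.Partition} (Θ : Cell ν → Fin n) : Prop :=
  (∀ (i : Fin n) (c c' : Fin (row ν i)), c ≤ c' → Θ ⟨i, c⟩ ≤ Θ ⟨i, c'⟩) ∧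
  (∀ (i i' : Fin n) (c : Fin (row ν i)) (c' : Fin (row ν i')),
    i < i' → (c : ℕ) = c' → Θ ⟨i, c⟩ < Θ ⟨i', c'⟩)

/-- The number of labels `j` in row `i` of a tableau. -/
def content {n : ℕ} {ν : n.Partition} (Θ : Cell ν → Fin n) (i j : Fin n) : ℕ :=
  (Finset.univ.filter fun c : Fin (row ν i) => Θ ⟨i, c⟩ = j).card

/-- `SStd ν lam`: semistandard tableaux of shape `ν` and type `lam`, i.e. the label `j` occurs
exactly `row lam j` times. -/
def SStd {n : ℕ} (ν lam : n.Partition) : Type :=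
  {Θ : Cell ν → Fin n // IsSemistandard Θ ∧
    ∀ j : Fin n, (Finset.univ.filter fun b : Cell ν => Θ b = j).card = row lam j}

/-- The tableau `lam(θ)`: each label of `θ` is replaced by the row of `φ^lam` containing it. -/
def reduceTableau {n : ℕ} {ν : n.Partition} (lam : n.Partition) (θ : Cell ν ≃ Fin n) :
    Cell ν → Fin n := fun b => block lam (θ b)

/-- The permutation `d(θ)` with `θ = φ^ν d(θ)`; permutations are written on the right, so it
sends the label of a box in `φ^ν` to the label of that box in `θ`. -/
def dPerm {n : ℕ} {ν : n.Partition} (θ : Cell ν ≃ Fin n) : Equiv.Perm (Fin n) :=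
  (rowReading ν).symm.trans θ

/-! ### The Iwahori-Hecke algebra of the symmetric group

Permutations act on the right, so that the product `w v` of two permutations means `w` followed
by `v`, i.e. `w.trans v`. -/

/-- The length of a permutation: its number of inversions. -/
def permLength {n : ℕ} (w : Equiv.Perm (Fin n)) : ℕ :=
  (Finset.univ.filter fun p : Fin n × Fin n => p.1 < p.2 ∧ w p.2 < w p.1).card

/-- The multiplication rules among the generators `T_w`; here `s` is the adjacent transposition
`(a, b)` with `b = a + 1`. -/
inductive HeckeRel (R : Type) [CommRing R] (q : R) (n : ℕ) :
    FreeAlgebra R (Equiv.Perm (Fin n)) → FreeAlgebra R (Equiv.Perm (Fin n)) → Prop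
  | one : HeckeRel R q n (FreeAlgebra.ι R 1) 1
  | up (w : Equiv.Perm (Fin n)) (a b : Fin n) (hab : (a : ℕ) + 1 = b)
      (h : permLength w < permLength (w.trans (Equiv.swap a b))) :
      HeckeRel R q n
        (FreeAlgebra.ι R w * FreeAlgebra.ι R (Equiv.swap a b))
        (FreeAlgebra.ι R (w.trans (Equiv.swap a b)))
  | down (w : Equiv.Perm (Fin n)) (a b : Fin n) (hab : (a : ℕ) + 1 = b)
      (h : ¬ permLength w < permLength (w.trans (Equiv.swap a b))) :
      HeckeRel R q n
        (FreeAlgebra.ι R w * FreeAlgebra.ι R (Equiv.swap a b))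
        (q • FreeAlgebra.ι R (w.trans (Equiv.swap a b)) + (q - 1) • FreeAlgebra.ι R w)

/-- The Iwahori-Hecke algebra `H_{R,q}(S_n)`: the unital `R`-algebra generated by the `T_w`,
`w ∈ S_n`, subject to `T_1 = 1`, to `T_w T_s = T_{ws}` if `ℓ(ws) > ℓ(w)`, and to
`T_w T_s = q T_{ws} + (q - 1) T_w` otherwise. -/
abbrev Hecke (R : Type) [CommRing R] (q : R) (n : ℕ) : Type := RingQuot (HeckeRel R q n)

/-- The standard basis element `T_w`. -/
def T (R : Type) [CommRing R] (q : R) {n : ℕ} (w : Equiv.Perm (Fin n)) : Hecke R q n :=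
  RingQuot.mkAlgHom R (HeckeRel R q n) (FreeAlgebra.ι R w)

/-- The Young subgroup `S_ν`: permutations preserving every block of `ν`. -/
def youngSubgroup {n : ℕ} (ν : n.Partition) : Finset (Equiv.Perm (Fin n)) :=
  Finset.univ.filter fun w => ∀ r, block ν (w r) = block ν r

/-- `m_ν = ∑_{w ∈ S_ν} T_w`. -/
def mElt (R : Type) [CommRing R] (q : R) {n : ℕ} (ν : n.Partition) : Hecke R q n :=
  ∑ w ∈ youngSubgroup ν, T R q w

/-- The module `m_lam H m_μ`. -/
def heckeModule (R : Type) [CommRing R] (q : R) {n : ℕ} (lam μ : n.Partition) :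
    Submodule R (Hecke R q n) :=
  LinearMap.range
    ((LinearMap.mulLeft R (mElt R q lam)).comp (LinearMap.mulRight R (mElt R q μ)))

/-- The Murphy-Dipper-James element
`m_{Θ₁Θ₂} = ∑ T_{d(θ₁)}^⋆ m_ν T_{d(θ₂)}`, where `T_w^⋆ = T_{w⁻¹}` and the sum is over the pairs
of standard `ν`-tableaux with `lam(θ₁) = Θ₁` and `μ(θ₂) = Θ₂`. -/
def murphyElt (R : Type) [CommRing R] (q : R) {n : ℕ} {ν lam μ : n.Partition}
    (Θ₁ : SStd ν lam) (Θ₂ : SStd ν μ) : Hecke R q n :=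
  ∑ θ₁ ∈ Finset.univ.filter
      (fun θ : Cell ν ≃ Fin n => IsStandard θ ∧ reduceTableau lam θ = Θ₁.1),
    ∑ θ₂ ∈ Finset.univ.filter
        (fun θ : Cell ν ≃ Fin n => IsStandard θ ∧ reduceTableau μ θ = Θ₂.1),
      T R q (dPerm θ₁)⁻¹ * mElt R q ν * T R q (dPerm θ₂)

/-! ### Flags -/

/-- A `lam`-flag in `k^n`.  The subspaces are indexed from the top: `space i` is the subspace
usually written `x_{l(lam) - i}`, and it is `0` for `i ≥ l(lam)`.  The successive quotients
`space i / space (i + 1)` have dimensions `λ_1, λ_2, …`. -/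
@[ext] structure FlagOf (k : Type*) [Field k] {n : ℕ} (lam : n.Partition) where
  space : Fin (n + 1) → Submodule k (Fin n → k)
  antitone : Antitone space
  top : space 0 = ⊤
  step : ∀ i : Fin n, Module.finrank k (space i.castSucc) =
    Module.finrank k (space i.succ) + row lam i

section Flags

variable {k : Type*} [Field k] {n : ℕ}

theorem mulVecLin_injective (g : Matrix.GeneralLinearGroup (Fin n) k) :
    Function.Injective (Matrix.mulVecLin (g : Matrix (Fin n) (Fin n) k)) := by
  have h : Function.LeftInverse
      (Matrix.mulVecLin ((g⁻¹ : Matrix.GeneralLinearGroup (Fin n) k) :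
        Matrix (Fin n) (Fin n) k))
      (Matrix.mulVecLin (g : Matrix (Fin n) (Fin n) k)) := by
    intro v
    rw [Matrix.mulVecLin_apply, Matrix.mulVecLin_apply, Matrix.mulVec_mulVec,
      ← Units.val_mul, inv_mul_cancel, Units.val_one, Matrix.one_mulVec]
  exact h.injective

theorem finrank_map_gl (g : Matrix.GeneralLinearGroup (Fin n) k)
    (A : Submodule k (Fin n → k)) :
    Module.finrank k (A.map (Matrix.mulVecLin (g : Matrix (Fin n) (Fin n) k))) =
      Module.finrank k A :=
  (LinearEquiv.finrank_eq
    (Submodule.equivMapOfInjective _ (mulVecLin_injective g) A)).symm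

theorem map_gl_top (g : Matrix.GeneralLinearGroup (Fin n) k) :
    (⊤ : Submodule k (Fin n → k)).map
      (Matrix.mulVecLin (g : Matrix (Fin n) (Fin n) k)) = ⊤ := by
  apply Submodule.eq_top_of_finrank_eq
  rw [finrank_map_gl, finrank_top]

/-- `GL_n(k)` acts on `lam`-flags. -/
instance (lam : n.Partition) :
    MulAction (Matrix.GeneralLinearGroup (Fin n) k) (FlagOf k lam) where
  smul g x :=
    { space := fun i => (x.space i).map (Matrix.mulVecLin (g : Matrix (Fin n) (Fin n) k))
      antitone := fun _ _ h => Submodule.map_mono (x.antitone h)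
      top := by rw [x.top, map_gl_top]
      step := fun i => by rw [finrank_map_gl, finrank_map_gl, x.step] }
  one_smul x := by
    apply FlagOf.ext
    funext i
    change (x.space i).map (Matrix.mulVecLin (1 : Matrix (Fin n) (Fin n) k)) = _
    rw [Matrix.mulVecLin_one, Submodule.map_id]
  mul_smul g h x := by
    apply FlagOf.ext
    funext i
    change (x.space i).map (Matrix.mulVecLin
      ((g : Matrix (Fin n) (Fin n) k) * (h : Matrix (Fin n) (Fin n) k))) =
      ((x.space i).map _).map _
    rw [Matrix.mulVecLin_mul, Submodule.map_comp]

theorem smul_space {lam : n.Partition} (g : Matrix.GeneralLinearGroup (Fin n) k)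
    (x : FlagOf k lam) (i : Fin (n + 1)) :
    (g • x).space i =
      (x.space i).map (Matrix.mulVecLin (g : Matrix (Fin n) (Fin n) k)) := rfl

theorem FlagOf.finrank_add {lam : n.Partition} (x : FlagOf k lam) (i : Fin (n + 1)) :
    Module.finrank k (x.space i) + partialSum lam i = n := by
  induction i using Fin.induction with
  | zero =>
    rw [x.top, finrank_top]
    simp [partialSum]
  | succ i ih =>
    have h := x.step i
    have h2 : partialSum lam (i.succ : Fin (n + 1)) =
        partialSum lam (i.castSucc : Fin (n + 1)) + row lam i := by
      simp [partialSum, Finset.sum_range_succ]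
    omega

instance [Finite k] (lam : n.Partition) : Finite (FlagOf k lam) := by
  have : Finite (Submodule k (Fin n → k)) :=
    Finite.of_injective _ (SetLike.coe_injective (A := Submodule k (Fin n → k)))
  exact Finite.of_injective (fun x : FlagOf k lam => x.space) fun x y h => FlagOf.ext h

instance [Finite k] (lam : n.Partition) : Fintype (FlagOf k lam) := Fintype.ofFinite _

/-- The `lam`-flag formed by some of the subspaces of a complete flag. -/
def coarsen (lam : n.Partition) (x : FlagOf k (ones n)) : FlagOf k lam where
  space i := x.space ⟨partialSum lam i, Nat.lt_succ_of_le (partialSum_le lam i)⟩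
  antitone i j h := x.antitone (by
    rw [Fin.mk_le_mk]
    exact Finset.sum_le_sum_of_subset (Finset.range_subset_range.2 h))
  top := by
    rw [← x.top]
    congr 1
  step i := by
    have key : ∀ j : Fin (n + 1), Module.finrank k (x.space j) + j = n := by
      intro j
      have h := x.finrank_add j
      have h2 : partialSum (ones n) j = j := by
        unfold partialSum
        rw [Finset.sum_congr rfl (g := fun _ => 1)]
        · simp
        · intro a ha
          exact row_ones ⟨a, by have := Finset.mem_range.1 ha; omega⟩
      rwa [h2] at h
    have h1 := key ⟨partialSum lam i.castSucc,
      Nat.lt_succ_of_le (partialSum_le lam i.castSucc)⟩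
    have h2 := key ⟨partialSum lam i.succ, Nat.lt_succ_of_le (partialSum_le lam i.succ)⟩
    have h3 : partialSum lam (i.succ : Fin (n + 1)) =
        partialSum lam (i.castSucc : Fin (n + 1)) + row lam i := by
      simp [partialSum, Finset.sum_range_succ]
    simp only at h1 h2
    omega

theorem coarsen_smul (lam : n.Partition) (g : Matrix.GeneralLinearGroup (Fin n) k)
    (x : FlagOf k (ones n)) : coarsen lam (g • x) = g • coarsen lam x := rfl

/-- The standard `lam`-flag: its subspaces are spanned by initial segments
`e_1, …, e_{n - (λ_1 + ⋯ + λ_i)}` of the standard basis. -/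
def stdFlag (k : Type*) [Field k] {n : ℕ} (lam : n.Partition) : FlagOf k lam where
  space i := Submodule.span k
    (Set.range ((Pi.basisFun k (Fin n)) ∘
      (Fin.castLE (Nat.sub_le n (partialSum lam i)))))
  antitone i j h := by
    apply Submodule.span_mono
    have hs : partialSum lam i ≤ partialSum lam j :=
      Finset.sum_le_sum_of_subset (Finset.range_subset_range.2 h)
    rintro _ ⟨r, rfl⟩
    exact ⟨Fin.castLE (by omega) r, rfl⟩
  top := by
    apply Submodule.eq_top_of_finrank_eq
    rw [finrank_span_eq_card
      ((Pi.basisFun k (Fin n)).linearIndependent.comp _ (Fin.castLE_injective _))]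
    simp [partialSum]
  step i := by
    rw [finrank_span_eq_card
      ((Pi.basisFun k (Fin n)).linearIndependent.comp _ (Fin.castLE_injective _)),
      finrank_span_eq_card
      ((Pi.basisFun k (Fin n)).linearIndependent.comp _ (Fin.castLE_injective _))]
    have h2 := partialSum_le lam i.succ
    have h3 : partialSum lam (i.succ : Fin (n + 1)) =
        partialSum lam (i.castSucc : Fin (n + 1)) + row lam i := by
      simp [partialSum, Finset.sum_range_succ]
    simp only [Fintype.card_fin]
    omega

/-- `P_ν`, the stabilizer of the standard `ν`-flag. -/
def parabolic (k : Type*) [Field k] {n : ℕ} (ν : n.Partition) :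
    Subgroup (Matrix.GeneralLinearGroup (Fin n) k) :=
  MulAction.stabilizer (Matrix.GeneralLinearGroup (Fin n) k) (stdFlag k ν)

/-- `B`, the invertible upper triangular matrices. -/
def upperTriangular (k : Type*) [Field k] (n : ℕ) : Set (Matrix.GeneralLinearGroup (Fin n) k) :=
  {g | ∀ i j : Fin n, j < i → (g : Matrix (Fin n) (Fin n) k) i j = 0}

/-! ### Relative positions of flags -/

/-- The intersection matrix of two flags: the `(i, j)` entry is the dimension of
`(X_i ∩ Y_j) / (X_i ∩ Y_{j+1} + X_{i+1} ∩ Y_j)`, where `X_i`, `Y_j` are the subspaces indexed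
from the top.  Its row sums are the parts of `lam` and its column sums are the parts
of `μ`. -/
def intMatrix {lam μ : n.Partition} (x : FlagOf k lam) (y : FlagOf k μ) (i j : Fin n) : ℕ :=
  Module.finrank k
    (↥(x.space i.castSucc ⊓ y.space j.castSucc) ⧸
      ((x.space i.castSucc ⊓ y.space j.succ) ⊔
        (x.space i.succ ⊓ y.space j.castSucc)).submoduleOf
        (x.space i.castSucc ⊓ y.space j.castSucc))

theorem finrank_quotient_map (g : Matrix.GeneralLinearGroup (Fin n) k)
    (A C : Submodule k (Fin n → k)) (h : C ≤ A) :
    Module.finrank k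
      (↥(A.map (Matrix.mulVecLin (g : Matrix (Fin n) (Fin n) k))) ⧸
        (C.map (Matrix.mulVecLin (g : Matrix (Fin n) (Fin n) k))).submoduleOf
          (A.map (Matrix.mulVecLin (g : Matrix (Fin n) (Fin n) k)))) =
    Module.finrank k (↥A ⧸ C.submoduleOf A) := by
  have h1 := Submodule.finrank_quotient_add_finrank (C.submoduleOf A)
  have h2 := Submodule.finrank_quotient_add_finrank
    ((C.map (Matrix.mulVecLin (g : Matrix (Fin n) (Fin n) k))).submoduleOf
      (A.map (Matrix.mulVecLin (g : Matrix (Fin n) (Fin n) k))))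
  rw [LinearEquiv.finrank_eq (Submodule.submoduleOfEquivOfLe h)] at h1
  rw [LinearEquiv.finrank_eq (Submodule.submoduleOfEquivOfLe (Submodule.map_mono h)),
    finrank_map_gl, finrank_map_gl] at h2
  omega

theorem intMatrix_smul {lam μ : n.Partition} (g : Matrix.GeneralLinearGroup (Fin n) k)
    (x : FlagOf k lam) (y : FlagOf k μ) : intMatrix (g • x) (g • y) = intMatrix x y := by
  funext i j
  have hle : (x.space i.castSucc ⊓ y.space j.succ) ⊔ (x.space i.succ ⊓ y.space j.castSucc) ≤
      x.space i.castSucc ⊓ y.space j.castSucc :=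
    sup_le (inf_le_inf_left _ (y.antitone (Fin.castSucc_lt_succ).le))
      (inf_le_inf_right _ (x.antitone (Fin.castSucc_lt_succ).le))
  have key := finrank_quotient_map g _ _ hle
  rw [Submodule.map_sup, Submodule.map_inf _ (mulVecLin_injective g),
    Submodule.map_inf _ (mulVecLin_injective g),
    Submodule.map_inf _ (mulVecLin_injective g)] at key
  exact key

/-- `X_lam ×_G X_μ`: the orbits of the diagonal action of `G = GL_n(k)`. -/
abbrev Orbits (k : Type*) [Field k] {n : ℕ} (lam μ : n.Partition) : Type _ :=
  MulAction.orbitRel.Quotient (Matrix.GeneralLinearGroup (Fin n) k)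
    (FlagOf k lam × FlagOf k μ)

/-- The intersection matrix of the pairs in an orbit. -/
def orbitMatrix {lam μ : n.Partition} (Ω : Orbits k lam μ) : Fin n → Fin n → ℕ :=
  Quotient.liftOn' Ω (fun p => intMatrix p.1 p.2) (by
    rintro _ q ⟨g, rfl⟩
    exact intMatrix_smul g q.1 q.2)

/-- `[(x, y)]^op = [(y, x)]`. -/
def Orbits.op {lam μ : n.Partition} (Ω : Orbits k lam μ) : Orbits k μ lam :=
  Quotient.map' Prod.swap (by
    rintro _ q ⟨g, rfl⟩
    exact ⟨g, rfl⟩) Ω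

/-- The `ν`-flag `z` is embedded in the `lam`-flag `x`. -/
def Embedded {ν lam : n.Partition} (z : FlagOf k ν) (x : FlagOf k lam) : Prop :=
  len ν ≤ len lam ∧ ∀ i : Fin (n + 1), (i : ℕ) ≤ len ν → z.space i ≤ x.space i

/-- The embedding of `z` in `x` is permissible: the `ν`-tableau with `a_{ij}` labels `j` in
row `i` (in weakly increasing order), where `(a_{ij})` is the intersection matrix,
is semistandard. -/
def Permissible {ν lam : n.Partition} (z : FlagOf k ν) (x : FlagOf k lam) : Prop :=
  Embedded z x ∧ ∃ Θ : Cell ν → Fin n, IsSemistandard Θ ∧ content Θ = intMatrix z x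

/-- `(X_ν ×_G X_lam)°`: the orbits of permissible embeddings. -/
abbrev PermOrbits (k : Type*) [Field k] {n : ℕ} (ν lam : n.Partition) : Type _ :=
  {Ω : Orbits k ν lam // ∃ (z : FlagOf k ν) (x : FlagOf k lam),
    Permissible z x ∧ (z, x) ∈ MulAction.orbitRel.Quotient.orbit Ω}

/-! ### Flag representations and Hecke modules -/

/-- The permutation representation `F_lam` of `G` on `ℚ`-valued functions on `X_lam`. -/
def flagRep (k : Type*) [Field k] {n : ℕ} (lam : n.Partition) :
    Representation ℚ (Matrix.GeneralLinearGroup (Fin n) k) (FlagOf k lam → ℚ) where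
  toFun g :=
    { toFun := fun f x => f (g⁻¹ • x)
      map_add' := fun _ _ => rfl
      map_smul' := fun _ _ => rfl }
  map_one' := by
    ext f x
    simp
  map_mul' g h := by
    apply LinearMap.ext
    intro f
    funext x
    simp [mul_smul]

/-- `HomG k μ lam = Hom_G(F_μ, F_lam)`. -/
abbrev HomG (k : Type*) [Field k] {n : ℕ} (μ lam : n.Partition) : Type _ :=
  (flagRep k μ).IntertwiningMap (flagRep k lam)

theorem mem_orbit_smul {lam μ : n.Partition} (Ω : Orbits k lam μ)
    (g : Matrix.GeneralLinearGroup (Fin n) k) (x : FlagOf k lam) (y : FlagOf k μ) :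
    (g • x, g • y) ∈ MulAction.orbitRel.Quotient.orbit Ω ↔
      (x, y) ∈ MulAction.orbitRel.Quotient.orbit Ω := by
  rw [MulAction.orbitRel.Quotient.mem_orbit, MulAction.orbitRel.Quotient.mem_orbit]
  have h : (Quotient.mk'' (g • x, g • y) : Orbits k lam μ) = Quotient.mk'' (x, y) :=
    Quotient.sound' ⟨g, rfl⟩
  rw [h]

/-- The `G`-map `g_Ω : F_μ → F_lam`, `(g_Ω f)(x) = ∑_{y : (x, y) ∈ Ω} f(y)`. -/
def gMap [Finite k] {lam μ : n.Partition} (Ω : Orbits k lam μ) : HomG k μ lam where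
  toFun f x := ∑ y ∈ Finset.univ.filter
    (fun y : FlagOf k μ => (x, y) ∈ MulAction.orbitRel.Quotient.orbit Ω), f y
  map_add' f f' := by
    funext x
    exact Finset.sum_add_distrib
  map_smul' a f := by
    funext x
    exact (Finset.mul_sum _ _ _).symm
  isIntertwining' g := by
    apply LinearMap.ext
    intro f
    funext x
    change ∑ y ∈ Finset.univ.filter
        (fun y : FlagOf k μ => (x, y) ∈ MulAction.orbitRel.Quotient.orbit Ω), f (g⁻¹ • y) =
      ∑ y ∈ Finset.univ.filter
        (fun y : FlagOf k μ => (g⁻¹ • x, y) ∈ MulAction.orbitRel.Quotient.orbit Ω), f y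
    refine Finset.sum_equiv (MulAction.toPerm g⁻¹) ?_ (fun _ _ => rfl)
    intro y
    simp [mem_orbit_smul]

/-- `c^ν_{Ω₁Ω₂} = g_{Ω₁^op} ∘ g_{Ω₂}`, a `G`-map from `F_μ` to `F_lam`. -/
def cMap [Finite k] {ν lam μ : n.Partition} (Ω₁ : Orbits k ν lam) (Ω₂ : Orbits k ν μ) :
    HomG k μ lam :=
  (gMap Ω₁.op).comp (gMap Ω₂)

/-- The index set: `ν ≤ lam ∧ μ` (equivalently `ν ≤ lam` and `ν ≤ μ`), together with an orbit
of permissible embeddings of `ν`-flags into `lam`-flags and one into `μ`-flags. -/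
abbrev Index (k : Type*) [Field k] {n : ℕ} (lam μ : n.Partition) : Type _ :=
  (ν : {ν : n.Partition // OppDomLE ν lam ∧ OppDomLE ν μ}) ×
    (PermOrbits k ν.1 lam × PermOrbits k ν.1 μ)

/-- The pull-back `F_lam → F_{(1^n)}` along the map taking a complete flag to its
`lam`-coarsening. -/
def pullback (k : Type*) [Field k] {n : ℕ} (lam : n.Partition) : HomG k lam (ones n) where
  toFun f x := f (coarsen lam x)
  map_add' _ _ := rfl
  map_smul' _ _ := rfl
  isIntertwining' _ := rfl

/-- The push-forward `F_{(1^n)} → F_μ`: summation over the complete flags refining a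
given `μ`-flag. -/
def pushforward (k : Type*) [Field k] [Finite k] {n : ℕ} (μ : n.Partition) :
    HomG k (ones n) μ where
  toFun f y := ∑ x ∈ Finset.univ.filter
    (fun x : FlagOf k (ones n) => coarsen μ x = y), f x
  map_add' f f' := by
    funext x
    exact Finset.sum_add_distrib
  map_smul' a f := by
    funext x
    exact (Finset.mul_sum _ _ _).symm
  isIntertwining' g := by
    apply LinearMap.ext
    intro f
    funext y
    change ∑ x ∈ Finset.univ.filter
        (fun x : FlagOf k (ones n) => coarsen μ x = y), f (g⁻¹ • x) =
      ∑ x ∈ Finset.univ.filter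
        (fun x : FlagOf k (ones n) => coarsen μ x = g⁻¹ • y), f x
    refine Finset.sum_equiv (MulAction.toPerm g⁻¹) ?_ (fun _ _ => rfl)
    intro x
    simp [coarsen_smul]

/-- The map `A ↦ Â` from `Hom_G(F_μ, F_lam)` to `End_G(F_{(1^n)})`: if `A` has kernel `K`, that is
`(A f)(x) = ∑_y K(x, y) f(y)`, then `Â` has the kernel `K` pulled back to pairs of
complete flags. -/
def inflate [Finite k] {lam μ : n.Partition} (A : HomG k μ lam) : HomG k (ones n) (ones n) :=
  (pullback k lam).comp (A.comp (pushforward k μ))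

end Flags

end FlagHecke

end

open FlagHecke

noncomputable section

namespace FlagHecke

open scoped Classical

set_option linter.unusedSectionVars false

open Module

/-! ### Leading positions of subspaces -/

section Leading

variable {k : Type*} [Field k] {n : ℕ}

/-! Two flags always have a common adapted basis (Bruhat decomposition,
`exists_unip_smul_wordFlag`). Hence the `G`-orbit of a pair is determined by its intersection
matrix, and the operators `gMap Ω` form a basis of `HomG k μ lam` (`orbitBasis`). For complete flags
the orbits are indexed by permutations. The `|k|` flags in simple relative position to a given one
yield the Hecke relations, and the resulting map from the Hecke algebra is bijective
(`heckeHom_bijective`).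

The element `m_ν` acts by summing over the complete refinements of a `ν`-flag and pulling back.
Given a `ν`-flag `z` and a complete flag `y`, exactly one complete refinement of `z` has position
`d(θ)` relative to `y` with `θ` increasing along rows. So applying the sum of the `T_{d(θ)}` over
the standard `θ` above `Θ` and then pushing forward to `ν`-flags is the same as pushing forward to
`μ`-flags and then applying `g_Ω` (`pushforward_comp_sum`). Together with the transposed identity
this identifies the Murphy elements with the inflated `c^ν` (`heckeEquiv_murphyElt`). Pull-back
followed by push-forward on `ν`-flags is the scalar `|P_ν|/|B|`; this explains the factor in the
product and identifies `m_λ H m_μ` with the inflated maps.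

Linear independence uses characters of the group `U` of lower unitriangular matrices. The boxes of
`ν` are numbered up the columns, and the character is nontrivial exactly on the simple root
positions inside the columns. A coordinate flag in the support of a `U`-equivariant function
corresponds to a column-strict filling of `ν`. Therefore equivariant functions on `κ`-flags vanish
unless `ν ≤ κ`, and on `ν`-flags they live on a single `U`-orbit. In a linear relation, let `ν` be
maximal among the partitions that occur. Twisted averaging of the kernels over `U × U` leaves only
the terms of `ν`, and these split into two matrices of twisted counts, triangular with nonzero
diagonal (`eq_zero_of_sum_twistedCount`). So the coefficients vanish.

Finally, growth diagrams realise the Robinson-Schensted-Knuth correspondence as an injection of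
intersection matrices into pairs of semistandard tableaux of equal shape. Thus there are at most as
many orbits as indices (`card_orbits_le`), and the independent family is a basis. -/

/-- The vectors whose coordinates at the positions `p` with `a p < j` vanish. -/
def wordSpace (k : Type*) [Field k] {n : ℕ} (a : Fin n → Fin n) (j : ℕ) :
    Submodule k (Fin n → k) where
  carrier := {v | ∀ p, (a p : ℕ) < j → v p = 0}
  add_mem' hv hw p hp := by simp [hv p hp, hw p hp]
  zero_mem' _ _ := rfl
  smul_mem' c v hv p hp := by simp [hv p hp]

theorem mem_wordSpace {a : Fin n → Fin n} {j : ℕ} {v : Fin n → k} :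
    v ∈ wordSpace k a j ↔ ∀ p, (a p : ℕ) < j → v p = 0 := Iff.rfl

/-- The positions at which some vector of `W` has its first nonzero coordinate. -/
def lead (W : Submodule k (Fin n → k)) : Finset (Fin n) :=
  Finset.univ.filter fun p => ∃ v ∈ W, v p = 1 ∧ ∀ q < p, v q = 0

theorem mem_lead {W : Submodule k (Fin n → k)} {p : Fin n} :
    p ∈ lead W ↔ ∃ v ∈ W, v p = 1 ∧ ∀ q < p, v q = 0 := by simp [lead]

theorem lead_mono {W W' : Submodule k (Fin n → k)} (h : W ≤ W') : lead W ⊆ lead W' := by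
  intro p hp
  rw [mem_lead] at hp ⊢
  obtain ⟨v, hv, h1⟩ := hp
  exact ⟨v, h hv, h1⟩

theorem finrank_comap_subtype (A C : Submodule k (Fin n → k)) :
    finrank k (C.comap A.subtype) = finrank k ↥(A ⊓ C) := by
  rw [← Submodule.map_comap_subtype A C]
  exact (LinearEquiv.finrank_eq
    (Submodule.equivMapOfInjective _ (Submodule.injective_subtype A) _))

/-- Descending induction on `m`: passing from `m` to `m + 1` intersects with the kernel of the
coordinate at `m`, and that coordinate is nonzero on the space exactly when `m` is a leading
position. The case `m = 0` says that a subspace has as many leading positions as its dimension. -/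
theorem finrank_inf_tail (W : Submodule k (Fin n → k)) (m : ℕ) (hm : m ≤ n) :
    finrank k ↥(W ⊓ wordSpace k id m) = ((lead W).filter fun p : Fin n => m ≤ (p : ℕ)).card := by
  induction hd : n - m generalizing m with
  | zero =>
    have hm' : m = n := by omega
    subst hm'
    have h1 : W ⊓ wordSpace k id m = ⊥ := by
      rw [eq_bot_iff]
      rintro v ⟨-, hv⟩
      rw [Submodule.mem_bot]
      funext p
      exact hv p p.2
    rw [h1, finrank_bot, eq_comm, Finset.card_eq_zero, Finset.filter_eq_empty_iff]
    intro p _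
    have := p.2
    omega
  | succ d ih =>
    have hlt : m < n := by omega
    have ih := ih (m + 1) hlt (by omega)
    set p : Fin n := ⟨m, hlt⟩ with hp
    let f : ↥(W ⊓ wordSpace k id m) →ₗ[k] k :=
      (LinearMap.proj p).domRestrict (W ⊓ wordSpace k id m)
    have hker : finrank k (LinearMap.ker f) = finrank k ↥(W ⊓ wordSpace k id (m + 1)) := by
      have : LinearMap.ker f = (LinearMap.ker (LinearMap.proj p : (Fin n → k) →ₗ[k] k)).comap
          (W ⊓ wordSpace k id m).subtype := rfl
      rw [this, finrank_comap_subtype]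
      refine congrArg (fun C : Submodule k (Fin n → k) => finrank k C) ?_
      ext v
      simp only [Submodule.mem_inf, mem_wordSpace, LinearMap.mem_ker, LinearMap.proj_apply, id]
      constructor
      · rintro ⟨⟨h1, h2⟩, h3⟩
        refine ⟨h1, fun q hq => ?_⟩
        rcases Nat.lt_succ_iff_lt_or_eq.1 hq with h | h
        · exact h2 q h
        · have : q = p := Fin.ext h
          rw [this, h3]
      · rintro ⟨h1, h2⟩
        exact ⟨⟨h1, fun q hq => h2 q (by omega)⟩, h2 p (by simp [hp])⟩
    have hrn := LinearMap.finrank_range_add_finrank_ker f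
    rw [hker, ih] at hrn
    rw [← hrn]
    by_cases hl : p ∈ lead W
    · have hr : LinearMap.range f = ⊤ := by
        rw [LinearMap.range_eq_top]
        obtain ⟨v, hv, h1, h2⟩ := mem_lead.1 hl
        intro c
        refine ⟨⟨c • v, Submodule.smul_mem _ _ ⟨hv, fun q hq => h2 q hq⟩⟩, ?_⟩
        simp [f, h1]
      rw [hr, finrank_top, finrank_self]
      have : (lead W).filter (fun q : Fin n => m ≤ (q : ℕ)) =
          insert p ((lead W).filter fun q : Fin n => m + 1 ≤ (q : ℕ)) := by
        ext q
        simp only [Finset.mem_filter, Finset.mem_insert]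
        constructor
        · rintro ⟨h1, h2⟩
          rcases Nat.eq_or_lt_of_le h2 with h | h
          · exact Or.inl (Fin.ext h.symm)
          · exact Or.inr ⟨h1, h⟩
        · rintro (rfl | ⟨h1, h2⟩)
          · exact ⟨hl, le_refl m⟩
          · exact ⟨h1, by omega⟩
      rw [this, Finset.card_insert_of_notMem (by simp [hp]), add_comm]
    · have hr : LinearMap.range f = ⊥ := by
        rw [eq_bot_iff]
        rintro _ ⟨⟨v, hv, hv2⟩, rfl⟩
        rw [Submodule.mem_bot]
        by_contra hne
        change v p ≠ 0 at hne
        refine hl (mem_lead.2 ⟨(v p)⁻¹ • v, Submodule.smul_mem _ _ hv, ?_, fun q hq => ?_⟩)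
        · simp [hne]
        · simp [hv2 q hq]
      rw [hr, finrank_bot, zero_add]
      congr 1
      apply Finset.filter_congr
      intro q hq
      have : q ≠ p := fun h => hl (h ▸ hq)
      have : (q : ℕ) ≠ m := fun h => this (Fin.ext h)
      omega

theorem finrank_eq_card_lead (W : Submodule k (Fin n → k)) : finrank k W = (lead W).card := by
  have h := finrank_inf_tail W 0 (Nat.zero_le n)
  have h1 : W ⊓ wordSpace k id 0 = W := by
    rw [inf_eq_left]
    intro v _ q hq
    omega
  rw [h1] at h
  simpa using h

theorem lead_wordSpace (a : Fin n → Fin n) (j : ℕ) :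
    lead (wordSpace k a j) = Finset.univ.filter fun p => j ≤ (a p : ℕ) := by
  ext p
  rw [mem_lead, Finset.mem_filter]
  constructor
  · rintro ⟨v, hv, h1, -⟩
    refine ⟨Finset.mem_univ _, ?_⟩
    by_contra h
    rw [hv p (by omega)] at h1
    exact zero_ne_one h1
  · rintro ⟨-, h⟩
    refine ⟨Pi.single p 1, fun q hq => ?_, by simp, fun q hq => ?_⟩
    · rw [Pi.single_eq_of_ne]
      rintro rfl
      omega
    · rw [Pi.single_eq_of_ne hq.ne]

theorem finrank_wordSpace (a : Fin n → Fin n) (j : ℕ) :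
    finrank k (wordSpace k a j) = (Finset.univ.filter fun p => j ≤ (a p : ℕ)).card := by
  rw [finrank_eq_card_lead, lead_wordSpace]

end Leading

/-! ### Word flags -/

section WordFlags

variable {k : Type*} [Field k] {n : ℕ}

/-- The letter `j` occurs `κ_{j+1}` times in the word `a`. -/
def IsWord (κ : n.Partition) (a : Fin n → Fin n) : Prop :=
  ∀ j, (Finset.univ.filter fun p => a p = j).card = row κ j

theorem card_filter_le_val (a : Fin n → Fin n) (j : Fin n) :
    (Finset.univ.filter fun p => (j : ℕ) ≤ (a p : ℕ)).card =
      (Finset.univ.filter fun p => (j : ℕ) + 1 ≤ (a p : ℕ)).card +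
        (Finset.univ.filter fun p => a p = j).card := by
  rw [← Finset.card_union_of_disjoint]
  · congr 1
    ext p
    simp only [Finset.mem_filter, Finset.mem_union, Finset.mem_univ, true_and, Fin.ext_iff]
    omega
  · rw [Finset.disjoint_filter]
    rintro p - h rfl
    omega

theorem wordSpace_antitone (a : Fin n → Fin n) : Antitone (wordSpace k a) :=
  fun _ _ h _ hv p hp => hv p (by omega)

/-- The coordinate flag attached to a word. -/
def wordFlag (k : Type*) [Field k] {n : ℕ} {κ : n.Partition} {a : Fin n → Fin n}
    (h : IsWord κ a) : FlagOf k κ where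
  space j := wordSpace k a j
  antitone _ _ hij := wordSpace_antitone a hij
  top := by
    rw [eq_top_iff]
    intro v _ p hp
    simp at hp
  step j := by
    rw [finrank_wordSpace, finrank_wordSpace, ← h j]
    exact card_filter_le_val a j

theorem mem_wordFlag {κ : n.Partition} {a : Fin n → Fin n} (h : IsWord κ a) (j : Fin (n + 1))
    (v : Fin n → k) : v ∈ (wordFlag k h).space j ↔ ∀ p, (a p : ℕ) < j → v p = 0 := Iff.rfl

/-- The letter `a p` is the largest `j` for which `p` is a leading position of the `j`-th subspace.
-/
theorem wordFlag_injective {κ : n.Partition} {a b : Fin n → Fin n} (ha : IsWord κ a)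
    (hb : IsWord κ b) (h : wordFlag k ha = wordFlag k hb) : a = b := by
  funext p
  apply Fin.ext
  have key : ∀ j : Fin (n + 1), (j : ℕ) ≤ a p ↔ (j : ℕ) ≤ b p := by
    intro j
    have h1 : lead (wordSpace k a j) = lead (wordSpace k b j) :=
      congrArg (fun x : FlagOf k κ => lead (x.space j)) h
    rw [lead_wordSpace, lead_wordSpace] at h1
    simpa using Finset.ext_iff.1 h1 p
  apply le_antisymm
  · exact (key ⟨a p, by omega⟩).1 le_rfl
  · exact (key ⟨b p, by omega⟩).2 le_rfl

theorem FlagOf.eq_of_le {κ : n.Partition} {x y : FlagOf k κ} (h : ∀ i, x.space i ≤ y.space i) :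
    x = y := by
  apply FlagOf.ext
  funext i
  apply Submodule.eq_of_le_of_finrank_eq (h i)
  have h1 := x.finrank_add i
  have h2 := y.finrank_add i
  omega

theorem FlagOf.space_last {κ : n.Partition} (x : FlagOf k κ) : x.space (Fin.last n) = ⊥ := by
  have h := x.finrank_add (Fin.last n)
  rw [Fin.val_last, partialSum_top] at h
  exact Submodule.finrank_eq_zero.1 (by omega)

theorem mem_smul_space {κ : n.Partition} (g : Matrix.GeneralLinearGroup (Fin n) k)
    (x : FlagOf k κ) (i : Fin (n + 1)) (v : Fin n → k) :
    v ∈ (g • x).space i ↔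
      ((g⁻¹ : Matrix.GeneralLinearGroup (Fin n) k) : Matrix (Fin n) (Fin n) k).mulVec v ∈
        x.space i := by
  rw [smul_space, Submodule.mem_map]
  constructor
  · rintro ⟨w, hw, rfl⟩
    rwa [Matrix.mulVecLin_apply, Matrix.mulVec_mulVec, ← Units.val_mul, inv_mul_cancel,
      Units.val_one, Matrix.one_mulVec]
  · intro h
    refine ⟨_, h, ?_⟩
    rw [Matrix.mulVecLin_apply, Matrix.mulVec_mulVec, ← Units.val_mul, mul_inv_cancel,
      Units.val_one, Matrix.one_mulVec]

theorem mulVec_mem_smul_space {κ : n.Partition} (g : Matrix.GeneralLinearGroup (Fin n) k)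
    (x : FlagOf k κ) (i : Fin (n + 1)) {v : Fin n → k} (hv : v ∈ x.space i) :
    (g : Matrix (Fin n) (Fin n) k).mulVec v ∈ (g • x).space i :=
  Submodule.mem_map_of_mem (f := Matrix.mulVecLin (g : Matrix (Fin n) (Fin n) k)) hv

/-- To show `g • x = y` it suffices that `g` maps `x` into `y`. -/
theorem smul_eq_of_mapsTo {κ : n.Partition} {g : Matrix.GeneralLinearGroup (Fin n) k}
    {x y : FlagOf k κ} (h : ∀ i, ∀ v ∈ x.space i,
      (g : Matrix (Fin n) (Fin n) k).mulVec v ∈ y.space i) : g • x = y := by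
  apply FlagOf.eq_of_le
  rintro i _ ⟨v, hv, rfl⟩
  exact h i v hv

end WordFlags

/-! ### Unitriangular matrices and the Bruhat decomposition -/

section Bruhat

variable {k : Type*} [Field k] {n : ℕ}

/-- Lower unitriangular invertible matrices. -/
def unipSubmonoid (k : Type*) [Field k] (n : ℕ) :
    Submonoid (Matrix.GeneralLinearGroup (Fin n) k) where
  carrier := {g | ∀ p q : Fin n, p ≤ q →
    (g : Matrix (Fin n) (Fin n) k) p q = if p = q then 1 else 0}
  one_mem' p q _ := by simp [Matrix.one_apply]
  mul_mem' {g h} hg hh p q hpq := by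
    rw [Units.val_mul, Matrix.mul_apply, Finset.sum_eq_single p]
    · rw [hg p p le_rfl, hh p q hpq, if_pos rfl, one_mul]
    · intro r _ hr
      rcases lt_or_gt_of_ne hr with h1 | h1
      · rw [hh r q (h1.le.trans hpq), if_neg (h1.trans_le hpq).ne, mul_zero]
      · rw [hg p r h1.le, if_neg h1.ne, zero_mul]
    · simp

/-- The group of lower unitriangular matrices. -/
def unip (k : Type*) [Field k] [Finite k] (n : ℕ) :
    Subgroup (Matrix.GeneralLinearGroup (Fin n) k) where
  __ := unipSubmonoid k n
  inv_mem' {g} hg := by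
    -- The group is finite, so inverses are powers and the submonoid is closed under them.
    have h : g⁻¹ = g ^ (orderOf g - 1) := by
      rw [inv_eq_iff_mul_eq_one, ← pow_succ', Nat.sub_add_cancel (orderOf_pos g),
        pow_orderOf_eq_one]
    rw [h]
    exact (unipSubmonoid k n).pow_mem hg _

/-- A lower unitriangular matrix changes a coordinate only by multiples of earlier ones, so it
preserves the leading position and the leading coefficient. -/
theorem unip_mulVec_lead {g : Matrix.GeneralLinearGroup (Fin n) k} (hg : g ∈ unipSubmonoid k n)
    {v : Fin n → k} {p : Fin n} (hv : ∀ q < p, v q = 0) :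
    (∀ q < p, (g : Matrix (Fin n) (Fin n) k).mulVec v q = 0) ∧
      (g : Matrix (Fin n) (Fin n) k).mulVec v p = v p := by
  constructor
  · intro q hq
    rw [Matrix.mulVec, dotProduct]
    apply Finset.sum_eq_zero
    intro r _
    by_cases hr : r < p
    · rw [hv r hr, mul_zero]
    · rw [hg q r (by omega), if_neg (by omega), zero_mul]
  · rw [Matrix.mulVec, dotProduct, Finset.sum_eq_single p]
    · rw [hg p p le_rfl, if_pos rfl, one_mul]
    · intro r _ hr
      by_cases h : r < p
      · rw [hv r h, mul_zero]
      · rw [hg p r (by omega), if_neg (by omega), zero_mul]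
    · simp

theorem lead_unip_smul [Finite k] {κ : n.Partition} {g : Matrix.GeneralLinearGroup (Fin n) k}
    (hg : g ∈ unip k n) (x : FlagOf k κ) (i : Fin (n + 1)) :
    lead ((g • x).space i) = lead (x.space i) := by
  have key : ∀ (g : Matrix.GeneralLinearGroup (Fin n) k) (_ : g ∈ unip k n) (x : FlagOf k κ),
      lead (x.space i) ⊆ lead ((g • x).space i) := by
    intro g hg x p hp
    obtain ⟨v, hv, h1, h2⟩ := mem_lead.1 hp
    obtain ⟨h3, h4⟩ := unip_mulVec_lead hg h2
    exact mem_lead.2 ⟨_, mulVec_mem_smul_space g x i hv, h4.trans h1, h3⟩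
  apply (key g hg x).antisymm'
  have h := key g⁻¹ (inv_mem hg) (g • x)
  rwa [inv_smul_smul] at h

/-- Bruhat decomposition. The letter at `p` is the last index whose subspace still has `p` as a
leading position. Vectors of these subspaces with leading coefficient one at `p` are the columns of
a lower unitriangular matrix carrying the coordinate flag to `x`. -/
theorem exists_unip_smul_wordFlag [Finite k] {κ : n.Partition} (x : FlagOf k κ) :
    ∃ u ∈ unip k n, ∃ (a : Fin n → Fin n) (h : IsWord κ a), x = u • wordFlag k h := by
  have hall : ∀ p : Fin n, p ∈ lead (x.space 0) := by
    intro p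
    rw [x.top, mem_lead]
    exact ⟨Pi.single p 1, trivial, by simp, fun q hq => Pi.single_eq_of_ne hq.ne _⟩
  have hlast : ∀ p : Fin n, p ∉ lead (x.space (Fin.last n)) := by
    intro p hp
    rw [x.space_last] at hp
    obtain ⟨v, hv, h1, -⟩ := mem_lead.1 hp
    rw [Submodule.mem_bot] at hv
    simp [hv] at h1
  have hex : ∀ p : Fin n, ∃ a : Fin n, ∀ j : Fin (n + 1),
      p ∈ lead (x.space j) ↔ (j : ℕ) ≤ a := by
    intro p
    let S : Finset (Fin (n + 1)) := Finset.univ.filter fun j => p ∈ lead (x.space j)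
    have hS : S.Nonempty := ⟨0, by simp [S, hall p]⟩
    have hmem : p ∈ lead (x.space (S.max' hS)) := by
      have := S.max'_mem hS
      simpa [S] using this
    have hne : S.max' hS ≠ Fin.last n := fun h => hlast p (h ▸ hmem)
    have hlt : (S.max' hS : ℕ) < n := by
      have := Fin.val_lt_last hne
      simpa using this
    refine ⟨⟨S.max' hS, hlt⟩, fun j => ⟨fun hj => ?_, fun hj => ?_⟩⟩
    · exact S.le_max' j (by simp [S, hj])
    · exact lead_mono (x.antitone hj) hmem
  choose a ha using hex
  have hv : ∀ p : Fin n, ∃ v ∈ x.space (a p).castSucc, v p = 1 ∧ ∀ q < p, v q = 0 :=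
    fun p => mem_lead.1 ((ha p _).2 le_rfl)
  choose v hvx hv1 hv0 using hv
  let M : Matrix (Fin n) (Fin n) k := Matrix.of fun q p => v p q
  have hdet : M.det = 1 := by
    rw [Matrix.det_of_isLowerTriangular]
    · exact Finset.prod_eq_one fun p _ => hv1 p
    · intro p q hpq
      exact hv0 q p hpq
  let u : Matrix.GeneralLinearGroup (Fin n) k :=
    Matrix.GeneralLinearGroup.mkOfDetNeZero M (by rw [hdet]; exact one_ne_zero)
  have hu : u ∈ unip k n := by
    intro p q hpq
    change v q p = _
    split_ifs with h
    · rw [h, hv1]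
    · exact hv0 q p (lt_of_le_of_ne hpq h)
  have hw : IsWord κ a := by
    intro j
    have h1 := card_filter_le_val a j
    have h2 : ∀ j : Fin (n + 1), (Finset.univ.filter fun p => (j : ℕ) ≤ (a p : ℕ)).card =
        finrank k (x.space j) := by
      intro j
      rw [finrank_eq_card_lead]
      congr 1
      ext p
      simp [ha p j]
    have h3 := h2 j.castSucc
    have h4 := h2 j.succ
    have h5 := x.step j
    simp only [Fin.val_castSucc, Fin.val_succ] at h3 h4
    omega
  refine ⟨u, hu, a, hw, (smul_eq_of_mapsTo fun i w hwi => ?_).symm⟩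
  change M.mulVec w ∈ _
  rw [Matrix.mulVec_eq_sum]
  refine Submodule.sum_mem _ fun p _ => ?_
  by_cases hp : (a p : ℕ) < i
  · rw [mem_wordFlag] at hwi
    simp [hwi p hp]
  · rw [op_smul_eq_smul]
    exact Submodule.smul_mem _ _ (x.antitone (by simpa [Fin.le_def] using hp) (hvx p))

end Bruhat

/-! ### Intersection matrices and orbits -/

section Counting

theorem exists_perm_of_card_fiber_eq {n : ℕ} {α : Type*} [DecidableEq α] (f g : Fin n → α)
    (h : ∀ c, (Finset.univ.filter fun p => f p = c).card =
      (Finset.univ.filter fun p => g p = c).card) :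
    ∃ π : Equiv.Perm (Fin n), ∀ p, g (π p) = f p := by
  have e : ∀ c, Nonempty ({p // f p = c} ≃ {p // g p = c}) := by
    intro c
    apply Fintype.card_eq.1
    rw [Fintype.card_subtype, Fintype.card_subtype, h]
  let e' := fun c => (e c).some
  refine ⟨(Equiv.sigmaFiberEquiv f).symm.trans
    ((Equiv.sigmaCongrRight e').trans (Equiv.sigmaFiberEquiv g)), fun p => ?_⟩
  exact ((e' (f p)) ⟨p, rfl⟩).2

/-- Inclusion-exclusion at a corner, written additively and checked point by point; the
combinatorial counterpart of `intMatrix_add`. -/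
theorem card_corner {ι : Type*} [Fintype ι] (a b : ι → ℕ) (i j : ℕ) :
    (Finset.univ.filter fun p => a p = i ∧ b p = j).card +
      (Finset.univ.filter fun p => i ≤ a p ∧ j + 1 ≤ b p).card +
      (Finset.univ.filter fun p => i + 1 ≤ a p ∧ j ≤ b p).card =
    (Finset.univ.filter fun p => i ≤ a p ∧ j ≤ b p).card +
      (Finset.univ.filter fun p => i + 1 ≤ a p ∧ j + 1 ≤ b p).card := by
  simp only [Finset.card_filter]
  rw [← Finset.sum_add_distrib, ← Finset.sum_add_distrib, ← Finset.sum_add_distrib]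
  refine Finset.sum_congr rfl fun p _ => ?_
  split_ifs <;> omega

end Counting

section IntMatrix

variable {k : Type*} [Field k] {n : ℕ} {lam μ lam' μ' : n.Partition}

/-- The matrix entry is a mixed second difference of the dimensions of intersections, by the formula
for `dim (A + B)`; the additive form avoids truncated subtraction. -/
theorem intMatrix_add (x : FlagOf k lam) (y : FlagOf k μ) (i j : Fin n) :
    intMatrix x y i j + finrank k ↥(x.space i.castSucc ⊓ y.space j.succ) +
      finrank k ↥(x.space i.succ ⊓ y.space j.castSucc) =
    finrank k ↥(x.space i.castSucc ⊓ y.space j.castSucc) +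
      finrank k ↥(x.space i.succ ⊓ y.space j.succ) := by
  have hx : x.space i.succ ≤ x.space i.castSucc := x.antitone Fin.castSucc_lt_succ.le
  have hy : y.space j.succ ≤ y.space j.castSucc := y.antitone Fin.castSucc_lt_succ.le
  have hle : (x.space i.castSucc ⊓ y.space j.succ) ⊔ (x.space i.succ ⊓ y.space j.castSucc) ≤
      x.space i.castSucc ⊓ y.space j.castSucc :=
    sup_le (inf_le_inf_left _ hy) (inf_le_inf_right _ hx)
  have h1 := Submodule.finrank_quotient_add_finrank
    (((x.space i.castSucc ⊓ y.space j.succ) ⊔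
      (x.space i.succ ⊓ y.space j.castSucc)).submoduleOf
        (x.space i.castSucc ⊓ y.space j.castSucc))
  rw [LinearEquiv.finrank_eq (Submodule.submoduleOfEquivOfLe hle)] at h1
  have h2 := Submodule.finrank_sup_add_finrank_inf_eq
    (x.space i.castSucc ⊓ y.space j.succ) (x.space i.succ ⊓ y.space j.castSucc)
  have h3 : (x.space i.castSucc ⊓ y.space j.succ) ⊓ (x.space i.succ ⊓ y.space j.castSucc) =
      x.space i.succ ⊓ y.space j.succ :=
    le_antisymm (le_inf (inf_le_right.trans inf_le_left) (inf_le_left.trans inf_le_right))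
      (le_inf (inf_le_inf_right _ hx) (inf_le_inf_left _ hy))
  rw [h3] at h2
  unfold intMatrix
  omega

/-- The second differences are summed back from the last indices, where the subspaces vanish; this
recovers every dimension of an intersection. -/
theorem intMatrix_eq_iff (x : FlagOf k lam) (y : FlagOf k μ) (x' : FlagOf k lam')
    (y' : FlagOf k μ') : intMatrix x y = intMatrix x' y' ↔
      (∀ i, finrank k (x.space i) = finrank k (x'.space i)) ∧
      (∀ i, finrank k (y.space i) = finrank k (y'.space i)) ∧
      ∀ i j, finrank k ↥(x.space i ⊓ y.space j) = finrank k ↥(x'.space i ⊓ y'.space j) := by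
  constructor
  · intro h
    have key : ∀ i j, finrank k ↥(x.space i ⊓ y.space j) =
        finrank k ↥(x'.space i ⊓ y'.space j) := by
      intro i
      induction i using Fin.reverseInduction with
      | last =>
        intro j
        rw [x.space_last, x'.space_last, bot_inf_eq, bot_inf_eq]
      | cast i ih =>
        intro j
        induction j using Fin.reverseInduction with
        | last => rw [y.space_last, y'.space_last, inf_bot_eq, inf_bot_eq]
        | cast j ihj =>
          have h1 := intMatrix_add x y i j
          have h2 := intMatrix_add x' y' i j
          rw [h] at h1
          have h3 := ih j.castSucc
          have h4 := ih j.succ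
          omega
    refine ⟨fun i => ?_, fun i => ?_, key⟩
    · have := key i 0
      rwa [y.top, y'.top, inf_top_eq, inf_top_eq] at this
    · have := key 0 i
      rwa [x.top, x'.top, top_inf_eq, top_inf_eq] at this
  · rintro ⟨-, -, h⟩
    funext i j
    have h1 := intMatrix_add x y i j
    have h2 := intMatrix_add x' y' i j
    rw [h, h, h, h] at h1
    omega

theorem intMatrix_swap (x : FlagOf k lam) (y : FlagOf k μ) (i j : Fin n) :
    intMatrix y x i j = intMatrix x y j i := by
  have h1 := intMatrix_add x y j i
  have h2 := intMatrix_add y x i j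
  rw [inf_comm (y.space i.castSucc), inf_comm (y.space i.castSucc), inf_comm (y.space i.succ),
    inf_comm (y.space i.succ)] at h2
  omega

theorem lead_wordSpace_inf (a b : Fin n → Fin n) (i j : ℕ) :
    lead (wordSpace k a i ⊓ wordSpace k b j) =
      Finset.univ.filter fun p => i ≤ (a p : ℕ) ∧ j ≤ (b p : ℕ) := by
  apply subset_antisymm
  · intro p hp
    have h1 := lead_mono inf_le_left hp
    have h2 := lead_mono inf_le_right hp
    rw [lead_wordSpace, Finset.mem_filter] at h1 h2
    simp [h1.2, h2.2]
  · intro p hp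
    rw [Finset.mem_filter] at hp
    refine mem_lead.2 ⟨Pi.single p 1, ⟨fun q hq => ?_, fun q hq => ?_⟩, by simp, fun q hq => ?_⟩
    · rw [Pi.single_eq_of_ne]
      rintro rfl
      omega
    · rw [Pi.single_eq_of_ne]
      rintro rfl
      omega
    · rw [Pi.single_eq_of_ne hq.ne]

theorem finrank_wordFlag_inf {a b : Fin n → Fin n} (ha : IsWord lam a) (hb : IsWord μ b)
    (i j : Fin (n + 1)) :
    finrank k ↥((wordFlag k ha).space i ⊓ (wordFlag k hb).space j) =
      (Finset.univ.filter fun p => (i : ℕ) ≤ (a p : ℕ) ∧ (j : ℕ) ≤ (b p : ℕ)).card := by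
  rw [finrank_eq_card_lead]
  exact congrArg _ (lead_wordSpace_inf a b i j)

/-- The number of positions at which `a` has the letter `i` and `b` has the letter `j`. -/
def jointCount {ι : Type*} [Fintype ι] (a b : ι → Fin n) (i j : Fin n) : ℕ :=
  (Finset.univ.filter fun p => a p = i ∧ b p = j).card

theorem intMatrix_wordFlag {a b : Fin n → Fin n} (ha : IsWord lam a) (hb : IsWord μ b) :
    intMatrix (wordFlag k ha) (wordFlag k hb) = jointCount a b := by
  funext i j
  have h := intMatrix_add (wordFlag k ha) (wordFlag k hb) i j
  simp only [finrank_wordFlag_inf, Fin.val_castSucc, Fin.val_succ] at h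
  have h2 := card_corner (fun p => (a p : ℕ)) (fun p => (b p : ℕ)) i j
  simp only [← Fin.ext_iff] at h2
  unfold jointCount
  omega

theorem jointCount_comp_equiv {ι κ : Type*} [Fintype ι] [Fintype κ] (e : ι ≃ κ)
    (a b : κ → Fin n) : jointCount (a ∘ e) (b ∘ e) = jointCount a b := by
  funext i j
  exact Finset.card_equiv e (by simp)

/-- The invertible matrix of a permutation of the coordinates. -/
def permGL (k : Type*) [Field k] {n : ℕ} (π : Equiv.Perm (Fin n)) :
    Matrix.GeneralLinearGroup (Fin n) k where
  val := π.permMatrix k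
  inv := π⁻¹.permMatrix k
  val_inv := by rw [← Matrix.permMatrix_mul, inv_mul_cancel, Matrix.permMatrix_one]
  inv_val := by rw [← Matrix.permMatrix_mul, mul_inv_cancel, Matrix.permMatrix_one]

theorem permGL_smul_wordFlag (π : Equiv.Perm (Fin n)) {a b : Fin n → Fin n}
    (ha : IsWord lam a) (hb : IsWord lam b) (h : ∀ p, a (π p) = b p) :
    permGL k π • wordFlag k ha = wordFlag k hb := by
  apply smul_eq_of_mapsTo
  intro i v hv p hp
  change (π.permMatrix k).mulVec v p = 0
  rw [Matrix.permMatrix_mulVec]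
  exact hv (π p) (by rwa [h])

/-! ### Blocks and coarsenings of complete flags -/

theorem rowReading_val (ν : n.Partition) (b : Cell ν) :
    (rowReading ν b : ℕ) = partialSum ν b.1 + b.2 := by
  unfold rowReading partialSum
  rw [Equiv.trans_apply, finCongr_apply, Fin.val_cast, finSigmaFinEquiv_apply,
    ← Fin.sum_univ_eq_sum_range]
  rfl

theorem partialSum_mono (ν : n.Partition) : Monotone (partialSum ν) := fun _ _ h =>
  Finset.sum_le_sum_of_subset (Finset.range_subset_range.2 h)

theorem partialSum_succ (ν : n.Partition) (i : ℕ) :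
    partialSum ν (i + 1) = partialSum ν i + row ν i := Finset.sum_range_succ _ _

/-- Translates between the indexing of a complete flag by dimension and the indexing of its
coarsening by blocks. -/
theorem lt_partialSum_iff (ν : n.Partition) (r : Fin n) (i : ℕ) :
    (r : ℕ) < partialSum ν i ↔ (block ν r : ℕ) < i := by
  obtain ⟨⟨j, c⟩, rfl⟩ := (rowReading ν).surjective r
  rw [rowReading_val, block, Equiv.symm_apply_apply]
  change partialSum ν j + (c : ℕ) < partialSum ν i ↔ (j : ℕ) < i
  have hc : (c : ℕ) < row ν j := c.2
  have hj := partialSum_succ ν j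
  constructor
  · intro h
    by_contra hij
    have := partialSum_mono ν (not_lt.1 hij)
    omega
  · intro h
    have : partialSum ν (j + 1) ≤ partialSum ν i := partialSum_mono ν (Nat.succ_le_of_lt h)
    omega

theorem block_mono (ν : n.Partition) : Monotone (block ν) := by
  intro r s h
  by_contra hlt
  rw [not_le, Fin.lt_def, ← lt_partialSum_iff] at hlt
  have := (lt_partialSum_iff ν r (block ν r)).1 (lt_of_le_of_lt h hlt)
  omega

theorem block_rowReading (ν : n.Partition) (b : Cell ν) : block ν (rowReading ν b) = b.1 := by
  rw [block, Equiv.symm_apply_apply]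

theorem isWord_block (ν : n.Partition) : IsWord ν (block ν) := by
  intro j
  rw [← Fintype.card_fin (row ν j), ← Finset.card_univ]
  symm
  refine Finset.card_bij (fun c _ => rowReading ν ⟨j, c⟩) ?_ ?_ ?_
  · intro c _
    simp [block_rowReading]
  · intro c _ c' _ h
    simpa using h
  · intro r hr
    obtain ⟨⟨i, c⟩, rfl⟩ := (rowReading ν).surjective r
    rw [Finset.mem_filter, block_rowReading] at hr
    obtain ⟨-, rfl⟩ := hr
    exact ⟨c, Finset.mem_univ _, rfl⟩

theorem IsWord.comp_perm {a : Fin n → Fin n} (ha : IsWord lam a) (π : Equiv.Perm (Fin n)) :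
    IsWord lam (fun p => a (π p)) := by
  intro j
  rw [← ha j]
  exact Finset.card_equiv π (by simp)

theorem isWord_ones_iff (a : Fin n → Fin n) : IsWord (ones n) a ↔ Function.Bijective a := by
  constructor
  · intro h
    refine (Finite.injective_iff_bijective).1 fun p q hpq => ?_
    have h1 := h (a q)
    rw [row_ones, Finset.card_eq_one] at h1
    obtain ⟨r, hr⟩ := h1
    have hp : p ∈ Finset.univ.filter fun p => a p = a q := by simp [hpq]
    have hq : q ∈ Finset.univ.filter fun p => a p = a q := by simp
    rw [hr, Finset.mem_singleton] at hp hq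
    rw [hp, hq]
  · intro h j
    rw [row_ones, Finset.card_eq_one]
    obtain ⟨p, rfl⟩ := h.2 j
    refine ⟨p, ?_⟩
    ext q
    simp [h.1.eq_iff]

theorem isWord_perm (w : Equiv.Perm (Fin n)) : IsWord (ones n) w :=
  (isWord_ones_iff _).2 w.bijective

/-- The coordinate complete flag attached to a permutation. -/
def permFlag (k : Type*) [Field k] {n : ℕ} (w : Equiv.Perm (Fin n)) : FlagOf k (ones n) :=
  wordFlag k (isWord_perm w)

theorem exists_perm_of_isWord_ones {a : Fin n → Fin n} (h : IsWord (ones n) a) :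
    ∃ w : Equiv.Perm (Fin n), wordFlag k h = permFlag k w :=
  ⟨Equiv.ofBijective a ((isWord_ones_iff a).1 h), rfl⟩

theorem coarsen_permFlag (w : Equiv.Perm (Fin n)) :
    coarsen lam (permFlag k w) = wordFlag k ((isWord_block lam).comp_perm w) := by
  apply FlagOf.ext
  funext i
  ext v
  change (∀ p, (w p : ℕ) < partialSum lam i → v p = 0) ↔ ∀ p, (block lam (w p) : ℕ) < i → v p = 0
  simp only [lt_partialSum_iff]

theorem coarsen_permFlag_one :
    coarsen lam (permFlag k 1) = wordFlag k (isWord_block lam) := coarsen_permFlag 1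

/-! ### Adapted bases -/

/-- This lets a second flag be put in coordinate form without disturbing the first. -/
theorem unip_smul_permFlag_one {u : Matrix.GeneralLinearGroup (Fin n) k}
    (hu : u ∈ unipSubmonoid k n) : u • permFlag k (1 : Equiv.Perm (Fin n)) = permFlag k 1 := by
  apply smul_eq_of_mapsTo
  intro i v hv p hp
  have h : ∀ q < (⟨p + 1, by omega⟩ : Fin (n + 1)), ∀ hq : (q : ℕ) < n, v ⟨q, hq⟩ = 0 := by
    intro q hq hq'
    refine hv ⟨q, hq'⟩ ?_
    change (q : ℕ) < i
    simp only [Fin.lt_def, Equiv.Perm.coe_one, id] at hp hq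
    omega
  have h2 := (unip_mulVec_lead hu (v := v) (p := p)
    (fun q hq => h q.castSucc (Nat.lt_succ_of_lt hq) q.2)).2
  rw [h2]
  exact hv p hp

variable [Finite k]

theorem exists_smul_permFlag_one (x : FlagOf k (ones n)) :
    ∃ g : Matrix.GeneralLinearGroup (Fin n) k, x = g • permFlag k 1 := by
  obtain ⟨u, -, a, ha, rfl⟩ := exists_unip_smul_wordFlag x
  obtain ⟨w, hw⟩ := exists_perm_of_isWord_ones (k := k) ha
  refine ⟨u * permGL k w, ?_⟩
  rw [hw, mul_smul]
  congr 1
  exact (permGL_smul_wordFlag w (isWord_perm 1) (isWord_perm w) fun p => rfl).symm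

/-- After `x` is moved to the standard flag, the unitriangular factor that normalises `y` fixes it.
-/
theorem exists_adapted_complete (x : FlagOf k (ones n)) (y : FlagOf k μ) :
    ∃ (g : Matrix.GeneralLinearGroup (Fin n) k) (b : Fin n → Fin n) (hb : IsWord μ b),
      x = g • permFlag k 1 ∧ y = g • wordFlag k hb := by
  obtain ⟨g, rfl⟩ := exists_smul_permFlag_one x
  obtain ⟨u, hu, b, hb, h⟩ := exists_unip_smul_wordFlag (g⁻¹ • y)
  refine ⟨g * u, b, hb, ?_, ?_⟩
  · rw [mul_smul, unip_smul_permFlag_one hu]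
  · rw [mul_smul, ← h, smul_inv_smul]

theorem coarsen_surjective (lam : n.Partition) :
    Function.Surjective (coarsen lam : FlagOf k (ones n) → FlagOf k lam) := by
  intro x
  obtain ⟨u, -, a, ha, rfl⟩ := exists_unip_smul_wordFlag x
  obtain ⟨π, hπ⟩ := exists_perm_of_card_fiber_eq a (block lam)
    fun c => (ha c).trans (isWord_block lam c).symm
  refine ⟨u • permFlag k π, ?_⟩
  rw [coarsen_smul, coarsen_permFlag]
  congr 1
  simp only [hπ]

theorem exists_adapted (x : FlagOf k lam) (y : FlagOf k μ) :
    ∃ (g : Matrix.GeneralLinearGroup (Fin n) k) (b : Fin n → Fin n) (hb : IsWord μ b),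
      x = g • wordFlag k (isWord_block lam) ∧ y = g • wordFlag k hb := by
  obtain ⟨x, rfl⟩ := coarsen_surjective lam x
  obtain ⟨g, b, hb, rfl, rfl⟩ := exists_adapted_complete x y
  exact ⟨g, b, hb, by rw [coarsen_smul, coarsen_permFlag_one], rfl⟩

theorem exists_adapted_perm (x y : FlagOf k (ones n)) :
    ∃ (g : Matrix.GeneralLinearGroup (Fin n) k) (w : Equiv.Perm (Fin n)),
      x = g • permFlag k 1 ∧ y = g • permFlag k w := by
  obtain ⟨g, b, hb, h1, h2⟩ := exists_adapted_complete x y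
  obtain ⟨w, hw⟩ := exists_perm_of_isWord_ones (k := k) hb
  exact ⟨g, w, h1, hw ▸ h2⟩

-- A permutation of the coordinates that matches the pairs of letters carries one pair of coordinate
-- flags to the other.
omit [Finite k] in
theorem exists_smul_wordFlag_eq {a b a' b' : Fin n → Fin n} (ha : IsWord lam a)
    (hb : IsWord μ b) (ha' : IsWord lam a') (hb' : IsWord μ b')
    (h : jointCount a b = jointCount a' b') :
    ∃ g : Matrix.GeneralLinearGroup (Fin n) k,
      g • wordFlag k ha = wordFlag k ha' ∧ g • wordFlag k hb = wordFlag k hb' := by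
  obtain ⟨π, hπ⟩ := exists_perm_of_card_fiber_eq (fun p => (a' p, b' p)) (fun p => (a p, b p))
    (by
      rintro ⟨i, j⟩
      simp only [Prod.mk.injEq]
      exact (congrFun (congrFun h i) j).symm)
  simp only [Prod.mk.injEq] at hπ
  exact ⟨permGL k π, permGL_smul_wordFlag π ha ha' fun p => (hπ p).1,
    permGL_smul_wordFlag π hb hb' fun p => (hπ p).2⟩

/-- The relative position of two flags is determined by the intersection matrix. -/
theorem exists_smul_eq_of_intMatrix_eq {x x' : FlagOf k lam} {y y' : FlagOf k μ}
    (h : intMatrix x y = intMatrix x' y') :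
    ∃ g : Matrix.GeneralLinearGroup (Fin n) k, g • x = x' ∧ g • y = y' := by
  obtain ⟨g, b, hb, rfl, rfl⟩ := exists_adapted x y
  obtain ⟨g', b', hb', rfl, rfl⟩ := exists_adapted x' y'
  rw [intMatrix_smul, intMatrix_smul, intMatrix_wordFlag, intMatrix_wordFlag] at h
  obtain ⟨γ, h1, h2⟩ := exists_smul_wordFlag_eq (k := k) (isWord_block lam) hb
    (isWord_block lam) hb' h
  refine ⟨g' * γ * g⁻¹, ?_, ?_⟩
  · rw [mul_smul, inv_smul_smul, mul_smul, h1]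
  · rw [mul_smul, inv_smul_smul, mul_smul, h2]

/-! ### Orbits of pairs of flags and their intersection matrices. -/

omit [Finite k] in
theorem orbitMatrix_mk (x : FlagOf k lam) (y : FlagOf k μ) :
    orbitMatrix (Quotient.mk'' (x, y) : Orbits k lam μ) = intMatrix x y := rfl

theorem mem_orbit_iff (Ω : Orbits k lam μ) (x : FlagOf k lam) (y : FlagOf k μ) :
    (x, y) ∈ MulAction.orbitRel.Quotient.orbit Ω ↔ intMatrix x y = orbitMatrix Ω := by
  rw [MulAction.orbitRel.Quotient.mem_orbit]
  constructor
  · rintro rfl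
    rfl
  · induction Ω using Quotient.inductionOn' with
    | h p =>
      intro h
      obtain ⟨g, h1, h2⟩ := exists_smul_eq_of_intMatrix_eq h.symm
      exact Quotient.sound' ⟨g, Prod.ext h1 h2⟩

theorem orbitMatrix_injective :
    Function.Injective (orbitMatrix : Orbits k lam μ → Fin n → Fin n → ℕ) := by
  intro Ω Ω' h
  induction Ω using Quotient.inductionOn' with
  | h p =>
    have h1 : (p.1, p.2) ∈ MulAction.orbitRel.Quotient.orbit Ω' := (mem_orbit_iff _ _ _).2 h
    exact MulAction.orbitRel.Quotient.mem_orbit.1 h1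

omit [Finite k] in
theorem orbitMatrix_op (Ω : Orbits k lam μ) (i j : Fin n) :
    orbitMatrix Ω.op i j = orbitMatrix Ω j i := by
  induction Ω using Quotient.inductionOn' with
  | h p => exact intMatrix_swap p.1 p.2 i j

theorem mem_orbit_op_iff (Ω : Orbits k lam μ) (x : FlagOf k lam) (y : FlagOf k μ) :
    (y, x) ∈ MulAction.orbitRel.Quotient.orbit Ω.op ↔
      (x, y) ∈ MulAction.orbitRel.Quotient.orbit Ω := by
  rw [mem_orbit_iff, mem_orbit_iff]
  simp only [funext_iff, orbitMatrix_op, intMatrix_swap x y]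
  exact forall_comm

/-- The matrix of a permutation. -/
def permMat (w : Equiv.Perm (Fin n)) (i j : Fin n) : ℕ := if w i = j then 1 else 0

omit [Finite k] in
theorem permMat_injective : Function.Injective (permMat : Equiv.Perm (Fin n) → _) := by
  intro w w' h
  ext i
  have := congrFun (congrFun h i) (w i)
  simp only [permMat, if_true] at this
  split_ifs at this with h'
  exact congrArg Fin.val h'.symm

omit [Finite k] in
theorem permMat_inv (w : Equiv.Perm (Fin n)) (i j : Fin n) : permMat w⁻¹ i j = permMat w j i := by
  simp only [permMat, Equiv.Perm.inv_eq_iff_eq, eq_comm (a := w j)]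

omit [Finite k] in
theorem intMatrix_permFlag (v w : Equiv.Perm (Fin n)) :
    intMatrix (permFlag k v) (permFlag k w) = permMat (v⁻¹.trans w) := by
  rw [permFlag, permFlag, intMatrix_wordFlag]
  funext i j
  rw [jointCount, permMat]
  split_ifs with h
  · rw [Finset.card_eq_one]
    refine ⟨v⁻¹ i, ?_⟩
    ext p
    simp only [Finset.mem_filter, Finset.mem_univ, true_and, Finset.mem_singleton,
      Equiv.Perm.eq_inv_iff_eq]
    refine ⟨fun h => h.1, ?_⟩
    rintro rfl
    simpa using h
  · rw [Finset.card_eq_zero, Finset.filter_eq_empty_iff]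
    rintro p - ⟨rfl, rfl⟩
    simp at h

omit [Finite k] in
theorem intMatrix_permFlag_one (w : Equiv.Perm (Fin n)) :
    intMatrix (permFlag k 1) (permFlag k w) = permMat w := by
  rw [intMatrix_permFlag, inv_one]
  rfl

/-- The orbit of pairs of complete flags with relative position `w`. -/
def permOrbit (k : Type*) [Field k] {n : ℕ} (w : Equiv.Perm (Fin n)) :
    Orbits k (ones n) (ones n) := Quotient.mk'' (permFlag k 1, permFlag k w)

omit [Finite k] in
theorem orbitMatrix_permOrbit (w : Equiv.Perm (Fin n)) :
    orbitMatrix (permOrbit k w) = permMat w := intMatrix_permFlag_one w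

theorem permOrbit_surjective : Function.Surjective (permOrbit k : Equiv.Perm (Fin n) → _) := by
  intro Ω
  induction Ω using Quotient.inductionOn' with
  | h p =>
    obtain ⟨g, w, h1, h2⟩ := exists_adapted_perm p.1 p.2
    exact ⟨w, (Quotient.sound' ⟨g, Prod.ext h1.symm h2.symm⟩ :
      (Quotient.mk'' p : Orbits k _ _) = _).symm⟩

theorem exists_smul_permFlag_of_intMatrix_eq {x y : FlagOf k (ones n)}
    {w : Equiv.Perm (Fin n)} (h : intMatrix x y = permMat w) :
    ∃ g : Matrix.GeneralLinearGroup (Fin n) k, x = g • permFlag k 1 ∧ y = g • permFlag k w := by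
  rw [← intMatrix_permFlag_one (k := k)] at h
  obtain ⟨g, h1, h2⟩ := exists_smul_eq_of_intMatrix_eq h.symm
  exact ⟨g, h1.symm, h2.symm⟩

end IntMatrix

/-! ### Kernels of `G`-maps -/

section Kernel

variable {k : Type*} [Field k] [Finite k] {n : ℕ} {lam μ ν : n.Partition}

/-- The kernel of a `G`-map `F_μ → F_lam`. -/
def kernel (A : HomG k μ lam) (x : FlagOf k lam) (y : FlagOf k μ) : ℚ := A (Pi.single y 1) x

theorem apply_eq_sum_kernel (A : HomG k μ lam) (f : FlagOf k μ → ℚ) (x : FlagOf k lam) :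
    A f x = ∑ y, kernel A x y * f y := by
  have h : f = ∑ y, f y • (Pi.single y 1 : FlagOf k μ → ℚ) := by
    funext z
    simp [Pi.single_apply]
  conv_lhs => rw [h]
  rw [map_sum, Finset.sum_apply]
  refine Finset.sum_congr rfl fun y _ => ?_
  rw [map_smul, Pi.smul_apply, smul_eq_mul, mul_comm]
  rfl

theorem kernel_ext {A B : HomG k μ lam} (h : ∀ x y, kernel A x y = kernel B x y) : A = B := by
  apply DFunLike.ext
  intro f
  funext x
  simp only [apply_eq_sum_kernel, h]

theorem kernel_comp (A : HomG k ν lam) (B : HomG k μ ν) (x : FlagOf k lam) (y : FlagOf k μ) :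
    kernel (A.comp B) x y = ∑ z, kernel A x z * kernel B z y :=
  apply_eq_sum_kernel A (B (Pi.single y 1)) x

theorem kernel_mul (A B : HomG k lam lam) (x y : FlagOf k lam) :
    kernel (A * B) x y = ∑ z, kernel A x z * kernel B z y := kernel_comp A B x y

theorem kernel_one (x y : FlagOf k lam) :
    kernel (1 : HomG k lam lam) x y = if x = y then 1 else 0 := by
  change (Pi.single y 1 : FlagOf k lam → ℚ) x = _
  rw [Pi.single_apply]

/-- The kernel as a linear function of the `G`-map. -/
def kernelHom (x : FlagOf k lam) (y : FlagOf k μ) : HomG k μ lam →ₗ[ℚ] ℚ where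
  toFun A := kernel A x y
  map_add' _ _ := rfl
  map_smul' _ _ := rfl

theorem kernel_smul (c : ℚ) (A : HomG k μ lam) (x : FlagOf k lam) (y : FlagOf k μ) :
    kernel (c • A) x y = c * kernel A x y := rfl

theorem kernel_add (A B : HomG k μ lam) (x : FlagOf k lam) (y : FlagOf k μ) :
    kernel (A + B) x y = kernel A x y + kernel B x y := rfl

theorem kernel_sum {ι : Type*} (s : Finset ι) (A : ι → HomG k μ lam) (x : FlagOf k lam)
    (y : FlagOf k μ) : kernel (∑ i ∈ s, A i) x y = ∑ i ∈ s, kernel (A i) x y :=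
  map_sum (kernelHom x y) A s

/-- Equivariance makes the kernel constant on orbits; this is what gives the spanning half of
`orbitBasis`. -/
theorem kernel_smul_smul (A : HomG k μ lam) (g : Matrix.GeneralLinearGroup (Fin n) k)
    (x : FlagOf k lam) (y : FlagOf k μ) : kernel A (g • x) (g • y) = kernel A x y := by
  have h := congrFun (A.isIntertwining _ _ g (Pi.single y 1)) (g • x)
  have h1 : flagRep k μ g (Pi.single y 1) = Pi.single (g • y) 1 := by
    funext z
    change (Pi.single y 1 : FlagOf k μ → ℚ) (g⁻¹ • z) = _
    rw [Pi.single_apply, Pi.single_apply]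
    simp only [inv_smul_eq_iff]
  have h2 : flagRep k lam g (A (Pi.single y 1)) (g • x) = A (Pi.single y 1) x := by
    change A (Pi.single y 1) (g⁻¹ • g • x) = _
    rw [inv_smul_smul]
  rw [h1, h2] at h
  exact h

theorem kernel_gMap (Ω : Orbits k lam μ) (x : FlagOf k lam) (y : FlagOf k μ) :
    kernel (gMap Ω) x y = if intMatrix x y = orbitMatrix Ω then 1 else 0 := by
  change ∑ y' ∈ Finset.univ.filter
    (fun y' : FlagOf k μ => (x, y') ∈ MulAction.orbitRel.Quotient.orbit Ω),
      (Pi.single y 1 : FlagOf k μ → ℚ) y' = _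
  simp [Pi.single_apply, mem_orbit_iff]

theorem kernel_pullback (x : FlagOf k (ones n)) (y : FlagOf k lam) :
    kernel (pullback k lam) x y = if coarsen lam x = y then 1 else 0 := by
  change (Pi.single y 1 : FlagOf k lam → ℚ) (coarsen lam x) = _
  rw [Pi.single_apply]

theorem kernel_pushforward (y : FlagOf k lam) (x : FlagOf k (ones n)) :
    kernel (pushforward k lam) y x = if coarsen lam x = y then 1 else 0 := by
  change ∑ x' ∈ Finset.univ.filter (fun x' : FlagOf k (ones n) => coarsen lam x' = y),
      (Pi.single x 1 : FlagOf k (ones n) → ℚ) x' = _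
  simp [Pi.single_apply]

theorem kernel_cMap (Ω₁ : Orbits k ν lam) (Ω₂ : Orbits k ν μ) (x : FlagOf k lam)
    (y : FlagOf k μ) :
    kernel (cMap Ω₁ Ω₂) x y = ∑ z : FlagOf k ν, (if intMatrix z x = orbitMatrix Ω₁ then 1 else 0) *
      (if intMatrix z y = orbitMatrix Ω₂ then 1 else 0) := by
  rw [cMap, kernel_comp]
  refine Finset.sum_congr rfl fun z _ => ?_
  rw [kernel_gMap, kernel_gMap]
  simp only [← mem_orbit_iff, mem_orbit_op_iff]

instance : Finite (Orbits k lam μ) := Quotient.finite _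

instance : Fintype (Orbits k lam μ) := Fintype.ofFinite _

theorem kernel_sum_gMap (c : Orbits k lam μ → ℚ) (x : FlagOf k lam) (y : FlagOf k μ) :
    kernel (∑ Ω, c Ω • gMap Ω) x y = c (Quotient.mk'' (x, y)) := by
  rw [kernel_sum, Finset.sum_eq_single (Quotient.mk'' (x, y))]
  · rw [kernel_smul, kernel_gMap, orbitMatrix_mk, if_pos rfl, mul_one]
  · intro Ω _ hΩ
    rw [kernel_smul, kernel_gMap, if_neg, mul_zero]
    intro h
    exact hΩ (orbitMatrix_injective h.symm)
  · simp

/-- The maps `g_Ω` form a basis of `Hom_G(F_μ, F_lam)`. -/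
def orbitBasis (k : Type*) [Field k] [Finite k] {n : ℕ} (lam μ : n.Partition) :
    Basis (Orbits k lam μ) ℚ (HomG k μ lam) :=
  Basis.mk (v := gMap)
    (by
      rw [Fintype.linearIndependent_iff]
      intro c hc Ω
      induction Ω using Quotient.inductionOn' with
      | h p =>
        rw [← kernel_sum_gMap c p.1 p.2, hc]
        rfl)
    (by
      rintro A -
      -- The coefficient of `gMap Ω` is the constant value of the kernel on `Ω`.
      have hA : A = ∑ Ω : Orbits k lam μ,
          (Quotient.liftOn' Ω (fun p => kernel A p.1 p.2) (by
            rintro _ q ⟨g, rfl⟩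
            exact kernel_smul_smul A g q.1 q.2)) • gMap Ω := by
        apply kernel_ext
        intro x y
        rw [kernel_sum_gMap]
        rfl
      rw [hA]
      exact Submodule.sum_mem _ fun Ω _ =>
        Submodule.smul_mem _ _ (Submodule.subset_span ⟨Ω, rfl⟩))

theorem orbitBasis_apply (Ω : Orbits k lam μ) : orbitBasis k lam μ Ω = gMap Ω :=
  Basis.mk_apply _ _ Ω

end Kernel

/-! ### Length of permutations -/

section Length

variable {n : ℕ}

theorem perm_apply_inv (w : Equiv.Perm (Fin n)) (a : Fin n) : w (w⁻¹ a) = a :=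
  w.apply_symm_apply a

theorem perm_inv_apply (w : Equiv.Perm (Fin n)) (a : Fin n) : w⁻¹ (w a) = a :=
  w.symm_apply_apply a

theorem swap_lt_swap_iff {a b : Fin n} (hab : (a : ℕ) + 1 = b) {i j : Fin n}
    (h1 : ¬(i = a ∧ j = b)) (h2 : ¬(i = b ∧ j = a)) :
    Equiv.swap a b i < Equiv.swap a b j ↔ i < j := by
  simp only [Equiv.swap_apply_def, Fin.lt_def, Fin.ext_iff] at *
  split_ifs <;> omega

/-- An adjacent transposition changes the relative order of the values `a` and `b` only, so the
single new inversion is `(w⁻¹ a, w⁻¹ b)`. -/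
theorem permLength_trans_swap (w : Equiv.Perm (Fin n)) {a b : Fin n} (hab : (a : ℕ) + 1 = b)
    (h : w⁻¹ a < w⁻¹ b) : permLength (w.trans (Equiv.swap a b)) = permLength w + 1 := by
  unfold permLength
  rw [← Finset.card_insert_of_notMem (a := (w⁻¹ a, w⁻¹ b))]
  · congr 1
    ext ⟨x, y⟩
    rw [Finset.mem_insert, Finset.mem_filter, Finset.mem_filter]
    simp only [Finset.mem_univ, true_and, Prod.mk.injEq, Equiv.trans_apply,
      Equiv.Perm.eq_inv_iff_eq]
    by_cases h1 : w x = a ∧ w y = b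
    · obtain ⟨rfl, rfl⟩ := h1
      simp only [perm_inv_apply] at h
      simp [h, Fin.lt_def, ← hab]
    · by_cases h2 : w x = b ∧ w y = a
      · obtain ⟨rfl, rfl⟩ := h2
        simp only [perm_inv_apply] at h
        simp [h.not_gt, h.ne]
      · rw [swap_lt_swap_iff hab (fun h => h2 h.symm) (fun h => h1 h.symm)]
        simp [h1]
  · simp only [Finset.mem_filter, perm_apply_inv, not_and, not_lt]
    intro _ _
    rw [Fin.le_def]
    omega

theorem trans_swap_trans_swap (w : Equiv.Perm (Fin n)) (a b : Fin n) :
    (w.trans (Equiv.swap a b)).trans (Equiv.swap a b) = w := by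
  ext x
  simp

theorem trans_swap_inv_left (w : Equiv.Perm (Fin n)) (a b : Fin n) :
    (w.trans (Equiv.swap a b))⁻¹ a = w⁻¹ b := by
  rw [Equiv.Perm.inv_eq_iff_eq]
  simp

theorem trans_swap_inv_right (w : Equiv.Perm (Fin n)) (a b : Fin n) :
    (w.trans (Equiv.swap a b))⁻¹ b = w⁻¹ a := by
  rw [Equiv.Perm.inv_eq_iff_eq]
  simp

theorem permLength_lt_iff (w : Equiv.Perm (Fin n)) {a b : Fin n} (hab : (a : ℕ) + 1 = b) :
    permLength w < permLength (w.trans (Equiv.swap a b)) ↔ w⁻¹ a < w⁻¹ b := by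
  constructor
  · intro h
    by_contra hlt
    have hne : w⁻¹ a ≠ w⁻¹ b := fun he => by
      have := congrArg Fin.val (w⁻¹.injective he)
      omega
    have h1 := permLength_trans_swap (w.trans (Equiv.swap a b)) hab
      (by rw [trans_swap_inv_left, trans_swap_inv_right]; exact lt_of_le_of_ne (not_lt.1 hlt) hne.symm)
    rw [trans_swap_trans_swap] at h1
    omega
  · intro h
    rw [permLength_trans_swap w hab h]
    exact Nat.lt_succ_self _

/-- Without a descent `w⁻¹` is strictly increasing, hence an order automorphism of `Fin n`, and the
identity is the only one. -/
theorem exists_descent (w : Equiv.Perm (Fin n)) (hw : w ≠ 1) :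
    ∃ a b : Fin n, (a : ℕ) + 1 = b ∧ w⁻¹ b < w⁻¹ a := by
  by_contra! h
  apply hw
  have hmono : StrictMono (w⁻¹ : Equiv.Perm (Fin n)) := by
    cases n with
    | zero => exact fun a => a.elim0
    | succ m =>
      rw [Fin.strictMono_iff_lt_succ]
      intro i
      refine lt_of_le_of_ne (h _ _ (by simp)) fun he => ?_
      exact absurd (w⁻¹.injective he) (Fin.castSucc_lt_succ).ne
  have h1 : ∀ i, w⁻¹ i = i := by
    intro i
    have := (StrictMono.orderIsoOfSurjective _ hmono (w⁻¹).surjective)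
    have h2 : StrictMono.orderIsoOfSurjective _ hmono (w⁻¹).surjective = OrderIso.refl _ :=
      Subsingleton.elim _ _
    exact congrArg (fun e : Fin n ≃o Fin n => e i) h2
  rw [← inv_inj, inv_one]
  exact Equiv.ext h1

end Length

/-! ### Complete flags in relative position an adjacent transposition -/

section Transvection

variable {k : Type*} [Field k] {n : ℕ}

/-- The transvection `e_p ↦ e_p + c e_q`. -/
def transGL {p q : Fin n} (h : q ≠ p) (c : k) : Matrix.GeneralLinearGroup (Fin n) k where
  val := Matrix.transvection q p c
  inv := Matrix.transvection q p (-c)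
  val_inv := by rw [Matrix.transvection_mul_transvection_same _ _ h, add_neg_cancel,
    Matrix.transvection_zero]
  inv_val := by rw [Matrix.transvection_mul_transvection_same _ _ h, neg_add_cancel,
    Matrix.transvection_zero]

theorem transGL_mulVec {p q : Fin n} (h : q ≠ p) (c : k) (v : Fin n → k) (r : Fin n) :
    (transGL h c : Matrix (Fin n) (Fin n) k).mulVec v r = v r + if r = q then c * v p else 0 := by
  change (Matrix.transvection q p c).mulVec v r = _
  rw [Matrix.transvection, Matrix.add_mulVec, Matrix.one_mulVec, Pi.add_apply,
    Matrix.single_mulVec]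
  simp [Function.update_apply]

theorem transGL_inv {p q : Fin n} (h : q ≠ p) (c : k) : (transGL h c)⁻¹ = transGL h (-c) := by
  apply Units.ext
  rfl

theorem transGL_mul {p q : Fin n} (h : q ≠ p) (c d : k) :
    transGL h c * transGL h d = transGL h (c + d) := by
  apply Units.ext
  exact Matrix.transvection_mul_transvection_same _ _ h _ _

theorem transGL_mem_unip {p q : Fin n} (h : p < q) (c : k) :
    transGL h.ne' c ∈ unipSubmonoid k n := by
  intro i j hij
  change Matrix.transvection q p c i j = _
  rw [Matrix.transvection, Matrix.add_apply, Matrix.one_apply, Matrix.single_apply,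
    if_neg (c := q = i ∧ p = j), add_zero]
  rintro ⟨rfl, rfl⟩
  exact absurd h hij.not_gt

/-- Whenever coordinate `q` is required to vanish, so is coordinate `p`, and adding a multiple of
the latter to the former does no harm. -/
theorem transGL_smul_wordFlag {κ : n.Partition} {a : Fin n → Fin n} (ha : IsWord κ a)
    {p q : Fin n} (h : q ≠ p) (hpq : a p ≤ a q) (c : k) :
    transGL h c • wordFlag k ha = wordFlag k ha := by
  apply smul_eq_of_mapsTo
  intro i v hv r hr
  rw [transGL_mulVec, hv r hr]
  split_ifs with h'
  · rw [hv p, mul_zero, add_zero]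
    subst h'
    exact lt_of_le_of_lt hpq hr
  · rw [add_zero]

theorem mem_permFlag (w : Equiv.Perm (Fin n)) (j : Fin (n + 1)) (v : Fin n → k) :
    v ∈ (permFlag k w).space j ↔ ∀ p, (w p : ℕ) < j → v p = 0 := Iff.rfl

variable (v : Equiv.Perm (Fin n)) {a b : Fin n} (hab : (a : ℕ) + 1 = b)

theorem inv_apply_ne (hab : (a : ℕ) + 1 = b) : v⁻¹ b ≠ v⁻¹ a := fun h => by
  have := congrArg Fin.val (v⁻¹.injective h)
  omega

/-- The complete flags that differ from `permFlag k v` exactly in the subspace of index `b`. -/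
def neighbour (hab : (a : ℕ) + 1 = b) (c : k) : FlagOf k (ones n) :=
  transGL (inv_apply_ne v hab) c • permFlag k (v.trans (Equiv.swap a b))

theorem transGL_smul_permFlag_self (c : k) :
    transGL (inv_apply_ne v hab) c • permFlag k v = permFlag k v := by
  apply transGL_smul_wordFlag
  rw [perm_apply_inv, perm_apply_inv, Fin.le_def]
  omega

theorem intMatrix_permFlag_trans_swap :
    intMatrix (permFlag k (v.trans (Equiv.swap a b))) (permFlag k v) =
      permMat (Equiv.swap a b) := by
  rw [intMatrix_permFlag]
  congr 1
  ext x
  change ((v ((v.trans (Equiv.swap a b))⁻¹ x) : Fin n) : ℕ) = _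
  congr 1
  rw [← Equiv.Perm.eq_inv_iff_eq, Equiv.Perm.inv_eq_iff_eq]
  simp

theorem intMatrix_neighbour (c : k) :
    intMatrix (neighbour v hab c) (permFlag k v) = permMat (Equiv.swap a b) := by
  rw [← transGL_smul_permFlag_self v hab c, neighbour, intMatrix_smul,
    intMatrix_permFlag_trans_swap]

/-- Two parameters with the same flag give a transvection fixing a coordinate flag; its image of one
basis vector shows that the parameter of this transvection is zero. -/
theorem neighbour_injective : Function.Injective (neighbour (k := k) v hab) := by
  intro c d h
  have h1 : transGL (inv_apply_ne v hab) (-d + c) • permFlag k (v.trans (Equiv.swap a b)) =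
      permFlag k (v.trans (Equiv.swap a b)) := by
    rw [← transGL_mul, mul_smul, ← transGL_inv, inv_smul_eq_iff]
    exact h
  have h2 : (Pi.single (v⁻¹ a) 1 : Fin n → k) ∈
      (permFlag k (v.trans (Equiv.swap a b))).space b.castSucc := by
    intro p hp
    rw [Pi.single_eq_of_ne]
    rintro rfl
    simp at hp
  have h3 := mulVec_mem_smul_space (transGL (inv_apply_ne v hab) (-d + c)) _ _ h2
  rw [h1] at h3
  have h4 := h3 (v⁻¹ b) (by simp [← hab])
  rw [transGL_mulVec, Pi.single_eq_of_ne (inv_apply_ne v hab), zero_add, if_pos rfl,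
    Pi.single_eq_same, mul_one] at h4
  exact (neg_add_eq_zero.1 h4).symm

theorem neighbour_zero : neighbour v hab (0 : k) = permFlag k (v.trans (Equiv.swap a b)) := by
  have : transGL (inv_apply_ne v hab) (0 : k) = 1 := by
    apply Units.ext
    exact Matrix.transvection_zero _ _
  rw [neighbour, this, one_smul]

/-- On the projective line of choices for the subspace of index `b`, `e + c f` and `f + c⁻¹ e` span
the same line, where `e` and `f` are the basis vectors at `v⁻¹ a` and `v⁻¹ b`. -/
theorem neighbour_eq {c : k} (hc : c ≠ 0) :
    neighbour v hab c = transGL (inv_apply_ne v hab).symm c⁻¹ • permFlag k v := by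
  symm
  apply smul_eq_of_mapsTo
  intro j x hx
  rw [neighbour, mem_smul_space, transGL_inv]
  intro p hp
  rw [transGL_mulVec, transGL_mulVec, transGL_mulVec, if_pos rfl]
  rw [mem_permFlag] at hx
  rw [Equiv.trans_apply] at hp
  by_cases h1 : p = v⁻¹ b
  · subst h1
    rw [perm_apply_inv, Equiv.swap_apply_right] at hp
    rw [hx (v⁻¹ a) (by simpa using hp), if_neg (inv_apply_ne v hab), if_pos rfl]
    field_simp
    ring
  · rw [if_neg h1, add_zero]
    by_cases h2 : p = v⁻¹ a
    · subst h2
      rw [perm_apply_inv, Equiv.swap_apply_left] at hp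
      rw [hx (v⁻¹ b) (by simpa using hp), mul_zero, hx (v⁻¹ a) (by simp; omega)]
      simp
    · rw [if_neg h2, add_zero]
      rw [Equiv.Perm.eq_inv_iff_eq] at h1 h2
      rw [Equiv.swap_apply_of_ne_of_ne h2 h1] at hp
      exact hx p hp

theorem exists_neighbour [Finite k] {y : FlagOf k (ones n)}
    (hy : intMatrix y (permFlag k v) = permMat (Equiv.swap a b)) :
    ∃ c : k, neighbour v hab c = y := by
  rw [← intMatrix_permFlag_trans_swap (k := k) v] at hy
  obtain ⟨h, h1, h2⟩ := exists_smul_eq_of_intMatrix_eq hy.symm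
  have hne := inv_apply_ne v hab
  have hsame : ∀ j : Fin (n + 1), (j : ℕ) ≠ b →
      (permFlag k (v.trans (Equiv.swap a b))).space j = (permFlag k v).space j := by
    intro j hj
    ext x
    rw [mem_permFlag, mem_permFlag]
    refine ⟨fun hx p hp => ?_, fun hx p hp => ?_⟩ <;>
    · apply hx
      simp only [Equiv.trans_apply, Equiv.swap_apply_def, Fin.ext_iff] at *
      split_ifs at * <;> omega
  have hyj : ∀ j : Fin (n + 1), (j : ℕ) ≠ b → y.space j = (permFlag k v).space j := by
    intro j hj
    rw [← h1, smul_space, hsame j hj, ← smul_space, h2]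
  -- Outside the index `b` the flags `y` and `permFlag k v` agree. The vector `t` generates the
  -- subspace of index `b` of `y` modulo the next one, so the parameter is the ratio of its
  -- coordinates at `v⁻¹ b` and `v⁻¹ a`.
  set t := (h : Matrix (Fin n) (Fin n) k).mulVec (Pi.single (v⁻¹ a) 1) with ht
  have hty : t ∈ y.space b.castSucc := by
    rw [← h1]
    apply mulVec_mem_smul_space
    intro p hp
    rw [Pi.single_eq_of_ne]
    rintro rfl
    simp at hp
  have hta : t ∈ (permFlag k v).space a.castSucc := by
    rw [← hyj _ (by simp; omega)]
    exact y.antitone (by rw [Fin.le_def]; simp; omega) hty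
  -- Otherwise `t` would lie in the subspace of index `b` of `permFlag k v`, which `h` stabilises,
  -- and so would the basis vector at `v⁻¹ a`, which does not.
  have ht0 : t (v⁻¹ a) ≠ 0 := by
    intro h0
    have h3 : t ∈ (h • permFlag k v).space b.castSucc := by
      rw [h2]
      intro p hp
      by_cases hpa : p = v⁻¹ a
      · rw [hpa, h0]
      · apply hta
        rw [Equiv.Perm.eq_inv_iff_eq, Fin.ext_iff] at hpa
        simp at hp ⊢
        omega
    rw [mem_smul_space, ht, Matrix.mulVec_mulVec, ← Units.val_mul, inv_mul_cancel, Units.val_one,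
      Matrix.one_mulVec] at h3
    have := h3 (v⁻¹ a) (by simp; omega)
    simp at this
  refine ⟨t (v⁻¹ b) / t (v⁻¹ a), smul_eq_of_mapsTo fun j x hx => ?_⟩
  by_cases hj : (j : ℕ) = b
  · have hj' : j = b.castSucc := Fin.ext hj
    subst hj'
    have hd : (transGL hne (t (v⁻¹ b) / t (v⁻¹ a)) : Matrix (Fin n) (Fin n) k).mulVec x -
        (x (v⁻¹ a) / t (v⁻¹ a)) • t ∈ (permFlag k v).space b.succ := by
      intro p hp
      rw [Pi.sub_apply, Pi.smul_apply, transGL_mulVec, smul_eq_mul]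
      by_cases hpb : p = v⁻¹ b
      · subst hpb
        rw [if_pos rfl, hx (v⁻¹ b) (by simp; omega)]
        field_simp
        ring
      · rw [if_neg hpb, add_zero]
        by_cases hpa : p = v⁻¹ a
        · subst hpa
          field_simp
          ring
        · rw [Equiv.Perm.eq_inv_iff_eq] at hpa hpb
          have hpa' := Fin.val_ne_of_ne hpa
          have hpb' := Fin.val_ne_of_ne hpb
          have hlt : (v p : ℕ) < a := by
            simp at hp
            omega
          rw [hta p (by simpa using hlt), mul_zero, sub_zero]
          apply hx
          rw [Equiv.trans_apply, Equiv.swap_apply_of_ne_of_ne hpa hpb]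
          simp
          omega
    rw [← hyj _ (by simp)] at hd
    have hd' := y.antitone (Fin.castSucc_lt_succ).le hd
    have := Submodule.add_mem _ hd' (Submodule.smul_mem _ (x (v⁻¹ a) / t (v⁻¹ a)) hty)
    rwa [sub_add_cancel] at this
  · rw [hyj j hj]
    rw [hsame j hj] at hx
    rw [← transGL_smul_permFlag_self v hab (t (v⁻¹ b) / t (v⁻¹ a))]
    exact mulVec_mem_smul_space _ _ _ hx

/-- Here the transvection is lower unitriangular and fixes the standard flag, so all neighbours are
in the same position. -/
theorem intMatrix_one_neighbour_of_lt (h : v⁻¹ a < v⁻¹ b) (c : k) :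
    intMatrix (permFlag k 1) (neighbour v hab c) = permMat (v.trans (Equiv.swap a b)) := by
  rw [neighbour, ← unip_smul_permFlag_one (k := k) (transGL_mem_unip h c), intMatrix_smul,
    intMatrix_permFlag_one]

/-- In this order only the second description of the neighbour, `neighbour_eq`, uses a lower
unitriangular transvection; it is available for the `q - 1` nonzero parameters. -/
theorem intMatrix_one_neighbour_of_gt (h : v⁻¹ b < v⁻¹ a) {c : k} (hc : c ≠ 0) :
    intMatrix (permFlag k 1) (neighbour v hab c) = permMat v := by
  rw [neighbour_eq v hab hc, ← unip_smul_permFlag_one (k := k) (transGL_mem_unip h c⁻¹), intMatrix_smul,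
    intMatrix_permFlag_one]

end Transvection

/-! ### The Hecke algebra acts on functions on complete flags -/

section HeckeAction

variable {k : Type*} [Field k] [Finite k] {n : ℕ}

/-- The intermediate flags are the neighbours of `permFlag k v`, parametrised by `k`. Either all `q`
have position `vs` relative to the standard flag, or one has position `vs` and `q - 1` have position
`v`. -/
theorem kernel_gMap_mul_gMap (w v : Equiv.Perm (Fin n)) {a b : Fin n} (hab : (a : ℕ) + 1 = b) :
    kernel (gMap (permOrbit k w) * gMap (permOrbit k (Equiv.swap a b))) (permFlag k 1)
        (permFlag k v) =
      if v⁻¹ a < v⁻¹ b then (if w = v.trans (Equiv.swap a b) then (Nat.card k : ℚ) else 0)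
      else (if w = v.trans (Equiv.swap a b) then 1 else 0) +
        if w = v then (Nat.card k : ℚ) - 1 else 0 := by
  have : Fintype k := Fintype.ofFinite k
  rw [kernel_mul]
  simp only [kernel_gMap, orbitMatrix_permOrbit, mul_ite, mul_one, mul_zero]
  rw [← Finset.sum_filter]
  have himg : (Finset.univ.filter fun y : FlagOf k (ones n) =>
      intMatrix y (permFlag k v) = permMat (Equiv.swap a b)) =
      Finset.univ.image (neighbour (k := k) v hab) := by
    ext y
    simp only [Finset.mem_filter, Finset.mem_univ, true_and, Finset.mem_image]
    constructor
    · exact exists_neighbour v hab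
    · rintro ⟨c, rfl⟩
      exact intMatrix_neighbour v hab c
  rw [himg, Finset.sum_image fun c _ d _ h => neighbour_injective v hab h]
  by_cases h1 : v⁻¹ a < v⁻¹ b
  · rw [if_pos h1]
    simp only [intMatrix_one_neighbour_of_lt v hab h1, permMat_injective.eq_iff, eq_comm (b := w),
      Finset.sum_const, Finset.card_univ, Nat.card_eq_fintype_card, nsmul_eq_mul, mul_ite, mul_one,
      mul_zero]
  · rw [if_neg h1]
    have hgt : v⁻¹ b < v⁻¹ a := lt_of_le_of_ne (not_lt.1 h1) (inv_apply_ne v hab)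
    rw [← Finset.add_sum_erase _ _ (Finset.mem_univ (0 : k)), neighbour_zero,
      intMatrix_permFlag_one, Finset.sum_congr rfl (g := fun _ => if v = w then (1 : ℚ) else 0)
      (fun c hc => by
        rw [intMatrix_one_neighbour_of_gt v hab hgt (Finset.ne_of_mem_erase hc)]
        simp only [permMat_injective.eq_iff])]
    simp only [permMat_injective.eq_iff, Finset.sum_const, Finset.card_erase_of_mem
      (Finset.mem_univ (0 : k)), Finset.card_univ, Nat.card_eq_fintype_card, eq_comm (b := w),
      nsmul_eq_mul, mul_ite, mul_one, mul_zero]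
    rw [Nat.cast_sub Fintype.card_pos, Nat.cast_one]

theorem homG_ones_ext {A B : HomG k (ones n) (ones n)}
    (h : ∀ v, kernel A (permFlag k 1) (permFlag k v) = kernel B (permFlag k 1) (permFlag k v)) :
    A = B := by
  apply kernel_ext
  intro x y
  obtain ⟨g, v, rfl, rfl⟩ := exists_adapted_perm x y
  rw [kernel_smul_smul, kernel_smul_smul, h]

theorem kernel_gMap_permOrbit (w v : Equiv.Perm (Fin n)) :
    kernel (gMap (permOrbit k w)) (permFlag k 1) (permFlag k v) = if w = v then 1 else 0 := by
  rw [kernel_gMap, orbitMatrix_permOrbit, intMatrix_permFlag_one]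
  simp only [permMat_injective.eq_iff, eq_comm (b := w)]

theorem gMap_permOrbit_one : gMap (permOrbit k (1 : Equiv.Perm (Fin n))) = 1 := by
  apply homG_ones_ext
  intro v
  rw [kernel_gMap_permOrbit, kernel_one]
  congr 1
  rw [eq_iff_iff]
  refine ⟨fun h => h ▸ rfl, fun h => ?_⟩
  exact Equiv.ext fun x => congrFun (wordFlag_injective _ _ h) x

theorem gMap_mul_of_lt (w : Equiv.Perm (Fin n)) {a b : Fin n} (hab : (a : ℕ) + 1 = b)
    (h : w⁻¹ a < w⁻¹ b) :
    gMap (permOrbit k w) * gMap (permOrbit k (Equiv.swap a b)) =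
      gMap (permOrbit k (w.trans (Equiv.swap a b))) := by
  apply homG_ones_ext
  intro v
  rw [kernel_gMap_mul_gMap w v hab, kernel_gMap_permOrbit]
  have h1 : w.trans (Equiv.swap a b) = v ↔ w = v.trans (Equiv.swap a b) :=
    ⟨fun h => by rw [← h, trans_swap_trans_swap], fun h => by rw [h, trans_swap_trans_swap]⟩
  simp only [h1]
  by_cases hv : v⁻¹ a < v⁻¹ b
  · rw [if_pos hv]
    have : w ≠ v.trans (Equiv.swap a b) := by
      rintro rfl
      rw [trans_swap_inv_left, trans_swap_inv_right] at h
      exact absurd h hv.not_gt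
    simp only [this, if_false]
  · rw [if_neg hv]
    have : w ≠ v := by
      rintro rfl
      exact hv h
    simp only [this, if_false, add_zero]

theorem gMap_mul_of_not_lt (w : Equiv.Perm (Fin n)) {a b : Fin n} (hab : (a : ℕ) + 1 = b)
    (h : ¬ w⁻¹ a < w⁻¹ b) :
    gMap (permOrbit k w) * gMap (permOrbit k (Equiv.swap a b)) =
      (Nat.card k : ℚ) • gMap (permOrbit k (w.trans (Equiv.swap a b))) +
        ((Nat.card k : ℚ) - 1) • gMap (permOrbit k w) := by
  apply homG_ones_ext
  intro v
  rw [kernel_gMap_mul_gMap w v hab, kernel_add, kernel_smul, kernel_smul, kernel_gMap_permOrbit,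
    kernel_gMap_permOrbit]
  have h1 : w.trans (Equiv.swap a b) = v ↔ w = v.trans (Equiv.swap a b) :=
    ⟨fun h => by rw [← h, trans_swap_trans_swap], fun h => by rw [h, trans_swap_trans_swap]⟩
  simp only [h1]
  by_cases hv : v⁻¹ a < v⁻¹ b
  · rw [if_pos hv]
    have : w ≠ v := by
      rintro rfl
      exact h hv
    simp [this]
  · rw [if_neg hv]
    have : w ≠ v.trans (Equiv.swap a b) := by
      rintro rfl
      rw [trans_swap_inv_left, trans_swap_inv_right] at h
      exact h (lt_of_le_of_ne (not_lt.1 hv) (inv_apply_ne v hab))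
    simp [this]

/-- The homomorphism from the Hecke algebra to `End_G(F_{(1^n)})`. -/
def heckeHom (k : Type*) [Field k] [Finite k] (n : ℕ) :
    Hecke ℚ (Nat.card k : ℚ) n →ₐ[ℚ] HomG k (ones n) (ones n) :=
  RingQuot.liftAlgHom ℚ ⟨FreeAlgebra.lift ℚ fun w => gMap (permOrbit k w), by
    intro x y h
    induction h with
    | one => rw [FreeAlgebra.lift_ι_apply, map_one, gMap_permOrbit_one]
    | up w a b hab h =>
      rw [map_mul, FreeAlgebra.lift_ι_apply, FreeAlgebra.lift_ι_apply, FreeAlgebra.lift_ι_apply]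
      exact gMap_mul_of_lt w hab ((permLength_lt_iff w hab).1 h)
    | down w a b hab h =>
      rw [map_mul, map_add, map_smul, map_smul, FreeAlgebra.lift_ι_apply,
        FreeAlgebra.lift_ι_apply, FreeAlgebra.lift_ι_apply]
      exact gMap_mul_of_not_lt w hab (fun h' => h ((permLength_lt_iff w hab).2 h'))⟩

theorem heckeHom_T (w : Equiv.Perm (Fin n)) :
    heckeHom k n (T ℚ (Nat.card k : ℚ) w) = gMap (permOrbit k w) := by
  rw [T, heckeHom, RingQuot.liftAlgHom_mkAlgHom_apply, FreeAlgebra.lift_ι_apply]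

theorem T_one (q : ℚ) : T ℚ q (1 : Equiv.Perm (Fin n)) = 1 := by
  rw [T, RingQuot.mkAlgHom_rel ℚ HeckeRel.one, map_one]

theorem T_mul_of_lt (q : ℚ) (w : Equiv.Perm (Fin n)) {a b : Fin n} (hab : (a : ℕ) + 1 = b)
    (h : permLength w < permLength (w.trans (Equiv.swap a b))) :
    T ℚ q w * T ℚ q (Equiv.swap a b) = T ℚ q (w.trans (Equiv.swap a b)) := by
  rw [T, T, T, ← map_mul]
  exact RingQuot.mkAlgHom_rel ℚ (HeckeRel.up w a b hab h)

theorem T_mul_of_not_lt (q : ℚ) (w : Equiv.Perm (Fin n)) {a b : Fin n} (hab : (a : ℕ) + 1 = b)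
    (h : ¬ permLength w < permLength (w.trans (Equiv.swap a b))) :
    T ℚ q w * T ℚ q (Equiv.swap a b) =
      q • T ℚ q (w.trans (Equiv.swap a b)) + (q - 1) • T ℚ q w := by
  rw [T, T, T, ← map_mul, ← map_smul, ← map_smul, ← map_add]
  exact RingQuot.mkAlgHom_rel ℚ (HeckeRel.down w a b hab h)

/-- Induction on length: a descent of `v` gives `T_v = T_{vs} T_s` with `vs` shorter, and right
multiplication by `T_s` preserves the span by the defining relations. -/
theorem mul_T_mem_span (q : ℚ) (v : Equiv.Perm (Fin n)) {h : Hecke ℚ q n}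
    (hh : h ∈ Submodule.span ℚ (Set.range (T ℚ q : Equiv.Perm (Fin n) → Hecke ℚ q n))) :
    h * T ℚ q v ∈ Submodule.span ℚ (Set.range (T ℚ q : Equiv.Perm (Fin n) → Hecke ℚ q n)) := by
  induction hv : permLength v using Nat.strong_induction_on generalizing v h with
  | _ l ih =>
    by_cases h1 : v = 1
    · rw [h1, T_one, mul_one]
      exact hh
    · obtain ⟨a, b, hab, hlt⟩ := exists_descent v h1
      have hlen : permLength (v.trans (Equiv.swap a b)) <
          permLength ((v.trans (Equiv.swap a b)).trans (Equiv.swap a b)) := by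
        rw [permLength_lt_iff _ hab, trans_swap_inv_left, trans_swap_inv_right]
        exact hlt
      have h2 := T_mul_of_lt q _ hab hlen
      rw [trans_swap_trans_swap] at h2 hlen
      rw [← h2, ← mul_assoc]
      have h3 := ih _ (hv ▸ hlen) _ hh rfl
      refine Submodule.span_induction (p := fun x _ => x * T ℚ q (Equiv.swap a b) ∈ _)
        ?_ ?_ ?_ ?_ h3
      · rintro _ ⟨w, rfl⟩
        by_cases hw : permLength w < permLength (w.trans (Equiv.swap a b))
        · rw [T_mul_of_lt q w hab hw]
          exact Submodule.subset_span ⟨_, rfl⟩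
        · rw [T_mul_of_not_lt q w hab hw]
          exact Submodule.add_mem _ (Submodule.smul_mem _ _ (Submodule.subset_span ⟨_, rfl⟩))
            (Submodule.smul_mem _ _ (Submodule.subset_span ⟨_, rfl⟩))
      · rw [zero_mul]
        exact Submodule.zero_mem _
      · intro x y _ _ hx hy
        rw [add_mul]
        exact Submodule.add_mem _ hx hy
      · intro c x _ hx
        rw [smul_mul_assoc]
        exact Submodule.smul_mem _ _ hx

theorem span_T (q : ℚ) :
    Submodule.span ℚ (Set.range (T ℚ q : Equiv.Perm (Fin n) → Hecke ℚ q n)) = ⊤ := by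
  set S := Submodule.span ℚ (Set.range (T ℚ q : Equiv.Perm (Fin n) → Hecke ℚ q n)) with hS
  have key : ∀ (x : FreeAlgebra ℚ (Equiv.Perm (Fin n))), ∀ h ∈ S,
      h * RingQuot.mkAlgHom ℚ (HeckeRel ℚ q n) x ∈ S := by
    intro x
    induction x using FreeAlgebra.induction with
    | grade0 r =>
      intro h hh
      rw [AlgHom.commutes, ← Algebra.commutes, ← Algebra.smul_def]
      exact Submodule.smul_mem _ _ hh
    | grade1 w => exact fun h hh => mul_T_mem_span q w hh
    | mul x y hx hy =>
      intro h hh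
      rw [map_mul, ← mul_assoc]
      exact hy _ (hx _ hh)
    | add x y hx hy =>
      intro h hh
      rw [map_add, mul_add]
      exact Submodule.add_mem _ (hx _ hh) (hy _ hh)
  rw [eq_top_iff]
  rintro h -
  obtain ⟨x, rfl⟩ := RingQuot.mkAlgHom_surjective ℚ (HeckeRel ℚ q n) h
  rw [← one_mul (RingQuot.mkAlgHom ℚ (HeckeRel ℚ q n) x), ← T_one]
  exact key x _ (Submodule.subset_span ⟨1, rfl⟩)

/-- The `T_w` span, and the coefficient of `T_v` is read off as the kernel value at the standard
flag and `permFlag k v`. Surjectivity holds because every orbit is a `permOrbit`. -/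
theorem heckeHom_bijective : Function.Bijective (heckeHom k n) := by
  constructor
  · rw [injective_iff_map_eq_zero]
    intro h hh
    have hmem : h ∈ Submodule.span ℚ (Set.range (T ℚ (Nat.card k : ℚ) :
        Equiv.Perm (Fin n) → Hecke ℚ (Nat.card k : ℚ) n)) := by
      rw [span_T]
      trivial
    obtain ⟨c, rfl⟩ := (Submodule.mem_span_range_iff_exists_fun ℚ).1 hmem
    apply Finset.sum_eq_zero
    intro v _
    have h1 : kernel (heckeHom k n (∑ w, c w • T ℚ (Nat.card k : ℚ) w)) (permFlag k 1)
        (permFlag k v) = c v := by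
      rw [map_sum, kernel_sum, Finset.sum_eq_single v]
      · rw [map_smul, heckeHom_T, kernel_smul, kernel_gMap_permOrbit, if_pos rfl, mul_one]
      · intro w _ hw
        rw [map_smul, heckeHom_T, kernel_smul, kernel_gMap_permOrbit, if_neg hw, mul_zero]
      · simp
    rw [hh] at h1
    rw [← h1]
    exact zero_smul _ _
  · have : LinearMap.range (heckeHom k n).toLinearMap = ⊤ := by
      rw [eq_top_iff, ← (orbitBasis k (ones n) (ones n)).span_eq, Submodule.span_le]
      rintro _ ⟨Ω, rfl⟩
      obtain ⟨w, rfl⟩ := permOrbit_surjective Ω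
      exact ⟨T ℚ (Nat.card k : ℚ) w, by rw [orbitBasis_apply]; exact heckeHom_T w⟩
    exact LinearMap.range_eq_top.1 this

/-- The Hecke algebra is the algebra of `G`-endomorphisms of `F_{(1^n)}`. -/
def heckeEquiv (k : Type*) [Field k] [Finite k] (n : ℕ) :
    Hecke ℚ (Nat.card k : ℚ) n ≃ₐ[ℚ] HomG k (ones n) (ones n) :=
  AlgEquiv.ofBijective (heckeHom k n) heckeHom_bijective

theorem heckeEquiv_T (w : Equiv.Perm (Fin n)) :
    heckeEquiv k n (T ℚ (Nat.card k : ℚ) w) = gMap (permOrbit k w) := heckeHom_T w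

end HeckeAction

/-! ### Rows of partitions -/

section Rows

variable {n : ℕ}

theorem row_antitone (ν : n.Partition) : Antitone (row ν) := by
  intro i j hij
  unfold row
  by_cases hj : j < (ν.parts.sort (· ≥ ·)).length
  · rw [List.getD_eq_getElem _ _ hj, List.getD_eq_getElem _ _ (lt_of_le_of_lt hij hj)]
    rcases hij.eq_or_lt with rfl | h
    · exact le_rfl
    · exact List.pairwise_iff_getElem.1 (Multiset.pairwise_sort ν.parts (· ≥ ·)) i j _ _ h
  · rw [List.getD_eq_default _ _ (not_lt.1 hj)]
    exact Nat.zero_le _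

theorem row_pos_iff (ν : n.Partition) (i : ℕ) : 0 < row ν i ↔ i < len ν := by
  have hl : (ν.parts.sort (· ≥ ·)).length = len ν := Multiset.length_sort _
  unfold row
  rw [← hl]
  by_cases hi : i < (ν.parts.sort (· ≥ ·)).length
  · rw [List.getD_eq_getElem _ _ hi]
    refine ⟨fun _ => hi, fun _ => ν.parts_pos ?_⟩
    rw [← Multiset.mem_sort (· ≥ ·)]
    exact List.getElem_mem hi
  · rw [List.getD_eq_default _ _ (not_lt.1 hi)]
    exact iff_of_false (lt_irrefl 0) hi

theorem row_eq_zero (ν : n.Partition) {i : ℕ} (hi : n ≤ i) : row ν i = 0 := by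
  by_contra h
  have := (row_pos_iff ν i).1 (Nat.pos_of_ne_zero h)
  have := len_le ν
  omega

theorem partialSum_of_le (ν : n.Partition) {i : ℕ} (hi : n ≤ i) : partialSum ν i = n := by
  induction i, hi using Nat.le_induction with
  | base => exact partialSum_top ν
  | succ i hi ih => rw [partialSum_succ, ih, row_eq_zero ν hi, add_zero]

theorem card_lt_eq_partialSum {ι : Type*} [Fintype ι] {κ : n.Partition} {f : ι → Fin n}
    (hf : ∀ j : Fin n, (Finset.univ.filter fun b => f b = j).card = row κ j) (i : ℕ)
    (hi : i ≤ n) : (Finset.univ.filter fun b => (f b : ℕ) < i).card = partialSum κ i := by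
  induction i with
  | zero => simp [partialSum]
  | succ i ih =>
    have h1 : (Finset.univ.filter fun b => (f b : ℕ) < i + 1) =
        (Finset.univ.filter fun b => (f b : ℕ) < i) ∪
          (Finset.univ.filter fun b => f b = ⟨i, hi⟩) := by
      ext b
      simp only [Finset.mem_filter, Finset.mem_univ, true_and, Finset.mem_union, Fin.ext_iff]
      omega
    rw [h1, Finset.card_union_of_disjoint, ih (by omega), hf, partialSum_succ]
    rw [Finset.disjoint_filter]
    intro b _ h h'
    rw [h'] at h
    exact absurd h (lt_irrefl _)

theorem card_cell_row (ν : n.Partition) (j : Fin n) :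
    (Finset.univ.filter fun b : Cell ν => b.1 = j).card = row ν j := by
  rw [← isWord_block ν j]
  exact Finset.card_equiv (rowReading ν) (by simp [block_rowReading])

end Rows

/-! ### Column-strict fillings -/

section ColStrict

variable {n : ℕ} {ν κ : n.Partition}

/-- Labels strictly increase down columns. -/
def ColStrict (Θ : Cell ν → Fin n) : Prop :=
  ∀ (i i' : Fin n) (c : Fin (row ν i)) (c' : Fin (row ν i')),
    i < i' → (c : ℕ) = c' → Θ ⟨i, c⟩ < Θ ⟨i', c'⟩

/-- The box above exists since row lengths decrease, and each step up a column lowers the label by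
at least one. -/
theorem ColStrict.row_le {Θ : Cell ν → Fin n} (h : ColStrict Θ) (b : Cell ν) : b.1 ≤ Θ b := by
  obtain ⟨⟨i, hi⟩, c⟩ := b
  induction i with
  | zero => exact Nat.zero_le _
  | succ i ih =>
    have hc : (c : ℕ) < row ν i := lt_of_lt_of_le c.2 (row_antitone ν (Nat.le_succ i))
    have h1 := ih (by omega) ⟨c, hc⟩
    have h2 := h ⟨i, by omega⟩ ⟨i + 1, hi⟩ ⟨c, hc⟩ c (by simp [Fin.lt_def]) rfl
    rw [Fin.le_def] at h1 ⊢
    rw [Fin.lt_def] at h2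
    simp only at h1 ⊢
    omega

theorem ColStrict.filter_subset {Θ : Cell ν → Fin n} (h : ColStrict Θ) (i : ℕ) :
    (Finset.univ.filter fun b => (Θ b : ℕ) < i) ⊆
      Finset.univ.filter fun b : Cell ν => (b.1 : ℕ) < i := by
  intro b hb
  rw [Finset.mem_filter] at hb ⊢
  exact ⟨hb.1, lt_of_le_of_lt (h.row_le b) hb.2⟩

/-- Labels below `i` occupy boxes of the first `i` rows only; comparing cardinalities is dominance.
-/
theorem ColStrict.oppDomLE {Θ : Cell ν → Fin n} (h : ColStrict Θ)
    (ht : ∀ j : Fin n, (Finset.univ.filter fun b : Cell ν => Θ b = j).card = row κ j) :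
    OppDomLE ν κ := by
  intro i
  rcases le_or_gt i n with hi | hi
  · rw [← card_lt_eq_partialSum ht i hi, ← card_lt_eq_partialSum (card_cell_row ν) i hi]
    exact Finset.card_le_card (h.filter_subset i)
  · rw [partialSum_of_le _ hi.le, partialSum_of_le _ hi.le]

/-- When type and shape agree, the inclusions behind `ColStrict.oppDomLE` are equalities: there is
only one such filling. -/
theorem ColStrict.eq_row {Θ : Cell ν → Fin n} (h : ColStrict Θ)
    (ht : ∀ j : Fin n, (Finset.univ.filter fun b : Cell ν => Θ b = j).card = row ν j)
    (b : Cell ν) : Θ b = b.1 := by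
  apply le_antisymm _ (h.row_le b)
  have hi : (b.1 : ℕ) + 1 ≤ n := b.1.2
  have h1 := Finset.eq_of_subset_of_card_le (h.filter_subset (b.1 + 1)) (by
    rw [card_lt_eq_partialSum ht _ hi, card_lt_eq_partialSum (card_cell_row ν) _ hi])
  have h2 : b ∈ Finset.univ.filter fun b' : Cell ν => (b'.1 : ℕ) < b.1 + 1 := by simp
  rw [← h1, Finset.mem_filter] at h2
  exact Nat.lt_succ_iff.1 h2.2

end ColStrict

/-! ### Contents of tableaux -/

section Content

variable {n : ℕ} {ν κ : n.Partition}

theorem content_eq_jointCount (Θ : Cell ν → Fin n) :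
    content Θ = jointCount (fun b : Cell ν => b.1) Θ := by
  funext i j
  refine Finset.card_bij (fun c _ => ⟨i, c⟩) ?_ ?_ ?_
  · intro c hc
    simpa using hc
  · intro c _ c' _ h
    simpa using h
  · rintro ⟨i', c⟩ hb
    simp only [Finset.mem_filter, Finset.mem_univ, true_and] at hb
    obtain ⟨rfl, hb⟩ := hb
    exact ⟨c, by simpa using hb, rfl⟩

theorem sum_jointCount {ι : Type*} [Fintype ι] (a b : ι → Fin n) (j : Fin n) :
    ∑ i, jointCount a b i j = (Finset.univ.filter fun p => b p = j).card := by
  rw [Finset.card_eq_sum_card_fiberwise (f := a) (t := Finset.univ) (by simp)]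
  refine Finset.sum_congr rfl fun i _ => ?_
  rw [Finset.filter_filter]
  simp only [jointCount, and_comm]

theorem mem_iff_lt_card {m : ℕ} {S : Finset (Fin m)} (hS : ∀ c ∈ S, ∀ c' ≤ c, c' ∈ S)
    (c : Fin m) : c ∈ S ↔ (c : ℕ) < S.card := by
  constructor
  · intro hc
    have h : Finset.Iic c ⊆ S := fun c' hc' => hS c hc c' (Finset.mem_Iic.1 hc')
    have := Finset.card_le_card h
    rw [Fin.card_Iic] at this
    omega
  · intro hc
    by_contra h
    have h : S ⊆ Finset.Iio c := fun c' hc' => Finset.mem_Iio.2 (by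
      by_contra hlt
      exact h (hS c' hc' c (not_lt.1 hlt)))
    have := Finset.card_le_card h
    rw [Fin.card_Iio] at this
    omega

theorem eq_of_monotone_of_card_fiber_eq {m : ℕ} {f g : Fin m → Fin n} (hf : Monotone f)
    (hg : Monotone g) (h : ∀ j, (Finset.univ.filter fun c => f c = j).card =
      (Finset.univ.filter fun c => g c = j).card) : f = g := by
  have key : ∀ (j : Fin n), (Finset.univ.filter fun c => f c ≤ j).card =
      (Finset.univ.filter fun c => g c ≤ j).card := by
    intro j
    rw [Finset.card_eq_sum_card_fiberwise (f := f) (t := Finset.univ) (by simp),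
      Finset.card_eq_sum_card_fiberwise (s := Finset.univ.filter fun c => g c ≤ j)
        (f := g) (t := Finset.univ) (by simp)]
    refine Finset.sum_congr rfl fun i _ => ?_
    rw [Finset.filter_filter, Finset.filter_filter]
    by_cases hi : i ≤ j
    · have h1 : ∀ f : Fin m → Fin n, (Finset.univ.filter fun c => f c ≤ j ∧ f c = i) =
          Finset.univ.filter fun c => f c = i := by
        intro f
        refine Finset.filter_congr fun c _ => ⟨fun h => h.2, ?_⟩
        rintro rfl
        exact ⟨hi, rfl⟩
      rw [h1, h1, h]
    · have h1 : ∀ f : Fin m → Fin n, (Finset.univ.filter fun c => f c ≤ j ∧ f c = i) = ∅ := by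
        intro f
        refine Finset.filter_eq_empty_iff.2 fun c _ => ?_
        rintro ⟨h1, rfl⟩
        exact hi h1
      rw [h1, h1]
  have h2 : ∀ (f : Fin m → Fin n), Monotone f → ∀ c j, f c ≤ j ↔
      (c : ℕ) < (Finset.univ.filter fun c => f c ≤ j).card := by
    intro f hf c j
    rw [← mem_iff_lt_card (S := Finset.univ.filter fun c => f c ≤ j)]
    · simp
    · intro c hc c' hcc'
      rw [Finset.mem_filter] at hc ⊢
      exact ⟨Finset.mem_univ _, (hf hcc').trans hc.2⟩
  funext c
  apply le_antisymm
  · rw [h2 f hf, key, ← h2 g hg]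
  · rw [h2 g hg, ← key, ← h2 f hf]

theorem eq_of_content_eq {Θ Θ' : Cell ν → Fin n}
    (h1 : ∀ (i : Fin n) (c c' : Fin (row ν i)), c ≤ c' → Θ ⟨i, c⟩ ≤ Θ ⟨i, c'⟩)
    (h2 : ∀ (i : Fin n) (c c' : Fin (row ν i)), c ≤ c' → Θ' ⟨i, c⟩ ≤ Θ' ⟨i, c'⟩)
    (h : content Θ = content Θ') : Θ = Θ' := by
  funext ⟨i, c⟩
  exact congrFun (eq_of_monotone_of_card_fiber_eq (f := fun c => Θ ⟨i, c⟩)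
    (g := fun c => Θ' ⟨i, c⟩) (h1 i) (h2 i) fun j => congrFun (congrFun h i) j) c

theorem SStd.content_injective : Function.Injective fun Θ : SStd ν κ => content Θ.1 :=
  fun Θ Θ' h => Subtype.ext (eq_of_content_eq Θ.2.1.1 Θ'.2.1.1 h)

theorem SStd.oppDomLE (Θ : SStd ν κ) : OppDomLE ν κ := ColStrict.oppDomLE Θ.2.1.2 Θ.2.2

theorem isWord_comp_symm {Θ : Cell ν → Fin n}
    (h : ∀ j : Fin n, (Finset.univ.filter fun b : Cell ν => Θ b = j).card = row κ j)
    (e : Cell ν ≃ Fin n) : IsWord κ (fun p => Θ (e.symm p)) := by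
  intro j
  rw [← h j]
  exact Finset.card_equiv e.symm (by simp)

end Content

/-! ### Permissible orbits and semistandard tableaux -/

section PermissibleOrbits

variable {k : Type*} [Field k] {n : ℕ} {ν κ : n.Partition}

theorem intMatrix_wordFlag_tableau {Θ Θ' : Cell ν → Fin n} {lam μ : n.Partition}
    (e : Cell ν ≃ Fin n) (h : IsWord lam (fun p => Θ (e.symm p)))
    (h' : IsWord μ (fun p => Θ' (e.symm p))) :
    intMatrix (wordFlag k h) (wordFlag k h') = jointCount Θ Θ' := by
  rw [intMatrix_wordFlag]
  exact jointCount_comp_equiv e.symm Θ Θ'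

theorem SStd.len_le (Θ : SStd ν κ) : len ν ≤ len κ := by
  by_contra hlt
  have h0 : len κ < len ν := not_le.1 hlt
  have hn : len κ < n := lt_of_lt_of_le h0 (FlagHecke.len_le ν)
  have h1 : 0 < row ν (⟨len κ, hn⟩ : Fin n) := (row_pos_iff ν _).2 h0
  have h2 := ColStrict.row_le Θ.2.1.2 ⟨⟨len κ, hn⟩, ⟨0, h1⟩⟩
  have h3 : 0 < row κ (Θ.1 ⟨⟨len κ, hn⟩, ⟨0, h1⟩⟩) := by
    rw [← Θ.2.2, Finset.card_pos]
    exact ⟨⟨⟨len κ, hn⟩, ⟨0, h1⟩⟩, by simp⟩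
  rw [row_pos_iff] at h3
  rw [Fin.le_def] at h2
  simp only at h2
  omega

/-- The inclusions of subspaces required for an embedding are the inequality of `ColStrict.row_le`:
a label is at least the index of its row. -/
theorem SStd.permissible (Θ : SStd ν κ) :
    Permissible (wordFlag k (isWord_block ν))
      (wordFlag k (isWord_comp_symm Θ.2.2 (rowReading ν))) := by
  refine ⟨⟨Θ.len_le, fun i _ v hv p hp => hv p (lt_of_le_of_lt ?_ hp)⟩, Θ.1, Θ.2.1, ?_⟩
  · exact ColStrict.row_le Θ.2.1.2 ((rowReading ν).symm p)
  · rw [content_eq_jointCount]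
    exact (intMatrix_wordFlag_tableau (Θ := fun b : Cell ν => b.1) _ _ _).symm

/-- The orbit of permissible embeddings attached to a semistandard tableau. -/
def SStd.orbit (k : Type*) [Field k] (Θ : SStd ν κ) : PermOrbits k ν κ :=
  ⟨Quotient.mk'' (wordFlag k (isWord_block ν),
    wordFlag k (isWord_comp_symm Θ.2.2 (rowReading ν))), _, _, Θ.permissible,
    MulAction.orbitRel.Quotient.mem_orbit.2 rfl⟩

theorem SStd.orbitMatrix_orbit (Θ : SStd ν κ) : orbitMatrix (Θ.orbit k).1 = content Θ.1 := by
  rw [content_eq_jointCount]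
  exact intMatrix_wordFlag_tableau (Θ := fun b : Cell ν => b.1) (rowReading ν) (isWord_block ν)
    (isWord_comp_symm Θ.2.2 (rowReading ν))

variable [Finite k]

theorem sum_intMatrix (z : FlagOf k ν) (x : FlagOf k κ) (j : Fin n) :
    ∑ i, intMatrix z x i j = row κ j := by
  obtain ⟨g, b, hb, rfl, rfl⟩ := exists_adapted z x
  rw [intMatrix_smul, intMatrix_wordFlag, sum_jointCount, hb]

/-- Both sides are determined by the same matrix, as content and as intersection matrix; its column
sums give the type of the tableau. -/
theorem SStd.orbit_bijective : Function.Bijective (SStd.orbit k : SStd ν κ → PermOrbits k ν κ) := by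
  constructor
  · intro Θ Θ' h
    apply SStd.content_injective
    simp only
    rw [← SStd.orbitMatrix_orbit (k := k), h, SStd.orbitMatrix_orbit]
  · rintro ⟨Ω, z, x, ⟨-, Θ, hΘ, hc⟩, hmem⟩
    let Θ' : SStd ν κ := ⟨Θ, hΘ, fun j => by
      rw [← sum_intMatrix z x j, ← hc, content_eq_jointCount, sum_jointCount]⟩
    refine ⟨Θ', Subtype.ext (orbitMatrix_injective ?_)⟩
    exact (SStd.orbitMatrix_orbit Θ').trans (hc.trans ((mem_orbit_iff _ _ _).1 hmem))

/-- Orbits of permissible embeddings correspond to semistandard tableaux. -/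
def permOrbitsEquiv (k : Type*) [Field k] [Finite k] {n : ℕ} (ν κ : n.Partition) :
    PermOrbits k ν κ ≃ SStd ν κ := (Equiv.ofBijective _ SStd.orbit_bijective).symm

theorem content_permOrbitsEquiv (Ω : PermOrbits k ν κ) :
    content (permOrbitsEquiv k ν κ Ω).1 = orbitMatrix Ω.1 := by
  rw [← SStd.orbitMatrix_orbit (k := k)]
  exact congrArg (fun Ω : PermOrbits k ν κ => orbitMatrix Ω.1)
    ((Equiv.ofBijective _ SStd.orbit_bijective).apply_symm_apply Ω)

end PermissibleOrbits

/-! ### Row-increasing refinements of flags -/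

section Refinement

variable {k : Type*} [Field k] {n : ℕ} {ν lam μ : n.Partition}

/-- Labels strictly increase along rows. -/
def RowIncreasing (θ : Cell ν ≃ Fin n) : Prop :=
  ∀ (i : Fin n) (c c' : Fin (row ν i)), c < c' → θ ⟨i, c⟩ < θ ⟨i, c'⟩

/-- So `d(θ)` is the distinguished representative of its coset of the Young subgroup. -/
theorem RowIncreasing.dPerm_lt {θ : Cell ν ≃ Fin n} (h : RowIncreasing θ) {p q : Fin n}
    (hb : block ν p = block ν q) (hpq : p < q) : dPerm θ p < dPerm θ q := by
  obtain ⟨⟨i, c⟩, rfl⟩ := (rowReading ν).surjective p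
  obtain ⟨⟨j, d⟩, rfl⟩ := (rowReading ν).surjective q
  rw [block_rowReading, block_rowReading] at hb
  simp only at hb
  subst hb
  rw [Fin.lt_def, rowReading_val, rowReading_val] at hpq
  rw [dPerm, Equiv.trans_apply, Equiv.trans_apply, Equiv.symm_apply_apply,
    Equiv.symm_apply_apply]
  exact h i c d (Nat.lt_of_add_lt_add_left hpq)

theorem RowIncreasing.eq_of_jointCount_eq {θ θ' : Cell ν ≃ Fin n} (h : RowIncreasing θ)
    (h' : RowIncreasing θ')
    (heq : jointCount (fun b : Cell ν => b.1) θ = jointCount (fun b : Cell ν => b.1) θ') :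
    θ = θ' := by
  rw [← content_eq_jointCount, ← content_eq_jointCount] at heq
  have hmono : ∀ θ : Cell ν ≃ Fin n, RowIncreasing θ → ∀ (i : Fin n) (c c' : Fin (row ν i)),
      c ≤ c' → θ ⟨i, c⟩ ≤ θ ⟨i, c'⟩ := by
    intro θ h i c c' hc
    rcases hc.eq_or_lt with rfl | hlt
    · exact le_rfl
    · exact (h i c c' hlt).le
  exact DFunLike.coe_injective (eq_of_content_eq (hmono θ h) (hmono θ' h') heq)

/-- Row `i` of `θ` lists in increasing order the values of `b` on the `i`-th block. -/
theorem exists_rowIncreasing (b : Equiv.Perm (Fin n)) :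
    ∃ θ : Cell ν ≃ Fin n, RowIncreasing θ ∧
      jointCount (fun b : Cell ν => b.1) θ = jointCount (block ν) b := by
  let S : Fin n → Finset (Fin n) := fun i =>
    (Finset.univ.filter fun p => block ν p = i).map b.toEmbedding
  have hS : ∀ i, (S i).card = row ν i := fun i => by
    rw [Finset.card_map, isWord_block]
  have hmem : ∀ i r, r ∈ S i ↔ block ν (b.symm r) = i := by
    intro i r
    simp only [S, Finset.mem_map_equiv, Finset.mem_filter, Finset.mem_univ, true_and]
  let f : Cell ν → Fin n := fun x => (S x.1).orderEmbOfFin (hS x.1) x.2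
  have hf : ∀ x, block ν (b.symm (f x)) = x.1 := fun x =>
    (hmem _ _).1 (Finset.orderEmbOfFin_mem _ _ _)
  have hinj : Function.Injective f := by
    rintro ⟨i, c⟩ ⟨j, d⟩ hxy
    have h1 := hf ⟨i, c⟩
    rw [hxy, hf] at h1
    simp only at h1
    subst h1
    simpa [f] using hxy
  have hbij : Function.Bijective f := by
    rw [Fintype.bijective_iff_injective_and_card]
    exact ⟨hinj, Fintype.card_congr (rowReading ν)⟩
  let θ : Cell ν ≃ Fin n := Equiv.ofBijective f hbij
  refine ⟨θ, fun i c c' hc => ((S i).orderEmbOfFin (hS i)).strictMono hc, ?_⟩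
  rw [← jointCount_comp_equiv (θ.trans b.symm) (block ν) b]
  congr 1
  · funext x
    exact (hf x).symm
  · funext x
    exact (b.apply_symm_apply _).symm

theorem jointCount_block_dPerm (θ : Cell ν ≃ Fin n) {α : Fin n → Fin n} :
    jointCount (block ν) (fun p => α (dPerm θ p)) =
      jointCount (fun b : Cell ν => b.1) (fun b => α (θ b)) := by
  rw [← jointCount_comp_equiv (rowReading ν)]
  congr 1
  · funext b
    exact block_rowReading ν b
  · funext b
    simp [dPerm]

/-- A matrix that preserves the coarse flag and the flag `permFlag k (dPerm θ)` preserves the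
complete flag obtained by refining the former along the latter. -/
theorem smul_permFlag_one_of_smul_eq {θ : Cell ν ≃ Fin n} (h : RowIncreasing θ)
    {t : Matrix.GeneralLinearGroup (Fin n) k}
    (h1 : t • wordFlag k (isWord_block ν) = wordFlag k (isWord_block ν))
    (h2 : t • permFlag k (dPerm θ) = permFlag k (dPerm θ)) :
    t • permFlag k (1 : Equiv.Perm (Fin n)) = permFlag k 1 := by
  apply smul_eq_of_mapsTo
  intro i v hv
  induction i using Fin.lastCases with
  | last =>
    rw [FlagOf.space_last, Submodule.mem_bot] at hv
    rw [hv, Matrix.mulVec_zero]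
    exact Submodule.zero_mem _
  | cast i =>
    rw [mem_permFlag] at hv ⊢
    simp only [Equiv.Perm.coe_one, id, Fin.val_castSucc] at hv ⊢
    -- The vector is split into its part in the block of `i` and its part in later blocks. A
    -- coordinate `p < i` of the image is controlled by `permFlag k (dPerm θ)` if `p` is in the same
    -- block, and by the coarse flag if it is in an earlier one.
    let v1 : Fin n → k := fun p => if block ν p = block ν i then v p else 0
    let v2 : Fin n → k := fun p => if block ν p = block ν i then 0 else v p
    have hv12 : v = v1 + v2 := by
      funext p
      simp only [v1, v2, Pi.add_apply]
      split_ifs <;> simp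
    have hlow : ∀ p, v p ≠ 0 → i ≤ p := fun p hp => by
      by_contra hlt
      exact hp (hv p (not_le.1 hlt))
    have hv1 : v1 ∈ (wordFlag k (isWord_block ν)).space (block ν i).castSucc := by
      intro p hp
      simp only [v1]
      rw [if_neg]
      rintro h
      rw [h] at hp
      exact absurd hp (lt_irrefl _)
    have hv1' : v1 ∈ (permFlag k (dPerm θ)).space (dPerm θ i).castSucc := by
      intro p hp
      simp only [v1]
      split_ifs with hb
      · by_contra hne
        rcases (hlow p hne).eq_or_lt with rfl | hlt
        · exact absurd hp (lt_irrefl _)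
        · exact absurd hp (h.dPerm_lt hb.symm hlt).not_gt
      · rfl
    have hv2 : v2 ∈ (wordFlag k (isWord_block ν)).space (block ν i).succ := by
      intro p hp
      simp only [v2]
      split_ifs with hb
      · rfl
      · by_contra hne
        apply hb
        apply le_antisymm
        · rw [Fin.val_succ] at hp
          exact Nat.lt_succ_iff.1 hp
        · exact block_mono ν (hlow p hne)
    have h3 := mulVec_mem_smul_space t _ _ hv1
    have h4 := mulVec_mem_smul_space t _ _ hv1'
    have h5 := mulVec_mem_smul_space t _ _ hv2
    rw [h1] at h3 h5
    rw [h2] at h4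
    intro p hp
    have hp' : p < i := hp
    rw [hv12, Matrix.mulVec_add, Pi.add_apply]
    have hb : block ν p ≤ block ν i := block_mono ν hp'.le
    rw [h5 p (by rw [Fin.val_succ]; exact Nat.lt_succ_of_le hb), add_zero]
    rcases hb.eq_or_lt with hb | hb
    · exact h4 p (h.dPerm_lt hb hp')
    · exact h3 p hb

variable [Finite k]

theorem intMatrix_coarsen {x y : FlagOf k (ones n)} {w : Equiv.Perm (Fin n)}
    (h : intMatrix x y = permMat w) :
    intMatrix (coarsen lam x) (coarsen μ y) =
      jointCount (block lam) (fun p => block μ (w p)) := by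
  obtain ⟨g, rfl, rfl⟩ := exists_smul_permFlag_of_intMatrix_eq h
  rw [coarsen_smul, coarsen_smul, intMatrix_smul, coarsen_permFlag_one, coarsen_permFlag,
    intMatrix_wordFlag]

theorem intMatrix_coarsen_left {x y : FlagOf k (ones n)} {w : Equiv.Perm (Fin n)}
    (h : intMatrix x y = permMat w) :
    intMatrix (coarsen lam x) y = jointCount (block lam) w := by
  obtain ⟨g, rfl, rfl⟩ := exists_smul_permFlag_of_intMatrix_eq h
  rw [coarsen_smul, intMatrix_smul, coarsen_permFlag_one, permFlag, intMatrix_wordFlag]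

theorem intMatrix_coarsen_dPerm {x y : FlagOf k (ones n)} {θ : Cell ν ≃ Fin n}
    (h : intMatrix x y = permMat (dPerm θ)) :
    intMatrix (coarsen ν x) (coarsen μ y) = content (reduceTableau μ θ) := by
  rw [intMatrix_coarsen h, jointCount_block_dPerm, content_eq_jointCount]
  rfl

/-- In an adapted basis, the refinement orders the basis vectors inside each layer of `z` as `y`
does. -/
theorem exists_refinement (z : FlagOf k ν) (y : FlagOf k (ones n)) :
    ∃ (x : FlagOf k (ones n)) (θ : Cell ν ≃ Fin n), RowIncreasing θ ∧ coarsen ν x = z ∧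
      intMatrix x y = permMat (dPerm θ) := by
  obtain ⟨g, b, hb, rfl, rfl⟩ := exists_adapted z y
  let b' : Equiv.Perm (Fin n) := Equiv.ofBijective b ((isWord_ones_iff b).1 hb)
  obtain ⟨θ, hθ, hc⟩ := exists_rowIncreasing (ν := ν) b'
  have hj : jointCount (block ν) (dPerm θ) = jointCount (block ν) b :=
    (jointCount_block_dPerm θ (α := id)).trans hc
  obtain ⟨γ, h1, h2⟩ := exists_smul_wordFlag_eq (k := k) (isWord_block ν) (isWord_perm (dPerm θ))
    (isWord_block ν) hb hj
  refine ⟨(g * γ) • permFlag k 1, θ, hθ, ?_, ?_⟩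
  · rw [coarsen_smul, coarsen_permFlag_one, mul_smul, h1]
  · rw [← h2, ← mul_smul, intMatrix_smul]
    exact intMatrix_permFlag_one _

/-- The position of the coarse flag relative to `y` determines `θ`; then the two refinements differ
by an element to which `smul_permFlag_one_of_smul_eq` applies. -/
theorem refinement_unique {x x' y : FlagOf k (ones n)} {θ θ' : Cell ν ≃ Fin n}
    (hθ : RowIncreasing θ) (hθ' : RowIncreasing θ') (hx : coarsen ν x = coarsen ν x')
    (h : intMatrix x y = permMat (dPerm θ)) (h' : intMatrix x' y = permMat (dPerm θ')) :
    x = x' ∧ θ = θ' := by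
  have heq : θ = θ' := by
    apply hθ.eq_of_jointCount_eq hθ'
    have h1 := intMatrix_coarsen_left (lam := ν) h
    have h2 := intMatrix_coarsen_left (lam := ν) h'
    rw [hx, h2] at h1
    exact (jointCount_block_dPerm θ (α := id)).symm.trans
      (h1.symm.trans (jointCount_block_dPerm θ' (α := id)))
  subst heq
  refine ⟨?_, rfl⟩
  obtain ⟨g, rfl, rfl⟩ := exists_smul_permFlag_of_intMatrix_eq h
  obtain ⟨g', rfl, hy⟩ := exists_smul_permFlag_of_intMatrix_eq h'
  rw [coarsen_smul, coarsen_smul, coarsen_permFlag_one] at hx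
  have h1 : (g⁻¹ * g') • wordFlag k (isWord_block ν) = wordFlag k (isWord_block ν) := by
    rw [mul_smul, ← hx, inv_smul_smul]
  have h2 : (g⁻¹ * g') • permFlag k (dPerm θ) = permFlag k (dPerm θ) := by
    rw [mul_smul, ← hy, inv_smul_smul]
  have h3 := smul_permFlag_one_of_smul_eq hθ h1 h2
  rw [mul_smul, inv_smul_eq_iff] at h3
  exact h3.symm

/-- Standardness of `θ` is automatic: `block μ` is monotone, so strict columns of `Θ` force strict
columns of `θ`. Hence the restriction to standard tableaux in `murphyElt` loses no refinement. -/
theorem rowIncreasing_of_reduceTableau_eq {Θ : SStd ν μ} {θ : Cell ν ≃ Fin n}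
    (h : RowIncreasing θ) (hc : content (reduceTableau μ θ) = content Θ.1) :
    IsStandard θ ∧ reduceTableau μ θ = Θ.1 := by
  have heq : reduceTableau μ θ = Θ.1 := by
    refine eq_of_content_eq (fun i c c' hcc => ?_) Θ.2.1.1 hc
    rcases hcc.eq_or_lt with rfl | hlt
    · exact le_rfl
    · exact block_mono μ (h i c c' hlt).le
  refine ⟨⟨h, fun i i' c c' hi hcc => ?_⟩, heq⟩
  have h1 := Θ.2.1.2 i i' c c' hi hcc
  rw [← heq] at h1
  by_contra hle
  exact absurd (block_mono μ (not_lt.1 hle)) h1.not_ge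

/-- The tableaux over which the sum defining `murphyElt` runs. -/
def stdFibre (Θ : SStd ν μ) : Finset (Cell ν ≃ Fin n) :=
  Finset.univ.filter (fun θ : Cell ν ≃ Fin n => IsStandard θ ∧ reduceTableau μ θ = Θ.1)

/-- The unique row-increasing refinement of `z` relative to `y` contributes exactly when its tableau
lies above `Θ`, which depends only on the position of `z` relative to the coarsening of `y`. -/
theorem sum_refinements (Θ : SStd ν μ) (z : FlagOf k ν) (y : FlagOf k (ones n)) :
    ∑ x : FlagOf k (ones n), (if coarsen ν x = z then (1 : ℚ) else 0) *
        ∑ θ ∈ stdFibre Θ, (if intMatrix x y = permMat (dPerm θ) then 1 else 0) =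
      if intMatrix z (coarsen μ y) = content Θ.1 then 1 else 0 := by
  split_ifs with hz
  · obtain ⟨x₀, θ₀, hθ₀, hx₀, hpos⟩ := exists_refinement z y
    have hc : content (reduceTableau μ θ₀) = content Θ.1 := by
      rw [← intMatrix_coarsen_dPerm hpos, hx₀, hz]
    have hmem : θ₀ ∈ stdFibre Θ := by
      rw [stdFibre, Finset.mem_filter]
      exact ⟨Finset.mem_univ _, rowIncreasing_of_reduceTableau_eq hθ₀ hc⟩
    rw [Finset.sum_eq_single x₀, if_pos hx₀, one_mul, Finset.sum_eq_single θ₀, if_pos hpos]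
    · intro θ hθ hne
      rw [if_neg]
      intro h
      rw [stdFibre, Finset.mem_filter] at hθ
      exact hne (refinement_unique hθ.2.1.1 hθ₀ rfl h hpos).2
    · exact fun h => absurd hmem h
    · intro x _ hne
      by_cases hx : coarsen ν x = z
      · rw [Finset.sum_eq_zero, mul_zero]
        intro θ hθ
        rw [if_neg]
        intro h
        rw [stdFibre, Finset.mem_filter] at hθ
        exact hne (refinement_unique hθ.2.1.1 hθ₀ (hx.trans hx₀.symm) h hpos).1
      · rw [if_neg hx, zero_mul]
    · simp
  · apply Finset.sum_eq_zero
    intro x _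
    by_cases hx : coarsen ν x = z
    · rw [Finset.sum_eq_zero, mul_zero]
      intro θ hθ
      rw [if_neg]
      intro h
      rw [stdFibre, Finset.mem_filter] at hθ
      apply hz
      rw [← hx, intMatrix_coarsen_dPerm h, hθ.2.2]
    · rw [if_neg hx, zero_mul]

end Refinement

/-! ### The Murphy elements as flag operators -/

section Murphy

variable {k : Type*} [Field k] [Finite k] {n : ℕ} {ν lam μ : n.Partition}

theorem pushforward_comp_sum (Θ : SStd ν μ) (Ω : Orbits k ν μ)
    (h : orbitMatrix Ω = content Θ.1) :
    (pushforward k ν).comp (∑ θ ∈ stdFibre Θ, gMap (permOrbit k (dPerm θ))) =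
      (gMap Ω).comp (pushforward k μ) := by
  apply kernel_ext
  intro z y
  rw [kernel_comp, kernel_comp]
  simp only [kernel_pushforward, kernel_sum, kernel_gMap, orbitMatrix_permOrbit, h]
  rw [sum_refinements]
  simp

theorem intMatrix_eq_permMat_inv_iff (x y : FlagOf k (ones n)) (w : Equiv.Perm (Fin n)) :
    intMatrix y x = permMat w⁻¹ ↔ intMatrix x y = permMat w := by
  simp only [funext_iff, permMat_inv, intMatrix_swap x y]
  exact forall_comm

theorem sum_comp_pullback (Θ : SStd ν lam) (Ω : Orbits k ν lam)
    (h : orbitMatrix Ω = content Θ.1) :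
    (∑ θ ∈ stdFibre Θ, gMap (permOrbit k (dPerm θ)⁻¹)).comp (pullback k ν) =
      (pullback k lam).comp (gMap Ω.op) := by
  apply kernel_ext
  intro y z
  rw [kernel_comp, kernel_comp]
  have h2 : ∀ y', kernel (gMap Ω.op) y' z = if intMatrix z y' = content Θ.1 then 1 else 0 := by
    intro y'
    rw [kernel_gMap, ← h]
    simp only [← mem_orbit_iff, mem_orbit_op_iff]
  simp only [kernel_pullback, kernel_sum, h2]
  simp only [kernel_gMap, orbitMatrix_permOrbit, intMatrix_eq_permMat_inv_iff]
  have h3 := sum_refinements Θ z y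
  simp only [mul_comm (ite (coarsen ν _ = z) _ _)] at h3
  rw [h3]
  simp only [ite_mul, one_mul, zero_mul, Finset.sum_ite_eq, Finset.mem_univ, if_true]

/-- Both kernels detect whether two complete flags have the same `ν`-coarsening. -/
theorem heckeEquiv_mElt :
    heckeEquiv k n (mElt ℚ (Nat.card k : ℚ) ν) = (pullback k ν).comp (pushforward k ν) := by
  rw [mElt, map_sum]
  simp only [heckeEquiv_T]
  apply homG_ones_ext
  intro v
  rw [kernel_sum, kernel_comp]
  simp only [kernel_gMap_permOrbit, kernel_pullback, kernel_pushforward]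
  rw [Finset.sum_ite_eq' (youngSubgroup ν) v (fun _ => (1 : ℚ))]
  have h : v ∈ youngSubgroup ν ↔
      coarsen ν (permFlag k v) = coarsen ν (permFlag k (1 : Equiv.Perm (Fin n))) := by
    rw [youngSubgroup, Finset.mem_filter, coarsen_permFlag, coarsen_permFlag_one]
    constructor
    · rintro ⟨-, h⟩
      congr 1
      funext r
      exact h r
    · intro h
      exact ⟨Finset.mem_univ _, fun r => congrFun (wordFlag_injective _ _ h) r⟩
  simp only [h, eq_comm (a := coarsen ν (permFlag k v))]
  simp

/-- Inflation as a linear map. -/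
def inflateHom (k : Type*) [Field k] [Finite k] {n : ℕ} (lam μ : n.Partition) :
    HomG k μ lam →ₗ[ℚ] HomG k (ones n) (ones n) where
  toFun A := inflate A
  map_add' A B := by
    apply kernel_ext
    intro x y
    simp only [inflate, kernel_add, kernel_comp, add_mul, mul_add, Finset.sum_add_distrib]
  map_smul' c A := by
    apply kernel_ext
    intro x y
    simp only [inflate, kernel_smul, kernel_comp, mul_assoc, Finset.mul_sum, RingHom.id_apply,
      mul_left_comm c]

theorem kernel_inflate (A : HomG k μ lam) (x y : FlagOf k (ones n)) :
    kernel (inflate A) x y = kernel A (coarsen lam x) (coarsen μ y) := by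
  rw [inflate, kernel_comp]
  simp only [kernel_pullback, kernel_comp, kernel_pushforward]
  simp

theorem inflate_injective : Function.Injective (inflate : HomG k μ lam → _) := by
  intro A B h
  apply kernel_ext
  intro x y
  obtain ⟨x, rfl⟩ := coarsen_surjective lam x
  obtain ⟨y, rfl⟩ := coarsen_surjective μ y
  rw [← kernel_inflate, h, kernel_inflate]

/-- The double sum factors, `m_ν` becomes pull-back after push-forward, and each outer sum slides
past its half. -/
theorem heckeEquiv_murphyElt {Θ₁ : SStd ν lam} {Θ₂ : SStd ν μ} {Ω₁ : Orbits k ν lam}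
    {Ω₂ : Orbits k ν μ} (h₁ : orbitMatrix Ω₁ = content Θ₁.1) (h₂ : orbitMatrix Ω₂ = content Θ₂.1) :
    heckeEquiv k n (murphyElt ℚ (Nat.card k : ℚ) Θ₁ Θ₂) = inflate (cMap Ω₁ Ω₂) := by
  have h : murphyElt ℚ (Nat.card k : ℚ) Θ₁ Θ₂ =
      (∑ θ ∈ stdFibre Θ₁, T ℚ (Nat.card k : ℚ) (dPerm θ)⁻¹) * mElt ℚ (Nat.card k : ℚ) ν *
        ∑ θ ∈ stdFibre Θ₂, T ℚ (Nat.card k : ℚ) (dPerm θ) := by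
    rw [Finset.sum_mul, Finset.sum_mul]
    refine Finset.sum_congr rfl fun θ _ => ?_
    rw [Finset.mul_sum]
    rfl
  rw [h, map_mul, map_mul, map_sum, map_sum, heckeEquiv_mElt]
  simp only [heckeEquiv_T]
  have h1 := sum_comp_pullback Θ₁ Ω₁ h₁
  have h2 := pushforward_comp_sum Θ₂ Ω₂ h₂
  calc _ = ((∑ θ ∈ stdFibre Θ₁, gMap (permOrbit k (dPerm θ)⁻¹)).comp (pullback k ν)).comp
        ((pushforward k ν).comp (∑ θ ∈ stdFibre Θ₂, gMap (permOrbit k (dPerm θ)))) := rfl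
    _ = ((pullback k lam).comp (gMap Ω₁.op)).comp ((gMap Ω₂).comp (pushforward k μ)) := by
      rw [h1, h2]
    _ = _ := rfl

end Murphy

/-! ### The index of a Borel subgroup in a parabolic subgroup -/

section Index

variable {k : Type*} [Field k] [Finite k] {n : ℕ} {ν lam μ : n.Partition}

theorem partialSum_ones {i : ℕ} (hi : i ≤ n) : partialSum (ones n) i = i := by
  unfold partialSum
  rw [Finset.sum_congr rfl (g := fun _ => 1)]
  · simp
  · intro a ha
    exact row_ones ⟨a, by have := Finset.mem_range.1 ha; omega⟩

/-- The reversal appears because the standard flag uses initial segments of the basis, whereas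
`permFlag k 1` uses final ones. -/
theorem stdFlag_ones : stdFlag k (ones n) = permFlag k Fin.revPerm := by
  apply FlagOf.eq_of_le
  intro i
  change Submodule.span k _ ≤ _
  rw [Submodule.span_le]
  rintro _ ⟨r, rfl⟩ p hp
  have hr := r.2
  have hi := partialSum_ones (n := n) (Nat.lt_succ_iff.1 i.2)
  rw [Function.comp_apply, Pi.basisFun_apply, Pi.single_eq_of_ne]
  rintro rfl
  rw [Fin.revPerm_apply, Fin.val_rev, Fin.val_castLE] at hp
  omega

theorem mem_upperTriangular_iff (g : Matrix.GeneralLinearGroup (Fin n) k) :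
    g ∈ upperTriangular k n ↔ g ∈ MulAction.stabilizer _ (stdFlag k (ones n)) := by
  rw [MulAction.mem_stabilizer_iff, stdFlag_ones]
  constructor
  · intro h
    apply smul_eq_of_mapsTo
    intro i v hv r hr
    rw [Matrix.mulVec, dotProduct]
    apply Finset.sum_eq_zero
    intro p _
    by_cases hp : p < r
    · rw [h r p hp, zero_mul]
    · rw [hv p, mul_zero]
      rw [Fin.revPerm_apply, Fin.val_rev] at hr ⊢
      rw [not_lt, Fin.le_def] at hp
      omega
  · intro h i j hij
    have h1 : (Pi.single j 1 : Fin n → k) ∈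
        (permFlag k Fin.revPerm).space (Fin.revPerm j).castSucc := by
      intro p hp
      rw [Pi.single_eq_of_ne]
      rintro rfl
      exact absurd hp (lt_irrefl _)
    have h2 := mulVec_mem_smul_space g _ _ h1
    rw [h] at h2
    have h3 := h2 i (by
      simp only [Fin.revPerm_apply, Fin.val_rev, Fin.val_castSucc]
      rw [Fin.lt_def] at hij
      omega)
    rwa [Matrix.mulVec_single_one] at h3

instance : MulAction.IsPretransitive (Matrix.GeneralLinearGroup (Fin n) k) (FlagOf k lam) where
  exists_smul_eq x y := by
    obtain ⟨g, -, -, hx, -⟩ := exists_adapted x x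
    obtain ⟨g', -, -, hy, -⟩ := exists_adapted y y
    exact ⟨g' * g⁻¹, by rw [hx, hy, mul_smul, inv_smul_smul]⟩

/-- The number of complete flags refining a given flag. -/
def refinementCard (z : FlagOf k ν) : ℕ :=
  (Finset.univ.filter fun x : FlagOf k (ones n) => coarsen ν x = z).card

theorem refinementCard_smul (g : Matrix.GeneralLinearGroup (Fin n) k) (z : FlagOf k ν) :
    refinementCard (g • z) = refinementCard z := by
  symm
  exact Finset.card_equiv (MulAction.toPerm g) (by simp [coarsen_smul])

theorem refinementCard_eq (z z' : FlagOf k ν) : refinementCard z = refinementCard z' := by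
  obtain ⟨g, rfl⟩ := MulAction.exists_smul_eq (Matrix.GeneralLinearGroup (Fin n) k) z z'
  exact (refinementCard_smul g z).symm

/-- Orbit-stabilizer for `ν`-flags and for complete flags, compared through the coarsening map,
whose fibres have equal size by transitivity. -/
theorem card_parabolic_eq (z : FlagOf k ν) :
    Nat.card (parabolic k ν) = refinementCard z * Nat.card (upperTriangular k n) := by
  have h1 : Nat.card (upperTriangular k n) =
      Nat.card (MulAction.stabilizer (Matrix.GeneralLinearGroup (Fin n) k)
        (stdFlag k (ones n))) :=
    Nat.card_congr (Equiv.subtypeEquivRight mem_upperTriangular_iff)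
  have h2 := (MulAction.stabilizer (Matrix.GeneralLinearGroup (Fin n) k)
    (stdFlag k (ones n))).card_mul_index
  have h3 := (MulAction.stabilizer (Matrix.GeneralLinearGroup (Fin n) k)
    (stdFlag k ν)).card_mul_index
  rw [MulAction.index_stabilizer_of_transitive] at h2 h3
  have h4 : Nat.card (FlagOf k (ones n)) = Nat.card (FlagOf k ν) * refinementCard z := by
    rw [Nat.card_eq_fintype_card, Nat.card_eq_fintype_card, ← Finset.card_univ,
      Finset.card_eq_sum_card_fiberwise (f := coarsen ν) (t := Finset.univ) (by simp)]
    change ∑ z' : FlagOf k ν, refinementCard z' = _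
    rw [Finset.sum_congr rfl fun z' _ => refinementCard_eq z' z]
    simp
  rw [h1]
  rw [h4, ← h3] at h2
  have hpos : 0 < Nat.card (FlagOf k ν) := Nat.card_pos_iff.2 ⟨⟨z⟩, inferInstance⟩
  apply Nat.eq_of_mul_eq_mul_right hpos
  unfold parabolic
  rw [← h2]
  ring

theorem card_upperTriangular_pos : 0 < Nat.card (upperTriangular k n) :=
  Nat.card_pos_iff.2 ⟨⟨⟨1, (mem_upperTriangular_iff 1).2 (one_mem _)⟩⟩, inferInstance⟩

theorem refinementCard_cast (z : FlagOf k ν) : (refinementCard z : ℚ) =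
    (Nat.card (parabolic k ν) : ℚ) / (Nat.card (upperTriangular k n) : ℚ) := by
  have h : (Nat.card (upperTriangular k n) : ℚ) ≠ 0 :=
    Nat.cast_ne_zero.2 card_upperTriangular_pos.ne'
  rw [eq_div_iff h, card_parabolic_eq z, Nat.cast_mul]

theorem pushforward_comp_pullback :
    (pushforward k ν).comp (pullback k ν) =
      ((Nat.card (parabolic k ν) : ℚ) / (Nat.card (upperTriangular k n) : ℚ)) •
        (1 : HomG k ν ν) := by
  apply kernel_ext
  intro z z'
  rw [kernel_comp, kernel_smul, kernel_one, ← refinementCard_cast z]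
  simp only [kernel_pullback, kernel_pushforward]
  split_ifs with h
  · subst h
    rw [refinementCard, Finset.card_filter, Nat.cast_sum, mul_one]
    refine Finset.sum_congr rfl fun x _ => ?_
    split_ifs <;> simp
  · rw [mul_zero]
    apply Finset.sum_eq_zero
    intro x _
    split_ifs with h1 h2
    · exact absurd (h1.symm.trans h2) h
    all_goals simp

theorem index_ne_zero :
    (Nat.card (parabolic k ν) : ℚ) / (Nat.card (upperTriangular k n) : ℚ) ≠ 0 :=
  div_ne_zero (Nat.cast_ne_zero.2 Nat.card_pos.ne')
    (Nat.cast_ne_zero.2 card_upperTriangular_pos.ne')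

/-! ### Products of inflated maps and the module `m_λ H m_μ`. -/

theorem inflate_comp (A : HomG k ν lam) (B : HomG k μ ν) :
    inflate A * inflate B =
      ((Nat.card (parabolic k ν) : ℚ) / (Nat.card (upperTriangular k n) : ℚ)) •
        inflate (A.comp B) := by
  calc inflate A * inflate B = ((pullback k lam).comp A).comp
        (((pushforward k ν).comp (pullback k ν)).comp (B.comp (pushforward k μ))) := rfl
    _ = _ := by
      rw [pushforward_comp_pullback]
      apply kernel_ext
      intro x y
      have h : ((((Nat.card (parabolic k ν) : ℚ) / (Nat.card (upperTriangular k n) : ℚ)) •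
          (1 : HomG k ν ν)).comp (B.comp (pushforward k μ))) =
          ((Nat.card (parabolic k ν) : ℚ) / (Nat.card (upperTriangular k n) : ℚ)) •
            (B.comp (pushforward k μ)) := rfl
      rw [h, kernel_smul, kernel_comp]
      simp only [kernel_smul, mul_left_comm _ (_ / _ : ℚ)]
      rw [← Finset.mul_sum, ← kernel_comp]
      rfl

/-- An element `m_λ a m_μ` visibly factors through pull-back and push-forward. Conversely, `m_λ` and
`m_μ` act on an inflated map by nonzero scalars, so dividing by their product exhibits it as such an
element. -/
theorem inflate_mem_iff (h : Hecke ℚ (Nat.card k : ℚ) n) :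
    h ∈ heckeModule ℚ (Nat.card k : ℚ) lam μ ↔ ∃ A : HomG k μ lam, inflate A = heckeEquiv k n h := by
  constructor
  · rintro ⟨a, rfl⟩
    refine ⟨(pushforward k lam).comp ((heckeEquiv k n a).comp (pullback k μ)), ?_⟩
    change _ = heckeEquiv k n (mElt ℚ (Nat.card k : ℚ) lam * (a * mElt ℚ (Nat.card k : ℚ) μ))
    rw [map_mul, map_mul, heckeEquiv_mElt, heckeEquiv_mElt]
    rfl
  · rintro ⟨A, hA⟩
    set c := (Nat.card (parabolic k lam) : ℚ) / (Nat.card (upperTriangular k n) : ℚ)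
    set d := (Nat.card (parabolic k μ) : ℚ) / (Nat.card (upperTriangular k n) : ℚ)
    have h1 : heckeEquiv k n (mElt ℚ (Nat.card k : ℚ) lam * (h * mElt ℚ (Nat.card k : ℚ) μ)) =
        (c * d) • heckeEquiv k n h := by
      rw [map_mul, map_mul, heckeEquiv_mElt, heckeEquiv_mElt, ← hA]
      have hlam : (pullback k lam).comp (pushforward k lam) = inflate (1 : HomG k lam lam) := rfl
      have hμ : (pullback k μ).comp (pushforward k μ) = inflate (1 : HomG k μ μ) := rfl
      rw [hlam, hμ, inflate_comp, mul_smul_comm, inflate_comp, smul_smul, mul_comm]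
      rfl
    refine ⟨(c * d)⁻¹ • h, ?_⟩
    apply (heckeEquiv k n).injective
    change heckeEquiv k n (mElt ℚ (Nat.card k : ℚ) lam *
      (((c * d)⁻¹ • h) * mElt ℚ (Nat.card k : ℚ) μ)) = _
    rw [smul_mul_assoc, mul_smul_comm, map_smul, h1, smul_smul, inv_mul_cancel₀, one_smul]
    exact mul_ne_zero index_ne_zero index_ne_zero

/-- `Hom_G(F_μ, F_lam)` is `m_lam H m_μ`. -/
def homEquivHeckeModule (k : Type*) [Field k] [Finite k] {n : ℕ} (lam μ : n.Partition) :
    HomG k μ lam ≃ₗ[ℚ] heckeModule ℚ (Nat.card k : ℚ) lam μ :=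
  LinearEquiv.ofBijective
    (((heckeEquiv k n).symm.toLinearMap.comp (inflateHom k lam μ)).codRestrict _ fun A =>
      (inflate_mem_iff _).2 ⟨A, ((heckeEquiv k n).apply_symm_apply (inflate A)).symm⟩)
    ⟨fun A B h => inflate_injective ((heckeEquiv k n).symm.injective (congrArg Subtype.val h)),
      fun h => by
        obtain ⟨A, hA⟩ := (inflate_mem_iff _).1 h.2
        refine ⟨A, Subtype.ext ?_⟩
        change (heckeEquiv k n).symm (inflate A) = _
        rw [hA, AlgEquiv.symm_apply_apply]⟩

theorem coe_homEquivHeckeModule (A : HomG k μ lam) :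
    (homEquivHeckeModule k lam μ A : Hecke ℚ (Nat.card k : ℚ) n) =
      (heckeEquiv k n).symm (inflate A) := rfl

end Index

/-! ### Reading a diagram along its columns -/

section ColumnReading

variable {n : ℕ} {ν κ : n.Partition}

/-- The columns are read successively, each one from bottom to top. -/
def columnKey (b : Cell ν) : ℕ := (b.2 : ℕ) * n + (n - 1 - b.1)

theorem columnKey_injective : Function.Injective (columnKey : Cell ν → ℕ) := by
  rintro ⟨i, c⟩ ⟨j, d⟩ h
  have hi := i.2
  have hj := j.2
  have hc : (c : ℕ) = d := by
    have h1 : ((c : ℕ) * n + (n - 1 - i)) / n = c := by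
      rw [mul_comm, Nat.mul_add_div (by omega), Nat.div_eq_of_lt (by omega), add_zero]
    have h2 : ((d : ℕ) * n + (n - 1 - j)) / n = d := by
      rw [mul_comm, Nat.mul_add_div (by omega), Nat.div_eq_of_lt (by omega), add_zero]
    rw [← h1, ← h2]
    exact congrArg (· / n) h
  have hij : i = j := by
    simp only [columnKey, hc] at h
    exact Fin.ext (by omega)
  subst hij
  rw [Fin.ext hc]

/-- Boxes are ranked by `columnKey`, and vertically adjacent boxes have consecutive keys. They thus
receive consecutive numbers, which puts them at simple root positions of the unitriangular group. -/
theorem exists_columnReading (ν : n.Partition) : ∃ e : Cell ν ≃ Fin n,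
    ∀ b b' : Cell ν, (b.1 : ℕ) + 1 = b'.1 → (b.2 : ℕ) = b'.2 → (e b' : ℕ) + 1 = e b := by
  let S : Cell ν → Finset (Cell ν) := fun b => Finset.univ.filter fun b' =>
    columnKey b' < columnKey b
  have hcard : Fintype.card (Cell ν) = n := by
    rw [Fintype.card_congr (rowReading ν), Fintype.card_fin]
  have hlt : ∀ b, (S b).card < n := by
    intro b
    conv_rhs => rw [← hcard]
    exact Finset.card_lt_univ_of_notMem (x := b) (by simp [S])
  have hmono : ∀ b b', columnKey b < columnKey b' → (S b).card < (S b').card := by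
    intro b b' h
    apply Finset.card_lt_card
    rw [Finset.ssubset_iff_of_subset]
    · exact ⟨b, by simp [S, h], by simp [S]⟩
    · intro x hx
      simp only [S, Finset.mem_filter, Finset.mem_univ, true_and] at hx ⊢
      omega
  let f : Cell ν → Fin n := fun b => ⟨(S b).card, hlt b⟩
  have hinj : Function.Injective f := by
    intro b b' h
    have h1 : (S b).card = (S b').card := congrArg Fin.val h
    apply columnKey_injective
    rcases lt_trichotomy (columnKey b) (columnKey b') with h2 | h2 | h2
    · exact absurd h1 (hmono _ _ h2).ne
    · exact h2
    · exact absurd h1 (hmono _ _ h2).ne'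
  have hbij : Function.Bijective f := by
    rw [Fintype.bijective_iff_injective_and_card]
    exact ⟨hinj, Fintype.card_congr (rowReading ν)⟩
  refine ⟨Equiv.ofBijective f hbij, fun b b' h1 h2 => ?_⟩
  change (S b').card + 1 = (S b).card
  have hkey : columnKey b = columnKey b' + 1 := by
    have := b'.1.2
    simp only [columnKey, h2]
    omega
  have : S b = insert b' (S b') := by
    ext x
    simp only [S, Finset.mem_filter, Finset.mem_univ, true_and, Finset.mem_insert, hkey]
    rw [Nat.lt_succ_iff_lt_or_eq, or_comm, columnKey_injective.eq_iff]
  rw [this, Finset.card_insert_of_notMem (by simp [S])]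

theorem colStrict_of_adjacent {Θ : Cell ν → Fin n}
    (h : ∀ b b' : Cell ν, (b.1 : ℕ) + 1 = b'.1 → (b.2 : ℕ) = b'.2 → Θ b < Θ b') :
    ColStrict Θ := by
  intro i i' c c' hi hc
  obtain ⟨d, hd⟩ : ∃ d, (i' : ℕ) = i + 1 + d := ⟨i' - (i + 1), by rw [Fin.lt_def] at hi; omega⟩
  induction d generalizing i' with
  | zero => exact h ⟨i, c⟩ ⟨i', c'⟩ hd.symm hc
  | succ d ih =>
    have hlt : (i : ℕ) + 1 + d < n := by have := i'.2; omega
    let j : Fin n := ⟨i + 1 + d, hlt⟩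
    have hrow : row ν i' ≤ row ν j := row_antitone ν (by change (i : ℕ) + 1 + d ≤ i'; omega)
    have h1 := ih j ⟨c', lt_of_lt_of_le c'.2 hrow⟩ (by
      rw [Fin.lt_def]; change (i : ℕ) < i + 1 + d; omega) hc rfl
    exact h1.trans (h ⟨j, ⟨c', lt_of_lt_of_le c'.2 hrow⟩⟩ ⟨i', c'⟩
      (by change (i : ℕ) + 1 + d + 1 = i'; omega) rfl)

end ColumnReading

/-! ### Characters of the unitriangular group -/

section Character

variable {k : Type*} [Field k] [Finite k] {n : ℕ} {κ : n.Partition}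

/-- The function on matrices attached to an additive character and a set of positions. -/
def psi (D : Finset (Fin n × Fin n)) (χ : AddChar k ℂ)
    (g : Matrix.GeneralLinearGroup (Fin n) k) : ℂ :=
  χ (∑ d ∈ D, (g : Matrix (Fin n) (Fin n) k) d.2 d.1)

variable {D : Finset (Fin n × Fin n)} (hD : ∀ d ∈ D, (d.1 : ℕ) + 1 = d.2) (χ : AddChar k ℂ)

/-- Subdiagonal entries add under multiplication of lower unitriangular matrices. -/
theorem psi_mul (hD : ∀ d ∈ D, (d.1 : ℕ) + 1 = d.2) {g h : Matrix.GeneralLinearGroup (Fin n) k}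
    (hg : g ∈ unip k n) (hh : h ∈ unip k n) : psi D χ (g * h) = psi D χ g * psi D χ h := by
  unfold psi
  rw [← AddChar.map_add_eq_mul, ← Finset.sum_add_distrib]
  congr 1
  refine Finset.sum_congr rfl fun d hd => ?_
  have hpq := hD d hd
  have hne : d.1 ≠ d.2 := fun h => by
    rw [h] at hpq
    omega
  rw [Units.val_mul, Matrix.mul_apply, Finset.sum_eq_add d.1 d.2 hne]
  · rw [hh d.1 d.1 le_rfl, hg d.2 d.2 le_rfl, if_pos rfl, if_pos rfl, mul_one, one_mul]
  · rintro r - ⟨h1, h2⟩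
    rcases lt_or_gt_of_ne h1 with h3 | h3
    · rw [hh r d.1 h3.le, if_neg h1, mul_zero]
    · have h4 : d.2 < r := by
        apply lt_of_le_of_ne _ h2.symm
        rw [Fin.lt_def] at h3
        rw [Fin.le_def]
        omega
      rw [hg d.2 r h4.le, if_neg h4.ne, zero_mul]
  · simp
  · simp

theorem psi_inv_mul_psi (g : Matrix.GeneralLinearGroup (Fin n) k) :
    psi D χ⁻¹ g * psi D χ g = 1 := by
  unfold psi
  rw [AddChar.inv_apply, ← AddChar.map_add_eq_mul, neg_add_cancel, AddChar.map_zero_eq_one]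

theorem psi_transGL {d : Fin n × Fin n} (hd : d ∈ D) (hlt : d.1 < d.2)
    (hD : ∀ d ∈ D, (d.1 : ℕ) + 1 = d.2) (c : k) : psi D χ (transGL hlt.ne' c) = χ c := by
  unfold psi
  congr 1
  rw [Finset.sum_eq_single d]
  · change Matrix.transvection d.2 d.1 c d.2 d.1 = c
    simp [Matrix.transvection, hlt.ne']
  · intro d' hd' hne
    have h1 : d'.2 ≠ d'.1 := fun h => by
      have := hD d' hd'
      rw [h] at this
      omega
    change Matrix.transvection d.2 d.1 c d'.2 d'.1 = 0
    rw [Matrix.transvection, Matrix.add_apply, Matrix.one_apply_ne h1, Matrix.single_apply,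
      if_neg, add_zero]
    rintro ⟨h2, h3⟩
    exact hne (Prod.ext h3.symm h2.symm)
  · exact fun h => absurd hd h

/-- `f` transforms under the unitriangular group by the character `psi D χ`. -/
def IsEquivariant (D : Finset (Fin n × Fin n)) (χ : AddChar k ℂ) (f : FlagOf k κ → ℂ) : Prop :=
  ∀ u ∈ unip k n, ∀ z, f (u • z) = psi D χ u * f z

/-- If the letters did not decrease strictly along a pair of `D`, the root subgroup of that pair
would fix the coordinate flag while acting on the value of `f` by a nontrivial character. -/
theorem IsEquivariant.exists_of_ne_zero {χ : AddChar k ℂ} (hD : ∀ d ∈ D, (d.1 : ℕ) + 1 = d.2)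
    (hχ : ∃ c, χ c ≠ 1) {f : FlagOf k κ → ℂ} (hf : IsEquivariant D χ f) {z : FlagOf k κ}
    (hz : f z ≠ 0) : ∃ u ∈ unip k n, ∃ (a : Fin n → Fin n) (h : IsWord κ a),
      z = u • wordFlag k h ∧ ∀ d ∈ D, a d.2 < a d.1 := by
  obtain ⟨u, hu, a, ha, rfl⟩ := exists_unip_smul_wordFlag z
  refine ⟨u, hu, a, ha, rfl, fun d hd => ?_⟩
  by_contra hle
  obtain ⟨c, hc⟩ := hχ
  have hlt : d.1 < d.2 := by
    have := hD d hd
    rw [Fin.lt_def]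
    omega
  rw [hf u hu] at hz
  have h1 := hf (transGL hlt.ne' c) (transGL_mem_unip hlt c) (wordFlag k ha)
  rw [transGL_smul_wordFlag ha hlt.ne' (not_lt.1 hle), psi_transGL χ hd hlt hD] at h1
  have h2 : (χ c - 1) * f (wordFlag k ha) = 0 := by
    rw [sub_mul, one_mul, ← h1, sub_self]
  rcases mul_eq_zero.1 h2 with h3 | h3
  · exact hc (sub_eq_zero.1 h3)
  · rw [h3, mul_zero] at hz
    exact hz rfl

instance : Fintype (unip k n) := Fintype.ofFinite _

/-- The twisted number of `u` such that `(z, u • x)` has intersection matrix `C`. -/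
def twistedCount {μ : n.Partition} (D : Finset (Fin n × Fin n)) (χ : AddChar k ℂ)
    (C : Fin n → Fin n → ℕ) (x : FlagOf k μ) (z : FlagOf k κ) : ℂ :=
  ∑ u : unip k n, psi D χ u.1 * if intMatrix z (u.1 • x) = C then 1 else 0

/-- Substitution `u ↦ v u` in the sum. -/
theorem isEquivariant_twistedCount {μ : n.Partition} (hD : ∀ d ∈ D, (d.1 : ℕ) + 1 = d.2)
    (C : Fin n → Fin n → ℕ) (x : FlagOf k μ) :
    IsEquivariant D χ (twistedCount D χ C x : FlagOf k κ → ℂ) := by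
  intro v hv z
  unfold twistedCount
  rw [Finset.mul_sum]
  symm
  refine Fintype.sum_equiv (Equiv.mulLeft (⟨v, hv⟩ : unip k n)) _ _ fun u => ?_
  change _ = psi D χ (v * u.1) * if intMatrix (v • z) ((v * u.1) • x) = C then 1 else 0
  rw [psi_mul χ hD hv u.2, mul_smul, intMatrix_smul, mul_assoc]

end Character

/-! ### Column-strict words -/

section Triangularity

variable {k : Type*} [Field k] [Finite k] {n : ℕ} {ν κ μ : n.Partition}

/-- Pairs of vertically adjacent boxes, the lower one first. -/
def columnPairs (e : Cell ν ≃ Fin n) : Finset (Fin n × Fin n) :=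
  Finset.univ.filter fun d => ((e.symm d.2).1 : ℕ) + 1 = (e.symm d.1).1 ∧
    ((e.symm d.2).2 : ℕ) = (e.symm d.1).2

/-- A numbering of the boxes along the columns, from bottom to top. -/
def IsColumnReading (e : Cell ν ≃ Fin n) : Prop :=
  ∀ b b' : Cell ν, (b.1 : ℕ) + 1 = b'.1 → (b.2 : ℕ) = b'.2 → (e b' : ℕ) + 1 = e b

theorem IsColumnReading.pairs {e : Cell ν ≃ Fin n} (he : IsColumnReading e) :
    ∀ d ∈ columnPairs e, (d.1 : ℕ) + 1 = d.2 := by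
  intro d hd
  rw [columnPairs, Finset.mem_filter] at hd
  have := he _ _ hd.2.1 hd.2.2
  rwa [Equiv.apply_symm_apply, Equiv.apply_symm_apply] at this

theorem colStrict_of_columnPairs {e : Cell ν ≃ Fin n} {a : Fin n → Fin n}
    (h : ∀ d ∈ columnPairs e, a d.2 < a d.1) : ColStrict fun b => a (e b) := by
  apply colStrict_of_adjacent
  intro b b' h1 h2
  refine h (e b', e b) ?_
  rw [columnPairs, Finset.mem_filter]
  have key : ∀ b : Cell ν, ((e.symm (e b)).2 : ℕ) = b.2 := fun b =>
    congrArg (fun b : Cell ν => (b.2 : ℕ)) (e.symm_apply_apply b)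
  refine ⟨Finset.mem_univ _, ?_, ?_⟩
  · simpa using h1
  · exact (key b).trans (h2.trans (key b').symm)

theorem ColStrict.lt_of_mem_columnPairs {e : Cell ν ≃ Fin n} {Θ : Cell ν → Fin n}
    (h : ColStrict Θ) {d : Fin n × Fin n} (hd : d ∈ columnPairs e) :
    Θ (e.symm d.2) < Θ (e.symm d.1) := by
  rw [columnPairs, Finset.mem_filter] at hd
  have h1 := hd.2.1
  exact h _ _ (e.symm d.2).2 (e.symm d.1).2 (by rw [Fin.lt_def]; omega) hd.2.2

theorem IsWord.card_comp {a : Fin n → Fin n} (h : IsWord κ a) (e : Cell ν ≃ Fin n) (j : Fin n) :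
    (Finset.univ.filter fun b : Cell ν => a (e b) = j).card = row κ j := by
  rw [← h j]
  exact Finset.card_equiv e (by simp)

theorem IsEquivariant.oppDomLE {χ : AddChar k ℂ} {e : Cell ν ≃ Fin n} (he : IsColumnReading e)
    (hχ : ∃ c, χ c ≠ 1) {f : FlagOf k κ → ℂ} (hf : IsEquivariant (columnPairs e) χ f)
    {z : FlagOf k κ} (hz : f z ≠ 0) : OppDomLE ν κ := by
  obtain ⟨u, -, a, ha, -, h⟩ := hf.exists_of_ne_zero he.pairs hχ hz
  exact (colStrict_of_columnPairs h).oppDomLE (ha.card_comp e)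

/-- The coordinate flag attached to the tableau whose `i`-th row is filled by `i`. -/
def rowFlag (k : Type*) [Field k] {n : ℕ} {ν : n.Partition} (e : Cell ν ≃ Fin n) : FlagOf k ν :=
  wordFlag k (isWord_comp_symm (Θ := fun b : Cell ν => b.1) (card_cell_row ν) e)

/-- The coordinate flag attached to a semistandard tableau. -/
def SStd.flag (k : Type*) [Field k] {n : ℕ} {ν μ : n.Partition} (Θ : SStd ν μ)
    (e : Cell ν ≃ Fin n) : FlagOf k μ := wordFlag k (isWord_comp_symm Θ.2.2 e)

/-- The word of a flag in the support is a column-strict filling of `ν` of type `ν`, which is unique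
by `ColStrict.eq_row`. -/
theorem IsEquivariant.exists_smul_rowFlag {χ : AddChar k ℂ} {e : Cell ν ≃ Fin n}
    (he : IsColumnReading e) (hχ : ∃ c, χ c ≠ 1) {f : FlagOf k ν → ℂ}
    (hf : IsEquivariant (columnPairs e) χ f) {z : FlagOf k ν} (hz : f z ≠ 0) :
    ∃ u ∈ unip k n, z = u • rowFlag k e := by
  obtain ⟨u, hu, a, ha, rfl, h⟩ := hf.exists_of_ne_zero he.pairs hχ hz
  refine ⟨u, hu, ?_⟩
  congr 1
  have h1 : a = fun p => (e.symm p).1 := by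
    funext p
    have := (colStrict_of_columnPairs h).eq_row (ha.card_comp e) (e.symm p)
    simpa using this
  subst h1
  rfl

theorem intMatrix_rowFlag (e : Cell ν ≃ Fin n) (Θ : SStd ν μ) :
    intMatrix (rowFlag k e) (Θ.flag k e) = content Θ.1 := by
  rw [content_eq_jointCount]
  exact intMatrix_wordFlag_tableau (Θ := fun b : Cell ν => b.1) e _ _

/-! ### Corner counts and the triangularity of twisted counts. -/

/-- The number of boxes in rows `≥ i` with labels `≥ j`. -/
def cornerCount (Θ : Cell ν → Fin n) (i j : ℕ) : ℕ :=
  (Finset.univ.filter fun b : Cell ν => i ≤ (b.1 : ℕ) ∧ j ≤ (Θ b : ℕ)).card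

theorem content_eq_of_cornerCount_eq {Θ Θ' : Cell ν → Fin n}
    (h : ∀ i ≤ n, ∀ j ≤ n, cornerCount Θ i j = cornerCount Θ' i j) : content Θ = content Θ' := by
  rw [content_eq_jointCount, content_eq_jointCount]
  funext i j
  have key : ∀ Θ : Cell ν → Fin n, jointCount (fun b : Cell ν => b.1) Θ i j +
      cornerCount Θ i (j + 1) + cornerCount Θ (i + 1) j =
        cornerCount Θ i j + cornerCount Θ (i + 1) (j + 1) := by
    intro Θ
    have h1 := card_corner (fun b : Cell ν => (b.1 : ℕ)) (fun b => (Θ b : ℕ)) i j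
    simpa only [jointCount, cornerCount, Fin.ext_iff] using h1
  have h1 := key Θ
  have h2 := key Θ'
  have hi := i.2
  have hj := j.2
  rw [h i (by omega) j (by omega), h i (by omega) (j + 1) (by omega),
    h (i + 1) (by omega) j (by omega), h (i + 1) (by omega) (j + 1) (by omega)] at h1
  omega

/-- Translation by `u` preserves leading positions, but after translation the intersection may have
fewer of them; this inequality is the source of triangularity. -/
theorem lead_inf_subset (e : Cell ν ≃ Fin n) (Θ : SStd ν μ)
    {u : Matrix.GeneralLinearGroup (Fin n) k} (hu : u ∈ unip k n) (i j : Fin (n + 1)) :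
    lead ((rowFlag k e).space i ⊓ (u • Θ.flag k e).space j) ⊆
      Finset.univ.filter fun p => (i : ℕ) ≤ (e.symm p).1 ∧ (j : ℕ) ≤ Θ.1 (e.symm p) := by
  intro p hp
  have h1 := lead_mono inf_le_left hp
  have h2 := lead_mono inf_le_right hp
  rw [lead_unip_smul hu] at h2
  have h3 := (lead_wordSpace (k := k) (fun p => (e.symm p).1) i) ▸ h1
  have h4 := (lead_wordSpace (k := k) (fun p => Θ.1 (e.symm p)) j) ▸ h2
  rw [Finset.mem_filter] at h3 h4 ⊢
  exact ⟨h3.1, h3.2, h4.2⟩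

theorem card_filter_symm (e : Cell ν ≃ Fin n) (Θ : Cell ν → Fin n) (i j : ℕ) :
    (Finset.univ.filter fun p => i ≤ ((e.symm p).1 : ℕ) ∧ j ≤ (Θ (e.symm p) : ℕ)).card =
      cornerCount Θ i j := Finset.card_equiv e.symm (by simp)

theorem finrank_inf_of_intMatrix_eq {e : Cell ν ≃ Fin n} {Θ Θ' : SStd ν μ}
    {u : Matrix.GeneralLinearGroup (Fin n) k}
    (h : intMatrix (rowFlag k e) (u • Θ'.flag k e) = content Θ.1) (i j : Fin (n + 1)) :
    (lead ((rowFlag k e).space i ⊓ (u • Θ'.flag k e).space j)).card = cornerCount Θ.1 i j := by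
  rw [← intMatrix_rowFlag (k := k) e Θ, intMatrix_eq_iff] at h
  rw [← finrank_eq_card_lead, h.2.2 i j, ← card_filter_symm e]
  exact finrank_wordFlag_inf (isWord_comp_symm (Θ := fun b : Cell ν => b.1) (card_cell_row ν) e)
    (isWord_comp_symm Θ.2.2 e) i j

theorem cornerCount_le {e : Cell ν ≃ Fin n} {Θ Θ' : SStd ν μ}
    {u : Matrix.GeneralLinearGroup (Fin n) k} (hu : u ∈ unip k n)
    (h : intMatrix (rowFlag k e) (u • Θ'.flag k e) = content Θ.1) (i j : ℕ) (hi : i ≤ n)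
    (hj : j ≤ n) : cornerCount Θ.1 i j ≤ cornerCount Θ'.1 i j := by
  have h1 := finrank_inf_of_intMatrix_eq h ⟨i, by omega⟩ ⟨j, by omega⟩
  rw [← h1, ← card_filter_symm e]
  exact Finset.card_le_card (lead_inf_subset e Θ' hu ⟨i, by omega⟩ ⟨j, by omega⟩)

/-- If `u` preserves the relative position of two coordinate flags that belong to column-strict
fillings, then its entries at vertically adjacent positions vanish. -/
theorem entry_eq_zero {e : Cell ν ≃ Fin n} (he : IsColumnReading e) {Θ : SStd ν μ}
    {u : Matrix.GeneralLinearGroup (Fin n) k} (hu : u ∈ unip k n)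
    (h : intMatrix (rowFlag k e) (u • Θ.flag k e) = content Θ.1) {d : Fin n × Fin n}
    (hd : d ∈ columnPairs e) : (u : Matrix (Fin n) (Fin n) k) d.2 d.1 = 0 := by
  have hlt := he.pairs d hd
  obtain ⟨p, q⟩ := d
  simp only at hlt ⊢
  have hrow : (e.symm q).1 < (e.symm p).1 :=
    ColStrict.lt_of_mem_columnPairs (Θ := fun b => b.1) (fun i i' c c' hi _ => hi) hd
  have hlab : Θ.1 (e.symm q) < Θ.1 (e.symm p) := ColStrict.lt_of_mem_columnPairs Θ.2.1.2 hd
  -- Equal cardinalities turn the inclusion of `lead_inf_subset` into an equality, so some `v` in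
  -- the intersection leads at `p`. Both `v` and `w = u⁻¹ v` vanish at `q = p + 1`, and comparing
  -- coordinates at `q` in `v = u w` isolates the entry of `u`.
  have hp : p ∈ lead ((rowFlag k e).space (e.symm p).1.castSucc ⊓
      (u • Θ.flag k e).space (Θ.1 (e.symm p)).castSucc) := by
    rw [Finset.eq_of_subset_of_card_le (lead_inf_subset e Θ hu _ _)
      (by rw [finrank_inf_of_intMatrix_eq h, card_filter_symm])]
    simp
  obtain ⟨v, ⟨hv1, hv2⟩, hvp, hv0⟩ := mem_lead.1 hp
  have hvq : v q = 0 := hv1 q hrow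
  rw [SetLike.mem_coe, mem_smul_space] at hv2
  set w := ((u⁻¹ : Matrix.GeneralLinearGroup (Fin n) k) : Matrix (Fin n) (Fin n) k).mulVec v
    with hw
  have hwq : w q = 0 := hv2 q hlab
  obtain ⟨hw0, hwp⟩ := unip_mulVec_lead (show u⁻¹ ∈ unip k n from inv_mem hu) hv0
  rw [← hw] at hw0 hwp
  have hvw : v = (u : Matrix (Fin n) (Fin n) k).mulVec w := by
    rw [hw, Matrix.mulVec_mulVec, ← Units.val_mul, mul_inv_cancel, Units.val_one,
      Matrix.one_mulVec]
  have hsum : (u : Matrix (Fin n) (Fin n) k).mulVec w q =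
      (u : Matrix (Fin n) (Fin n) k) q p := by
    rw [Matrix.mulVec, dotProduct, Finset.sum_eq_single p]
    · rw [hwp, hvp, mul_one]
    · intro r _ hr
      rcases lt_trichotomy r q with h1 | h1 | h1
      · have : r < p := by
          rw [Fin.lt_def] at h1 ⊢
          have := Fin.val_ne_of_ne hr
          omega
        rw [hw0 r this, mul_zero]
      · rw [h1, hwq, mul_zero]
      · rw [hu q r h1.le, if_neg h1.ne, zero_mul]
    · simp
  rw [← hsum, ← hvw, hvq]

/-- On the diagonal every contributing `u` has character value one by `entry_eq_zero`, so the
twisted count is an honest count, and `u = 1` contributes. -/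
theorem twistedCount_self_ne_zero {e : Cell ν ≃ Fin n} (he : IsColumnReading e)
    (χ : AddChar k ℂ) (Θ : SStd ν μ) :
    twistedCount (columnPairs e) χ (content Θ.1) (Θ.flag k e) (rowFlag k e) ≠ 0 := by
  have h1 : twistedCount (columnPairs e) χ (content Θ.1) (Θ.flag k e) (rowFlag k e) =
      ((Finset.univ.filter fun u : unip k n =>
        intMatrix (rowFlag k e) (u.1 • Θ.flag k e) = content Θ.1).card : ℂ) := by
    rw [twistedCount, Finset.card_filter, Nat.cast_sum]
    refine Finset.sum_congr rfl fun u _ => ?_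
    split_ifs with h
    · rw [psi, Finset.sum_eq_zero fun d hd => entry_eq_zero he u.2 h hd,
        AddChar.map_zero_eq_one]
      simp
    · simp
  rw [h1, Nat.cast_ne_zero, Finset.card_ne_zero]
  refine ⟨1, ?_⟩
  rw [Finset.mem_filter]
  refine ⟨Finset.mem_univ _, ?_⟩
  rw [OneMemClass.coe_one, one_smul, intMatrix_rowFlag]

theorem cornerCount_le_of_twistedCount_ne_zero {e : Cell ν ≃ Fin n} {χ : AddChar k ℂ}
    {Θ Θ' : SStd ν μ}
    (h : twistedCount (columnPairs e) χ (content Θ.1) (Θ'.flag k e) (rowFlag k e) ≠ 0)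
    (i j : ℕ) (hi : i ≤ n) (hj : j ≤ n) : cornerCount Θ.1 i j ≤ cornerCount Θ'.1 i j := by
  obtain ⟨u, -, hu⟩ := Finset.exists_ne_zero_of_sum_ne_zero h
  have h1 : intMatrix (rowFlag k e) (u.1 • Θ'.flag k e) = content Θ.1 := by
    by_contra hne
    rw [if_neg hne, mul_zero] at hu
    exact hu rfl
  exact cornerCount_le u.2 h1 i j hi hj

theorem eq_zero_of_triangular {S : Type*} [Fintype S] (r : S → ℕ) (M : S → S → ℂ)
    (hle : ∀ s t, M s t ≠ 0 → r s ≤ r t) (heq : ∀ s t, M s t ≠ 0 → r s = r t → s = t)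
    (hd : ∀ s, M s s ≠ 0) (x : S → ℂ) (hx : ∀ t, ∑ s, x s * M s t = 0) (s : S) : x s = 0 := by
  by_contra hs
  -- At a nonzero coefficient of minimal rank, the equation with the same index has only its
  -- diagonal term.
  obtain ⟨s, hs, hmin⟩ := Finset.exists_min_image (Finset.univ.filter fun s => x s ≠ 0) r
    ⟨s, by simp [hs]⟩
  rw [Finset.mem_filter] at hs
  have h := hx s
  rw [Finset.sum_eq_single s] at h
  · exact (mul_ne_zero hs.2 (hd s)) h
  · intro t _ hts
    by_contra hne
    have h1 := left_ne_zero_of_mul hne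
    have h2 := right_ne_zero_of_mul hne
    exact hts (heq t s h2 (le_antisymm (hle t s h2) (hmin t (by simp [h1]))))
  · simp

instance : Finite (SStd ν μ) := Subtype.finite

instance : Fintype (SStd ν μ) := Fintype.ofFinite _

/-- The sum of all corner counts serves as rank: it is monotone for the entrywise order, and equal
sums force equal corner counts, hence equal tableaux. -/
theorem eq_zero_of_sum_twistedCount {e : Cell ν ≃ Fin n} (he : IsColumnReading e)
    (χ : AddChar k ℂ) (x : SStd ν μ → ℂ) (hx : ∀ Θ' : SStd ν μ, ∑ Θ : SStd ν μ, x Θ *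
      twistedCount (columnPairs e) χ (content Θ.1) (Θ'.flag k e) (rowFlag k e) = 0)
    (Θ : SStd ν μ) : x Θ = 0 := by
  have hle : ∀ Θ Θ' : SStd ν μ,
      twistedCount (columnPairs e) χ (content Θ.1) (Θ'.flag k e) (rowFlag k e) ≠ 0 →
      ∀ i ∈ Finset.range (n + 1), ∀ j ∈ Finset.range (n + 1),
        cornerCount Θ.1 i j ≤ cornerCount Θ'.1 i j := fun Θ Θ' h i hi j hj =>
    cornerCount_le_of_twistedCount_ne_zero h i j (Nat.lt_succ_iff.1 (Finset.mem_range.1 hi))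
      (Nat.lt_succ_iff.1 (Finset.mem_range.1 hj))
  refine eq_zero_of_triangular
    (fun Θ : SStd ν μ =>
      ∑ i ∈ Finset.range (n + 1), ∑ j ∈ Finset.range (n + 1), cornerCount Θ.1 i j)
    (fun Θ Θ' : SStd ν μ =>
      twistedCount (columnPairs e) χ (content Θ.1) (Θ'.flag k e) (rowFlag k e))
    ?_ ?_ (twistedCount_self_ne_zero he χ) x hx Θ
  · intro Θ Θ' h
    exact Finset.sum_le_sum fun i hi => Finset.sum_le_sum (hle Θ Θ' h i hi)
  · intro Θ Θ' h heq
    apply SStd.content_injective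
    apply content_eq_of_cornerCount_eq
    have h1 := (Finset.sum_eq_sum_iff_of_le fun i hi =>
      Finset.sum_le_sum (hle Θ Θ' h i hi)).1 heq
    intro i hi j hj
    have hi' := Finset.mem_range.2 (Nat.lt_succ_iff.2 hi)
    exact (Finset.sum_eq_sum_iff_of_le (hle Θ Θ' h i hi')).1 (h1 i hi') j
      (Finset.mem_range.2 (Nat.lt_succ_iff.2 hj))

end Triangularity

/-! ### Linear independence -/

section Independence

variable {k : Type*} [Field k] [Finite k] {n : ℕ} {ν κ lam μ : n.Partition}

theorem partition_ext {ν κ : n.Partition} (h : row ν = row κ) : ν = κ := by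
  have hlen : len ν = len κ := by
    apply le_antisymm
    · by_contra hlt
      have := (row_pos_iff ν (len κ)).2 (not_le.1 hlt)
      rw [h, row_pos_iff] at this
      exact lt_irrefl _ this
    · by_contra hlt
      have := (row_pos_iff κ (len ν)).2 (not_le.1 hlt)
      rw [← h, row_pos_iff] at this
      exact lt_irrefl _ this
  apply Nat.Partition.ext
  rw [← Multiset.sort_eq ν.parts (· ≥ ·), ← Multiset.sort_eq κ.parts (· ≥ ·)]
  congr 1
  refine List.ext_getElem ?_ fun i h1 h2 => ?_
  · rw [Multiset.length_sort, Multiset.length_sort]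
    exact hlen
  · have := congrFun h i
    unfold row at this
    rwa [List.getD_eq_getElem _ _ h1, List.getD_eq_getElem _ _ h2] at this

theorem partition_eq_of_partialSum_eq {ν κ : n.Partition}
    (h : ∀ i ≤ n, partialSum ν i = partialSum κ i) : ν = κ := by
  apply partition_ext
  funext i
  rcases lt_or_ge i n with hi | hi
  · have h1 := h i hi.le
    have h2 := h (i + 1) hi
    rw [partialSum_succ, partialSum_succ, h1] at h2
    exact Nat.add_left_cancel h2
  · rw [row_eq_zero ν hi, row_eq_zero κ hi]

theorem exists_maximal_of_oppDomLE (S : Finset n.Partition) (hS : S.Nonempty) :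
    ∃ ν ∈ S, ∀ κ ∈ S, OppDomLE ν κ → κ = ν := by
  -- The order is opposite to dominance, so a maximal element has the smallest total of partial
  -- sums.
  obtain ⟨ν, hν, hmin⟩ := Finset.exists_min_image S
    (fun ν => ∑ i ∈ Finset.range (n + 1), partialSum ν i) hS
  refine ⟨ν, hν, fun κ hκ hle => ?_⟩
  have h1 := le_antisymm (Finset.sum_le_sum fun i _ => hle i) (hmin κ hκ)
  have h2 := (Finset.sum_eq_sum_iff_of_le fun i _ => hle i).1 h1
  exact partition_eq_of_partialSum_eq fun i hi => h2 i (Finset.mem_range.2 (by omega))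

/-- The right side depends linearly on the kernel of the operator, so a linear relation among the
`cMap` passes to the twisted pairings on the left. -/
theorem sum_twistedCount_mul (D : Finset (Fin n × Fin n)) (χ χ' : AddChar k ℂ)
    (Ω₁ : Orbits k κ lam) (Ω₂ : Orbits k κ μ) (x : FlagOf k lam) (y : FlagOf k μ) :
    ∑ z : FlagOf k κ, twistedCount D χ (orbitMatrix Ω₁) x z *
        twistedCount D χ' (orbitMatrix Ω₂) y z =
      ∑ u : unip k n, ∑ v : unip k n, psi D χ u.1 * psi D χ' v.1 *
        (kernel (cMap Ω₁ Ω₂) (u.1 • x) (v.1 • y) : ℂ) := by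
  have h : ∀ z : FlagOf k κ, twistedCount D χ (orbitMatrix Ω₁) x z *
      twistedCount D χ' (orbitMatrix Ω₂) y z = ∑ u : unip k n, ∑ v : unip k n,
        psi D χ u.1 * psi D χ' v.1 *
          ((if intMatrix z (u.1 • x) = orbitMatrix Ω₁ then 1 else 0) *
            (if intMatrix z (v.1 • y) = orbitMatrix Ω₂ then 1 else 0)) := by
    intro z
    rw [twistedCount, twistedCount, Finset.sum_mul_sum]
    exact Finset.sum_congr rfl fun u _ => Finset.sum_congr rfl fun v _ => mul_mul_mul_comm _ _ _ _
  simp only [h]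
  rw [Finset.sum_comm]
  refine Finset.sum_congr rfl fun u _ => ?_
  rw [Finset.sum_comm]
  refine Finset.sum_congr rfl fun v _ => ?_
  rw [kernel_cMap, Rat.cast_sum, Finset.mul_sum]
  refine Finset.sum_congr rfl fun z _ => ?_
  rw [Rat.cast_mul]
  split_ifs <;> simp

/-- Opposite characters make the product `U`-invariant, and it is supported on the single orbit of
`rowFlag k e`. -/
theorem sum_equivariant_mul {χ : AddChar k ℂ} {e : Cell ν ≃ Fin n} (he : IsColumnReading e)
    (hχ : ∃ c, χ c ≠ 1) {f g : FlagOf k ν → ℂ} (hf : IsEquivariant (columnPairs e) χ⁻¹ f)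
    (hg : IsEquivariant (columnPairs e) χ g) :
    ∑ z, f z * g z =
      ((Finset.univ.filter fun z => ∃ u ∈ unip k n, z = u • rowFlag k e).card : ℂ) *
        (f (rowFlag k e) * g (rowFlag k e)) := by
  rw [Finset.card_filter, Nat.cast_sum, Finset.sum_mul]
  refine Finset.sum_congr rfl fun z _ => ?_
  split_ifs with h
  · obtain ⟨u, hu, rfl⟩ := h
    rw [hf u hu, hg u hu, mul_mul_mul_comm, psi_inv_mul_psi, Nat.cast_one]
  · have : g z = 0 := by
      by_contra hne
      exact h (hg.exists_smul_rowFlag he hχ hne)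
    rw [this, mul_zero, Nat.cast_zero, zero_mul]

instance : Finite (PermOrbits k ν κ) := Subtype.finite

instance : Fintype (PermOrbits k ν κ) := Fintype.ofFinite _

theorem linearIndependent_cMap (lam μ : n.Partition) :
    LinearIndependent ℚ (fun i : Index k lam μ => cMap i.2.1.1 i.2.2.1) := by
  rw [Fintype.linearIndependent_iff]
  intro a ha
  by_contra! hne
  obtain ⟨i₀, hi₀⟩ := hne
  let S : Finset n.Partition := Finset.univ.filter fun ν =>
    ∃ i : Index k lam μ, i.1.1 = ν ∧ a i ≠ 0
  obtain ⟨ν, hν, hmax⟩ := exists_maximal_of_oppDomLE S ⟨i₀.1.1, by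
    simp only [S, Finset.mem_filter, Finset.mem_univ, true_and]
    exact ⟨i₀, rfl, hi₀⟩⟩
  simp only [S, Finset.mem_filter, Finset.mem_univ, true_and] at hν hmax
  obtain ⟨⟨⟨ν, hle⟩, Ω₁, Ω₂⟩, rfl, hne⟩ := hν
  simp only at hmax
  obtain ⟨e, he⟩ := exists_columnReading ν
  change IsColumnReading e at he
  obtain ⟨χ, hχ⟩ := (AddChar.exists_apply_ne_zero (a := (1 : k))).2 one_ne_zero
  have key : ∀ (Θ' : SStd ν lam) (Θ'' : SStd ν μ), ∑ i : Index k lam μ, (a i : ℂ) *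
      ∑ z : FlagOf k i.1.1,
        twistedCount (columnPairs e) χ⁻¹ (orbitMatrix i.2.1.1) (Θ'.flag k e) z *
          twistedCount (columnPairs e) χ (orbitMatrix i.2.2.1) (Θ''.flag k e) z = 0 := by
    intro Θ' Θ''
    simp only [sum_twistedCount_mul, Finset.mul_sum]
    rw [Finset.sum_comm]
    refine Finset.sum_eq_zero fun u _ => ?_
    rw [Finset.sum_comm]
    refine Finset.sum_eq_zero fun v _ => ?_
    simp only [mul_left_comm (Rat.cast (a _) : ℂ)]
    rw [← Finset.mul_sum]
    have h1 := congrArg (fun A => (kernel A (u.1 • Θ'.flag k e) (v.1 • Θ''.flag k e) : ℂ)) ha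
    simp only [kernel_sum, kernel_smul, Rat.cast_sum, Rat.cast_mul] at h1
    rw [h1]
    change _ * ((0 : ℚ) : ℂ) = 0
    rw [Rat.cast_zero, mul_zero]
  set N : ℂ := ((Finset.univ.filter fun z : FlagOf k ν =>
    ∃ u ∈ unip k n, z = u • rowFlag k e).card : ℂ) with hN
  have hN0 : N ≠ 0 := by
    rw [hN, Nat.cast_ne_zero, Finset.card_ne_zero]
    refine ⟨rowFlag k e, ?_⟩
    rw [Finset.mem_filter]
    exact ⟨Finset.mem_univ _, 1, one_mem _, (one_smul _ _).symm⟩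
  let E₁ := permOrbitsEquiv k ν lam
  let E₂ := permOrbitsEquiv k ν μ
  have hE₁ : ∀ Θ, orbitMatrix (E₁.symm Θ).1 = content Θ.1 := fun Θ => by
    rw [← content_permOrbitsEquiv, Equiv.apply_symm_apply]
  have hE₂ : ∀ Θ, orbitMatrix (E₂.symm Θ).1 = content Θ.1 := fun Θ => by
    rw [← content_permOrbitsEquiv, Equiv.apply_symm_apply]
  let b : SStd ν lam → SStd ν μ → ℂ := fun Θ₁ Θ₂ =>
    (a ⟨⟨ν, hle⟩, E₁.symm Θ₁, E₂.symm Θ₂⟩ : ℂ)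
  have key2 : ∀ (Θ' : SStd ν lam) (Θ'' : SStd ν μ), ∑ Θ₁ : SStd ν lam, (∑ Θ₂ : SStd ν μ, b Θ₁ Θ₂ *
      twistedCount (columnPairs e) χ (content Θ₂.1) (Θ''.flag k e) (rowFlag k e)) *
        twistedCount (columnPairs e) χ⁻¹ (content Θ₁.1) (Θ'.flag k e) (rowFlag k e) = 0 := by
    intro Θ' Θ''
    have h := key Θ' Θ''
    -- Only `κ = ν` survives: a nonzero equivariant function on `κ`-flags needs `ν ≤ κ`, and `ν` is
    -- maximal among the shapes with a nonzero coefficient.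
    rw [Fintype.sum_sigma, Finset.sum_eq_single
      (⟨ν, hle⟩ : {ν : n.Partition // OppDomLE ν lam ∧ OppDomLE ν μ})] at h
    · simp only [sum_equivariant_mul he ⟨1, hχ⟩ (isEquivariant_twistedCount χ⁻¹ he.pairs _ _)
        (isEquivariant_twistedCount χ he.pairs _ _)] at h
      rw [← (E₁.symm.prodCongr E₂.symm).sum_comp, Fintype.sum_prod_type] at h
      refine (mul_eq_zero.1 (Eq.trans ?_ h)).resolve_left hN0
      rw [Finset.mul_sum]
      refine Finset.sum_congr rfl fun Θ₁ _ => ?_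
      rw [Finset.sum_mul, Finset.mul_sum]
      refine Finset.sum_congr rfl fun Θ₂ _ => ?_
      rw [Equiv.prodCongr_apply, Prod.map_apply, hE₁, hE₂]
      ring
    · rintro ⟨κ, hκ⟩ - hκν
      refine Finset.sum_eq_zero ?_
      rintro ⟨Ω₁, Ω₂⟩ -
      by_cases h0 : a ⟨⟨κ, hκ⟩, Ω₁, Ω₂⟩ = 0
      · rw [h0, Rat.cast_zero, zero_mul]
      · refine mul_eq_zero_of_right _ (Finset.sum_eq_zero fun z _ => ?_)
        by_contra hz
        have hle' := (isEquivariant_twistedCount χ he.pairs _ _).oppDomLE he ⟨1, hχ⟩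
          (right_ne_zero_of_mul hz)
        exact hκν (Subtype.ext (hmax κ ⟨_, rfl, h0⟩ hle'))
    · simp
  -- The remaining coefficient matrix is multiplied on both sides by triangular matrices; the two
  -- are cancelled one after the other.
  have h1 : ∀ (Θ'' : SStd ν μ) (Θ₁ : SStd ν lam), ∑ Θ₂ : SStd ν μ, b Θ₁ Θ₂ *
      twistedCount (columnPairs e) χ (content Θ₂.1) (Θ''.flag k e) (rowFlag k e) = 0 :=
    fun Θ'' Θ₁ => eq_zero_of_sum_twistedCount he χ⁻¹
      (fun Θ₁ => ∑ Θ₂ : SStd ν μ, b Θ₁ Θ₂ *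
        twistedCount (columnPairs e) χ (content Θ₂.1) (Θ''.flag k e) (rowFlag k e))
      (fun Θ' => key2 Θ' Θ'') Θ₁
  have h2 : b (E₁ Ω₁) (E₂ Ω₂) = 0 :=
    eq_zero_of_sum_twistedCount he χ (b (E₁ Ω₁)) (fun Θ'' => h1 Θ'' (E₁ Ω₁)) (E₂ Ω₂)
  simp only [b, Equiv.symm_apply_apply, Rat.cast_eq_zero] at h2
  exact hne h2

end Independence

/-! ### Growth diagrams -/

section Growth

/-- `β` is obtained from `α` by adding a horizontal strip. -/
def HStrip (α β : ℕ → ℕ) : Prop := ∀ r, α r ≤ β r ∧ β (r + 1) ≤ α r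

/-- The local rule of the Robinson-Schensted-Knuth correspondence. -/
def localRule (δ α β : ℕ → ℕ) (m : ℕ) : ℕ → ℕ
  | 0 => max (α 0) (β 0) + m
  -- For horizontal strips `δ r ≤ min (α r) (β r)`, so the subtraction is never truncated.
  | r + 1 => max (α (r + 1)) (β (r + 1)) + min (α r) (β r) - δ r

theorem HStrip.localRule_left {δ α β : ℕ → ℕ} (hα : HStrip δ α) (hβ : HStrip δ β) (m : ℕ) :
    HStrip α (localRule δ α β m) := by
  intro r
  have h1 := hα r
  have h2 := hβ r
  refine ⟨?_, ?_⟩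
  · cases r with
    | zero => simp only [localRule]; omega
    | succ r =>
      have h3 := hα r
      have h4 := hβ r
      simp only [localRule]
      omega
  · simp only [localRule]
    omega

theorem HStrip.localRule_right {δ α β : ℕ → ℕ} (hα : HStrip δ α) (hβ : HStrip δ β) (m : ℕ) :
    HStrip β (localRule δ α β m) := by
  intro r
  have h1 := hα r
  have h2 := hβ r
  refine ⟨?_, ?_⟩
  · cases r with
    | zero => simp only [localRule]; omega
    | succ r =>
      have h3 := hα r
      have h4 := hβ r
      simp only [localRule]
      omega
  · simp only [localRule]
    omega

/-- The sum telescopes through `max + min = α + β`, with `min (α N) (β N)` as the carry. -/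
theorem localRule_sum {δ α β : ℕ → ℕ} (hα : HStrip δ α) (hβ : HStrip δ β) (m N : ℕ) :
    ∑ r ∈ Finset.range (N + 1), localRule δ α β m r + ∑ r ∈ Finset.range N, δ r +
      min (α N) (β N) =
    ∑ r ∈ Finset.range (N + 1), α r + ∑ r ∈ Finset.range (N + 1), β r + m := by
  induction N with
  | zero => simp [localRule]; omega
  | succ N ih =>
    rw [Finset.sum_range_succ _ (N + 1), Finset.sum_range_succ δ N,
      Finset.sum_range_succ α (N + 1), Finset.sum_range_succ β (N + 1)]
    have h1 := hα N
    have h2 := hβ N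
    have h3 : localRule δ α β m (N + 1) =
      max (α (N + 1)) (β (N + 1)) + min (α N) (β N) - δ N := rfl
    omega

/-- The rule runs backwards: entry `0` of the result yields `m`, and entry `r + 1` yields `δ r`. -/
theorem localRule_injective {δ δ' α β : ℕ → ℕ} {m m' : ℕ} (hα : HStrip δ α) (hβ : HStrip δ β)
    (hα' : HStrip δ' α) (hβ' : HStrip δ' β) (h : localRule δ α β m = localRule δ' α β m') :
    δ = δ' ∧ m = m' := by
  constructor
  · funext r
    have h1 := congrFun h (r + 1)
    simp only [localRule] at h1
    have h2 := hα r
    have h3 := hβ r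
    have h4 := hα' r
    have h5 := hβ' r
    omega
  · have h1 := congrFun h 0
    simp only [localRule] at h1
    omega

/-- The growth diagram of a matrix. -/
def growth (A : ℕ → ℕ → ℕ) : ℕ → ℕ → ℕ → ℕ
  | 0, _ => fun _ => 0
  | _ + 1, 0 => fun _ => 0
  | i + 1, j + 1 => localRule (growth A i j) (growth A i (j + 1)) (growth A (i + 1) j) (A i j)

variable (A : ℕ → ℕ → ℕ)

theorem growth_zero_left (j : ℕ) : growth A 0 j = fun _ => 0 := by rw [growth]

theorem growth_zero_right (i : ℕ) : growth A i 0 = fun _ => 0 := by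
  cases i <;> rw [growth]

theorem growth_succ (i j : ℕ) : growth A (i + 1) (j + 1) =
    localRule (growth A i j) (growth A i (j + 1)) (growth A (i + 1) j) (A i j) := by
  rw [growth]

theorem hStrip_zero : HStrip (fun _ => 0) (fun _ => 0) := fun _ => ⟨le_rfl, le_rfl⟩

theorem hStrip_growth (i : ℕ) : ∀ j, HStrip (growth A i j) (growth A i (j + 1)) ∧
    HStrip (growth A i j) (growth A (i + 1) j) := by
  induction i with
  | zero =>
    have h1 : ∀ j, HStrip (growth A 0 j) (growth A 0 (j + 1)) := fun j => by
      rw [growth_zero_left, growth_zero_left]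
      exact hStrip_zero
    intro j
    refine ⟨h1 j, ?_⟩
    induction j with
    | zero =>
      rw [growth_zero_right, growth_zero_right]
      exact hStrip_zero
    | succ j ih =>
      rw [growth_succ]
      exact (h1 j).localRule_left ih _
  | succ i ih =>
    have h1 : ∀ j, HStrip (growth A (i + 1) j) (growth A (i + 1) (j + 1)) := fun j => by
      rw [growth_succ]
      exact (ih j).1.localRule_right (ih j).2 _
    intro j
    refine ⟨h1 j, ?_⟩
    induction j with
    | zero =>
      rw [growth_zero_right, growth_zero_right]
      exact hStrip_zero
    | succ j ihj =>
      rw [growth_succ A (i + 1) j]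
      exact (h1 j).localRule_left ihj _

/-- Each horizontal strip adds at most one new row. -/
theorem growth_eq_zero (i j r : ℕ) (h : i ≤ r) : growth A i j r = 0 := by
  induction i generalizing r with
  | zero => rw [growth_zero_left]
  | succ i ih =>
    obtain ⟨r, rfl⟩ : ∃ s, r = s + 1 := ⟨r - 1, by omega⟩
    have h1 := ((hStrip_growth A i j).2 r).2
    rw [ih r (by omega)] at h1
    omega

theorem sum_growth (n i j : ℕ) (hi : i ≤ n) :
    ∑ r ∈ Finset.range n, growth A i j r =
      ∑ i' ∈ Finset.range i, ∑ j' ∈ Finset.range j, A i' j' := by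
  induction i generalizing j with
  | zero => simp [growth_zero_left]
  | succ i ih =>
    induction j with
    | zero => simp [growth_zero_right]
    | succ j ihj =>
      have h := localRule_sum (hStrip_growth A i j).1 (hStrip_growth A i j).2 (A i j) n
      rw [← growth_succ] at h
      simp only [Finset.sum_range_succ _ n, growth_eq_zero A i _ n (by omega),
        growth_eq_zero A (i + 1) _ n hi, add_zero, min_self] at h
      rw [ih j (by omega), ih (j + 1) (by omega), ihj] at h
      simp only [Finset.sum_range_succ _ j, Finset.sum_range_succ _ i,
        Finset.sum_add_distrib] at h ⊢
      omega

theorem growth_injective {A B : ℕ → ℕ → ℕ} (n : ℕ) (h1 : ∀ j ≤ n, growth A n j = growth B n j)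
    (h2 : ∀ i ≤ n, growth A i n = growth B i n) (i j : ℕ) (hi : i < n) (hj : j < n) :
    A i j = B i j := by
  -- Here `d` and `c` are the distances from the far sides; the diagram is reconstructed inward from
  -- its last row and column by inverting the local rule.
  have key : ∀ d ≤ n, ∀ c ≤ n, growth A (n - d) (n - c) = growth B (n - d) (n - c) := by
    intro d
    induction d with
    | zero => exact fun _ c hc => h1 _ (by omega)
    | succ d ih =>
      intro hd c
      induction c with
      | zero => exact fun _ => h2 _ (by omega)
      | succ c ihc =>
        intro hc
        have h3 := ihc (by omega)
        have h4 := ih (by omega) (c + 1) hc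
        have h5 := ih (by omega) c (by omega)
        have hd' : n - d = n - (d + 1) + 1 := by omega
        have hc' : n - c = n - (c + 1) + 1 := by omega
        have hA := hStrip_growth A (n - (d + 1)) (n - (c + 1))
        have hB := hStrip_growth B (n - (d + 1)) (n - (c + 1))
        rw [hd', hc', growth_succ, growth_succ] at h5
        rw [hc'] at h3
        rw [hd'] at h4
        rw [h3, h4] at h5
        rw [h3, h4] at hA
        exact (localRule_injective hA.1 hA.2 hB.1 hB.2 h5).1
  have key' : ∀ i ≤ n, ∀ j ≤ n, growth A i j = growth B i j := by
    intro i hi j hj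
    have := key (n - i) (by omega) (n - j) (by omega)
    rwa [Nat.sub_sub_self hi, Nat.sub_sub_self hj] at this
  have hA := hStrip_growth A i j
  have hB := hStrip_growth B i j
  have h := key' (i + 1) hi (j + 1) hj
  rw [growth_succ, growth_succ] at h
  rw [key' i hi.le (j + 1) hj, key' (i + 1) hi j hj.le] at hA h
  exact (localRule_injective hA.1 hA.2 hB.1 hB.2 h).2

end Growth

/-! ### Chains of horizontal strips and semistandard tableaux -/

section Chains

variable {n : ℕ} {ν κ : n.Partition}

/-- The positive values of an antitone function form an initial segment, so deleting zeros shifts no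
index. -/
theorem getD_filter_map_range (f : ℕ → ℕ) (hf : Antitone f) (m i : ℕ) (hi : m ≤ i → f i = 0) :
    (((List.range m).map f).filter (fun a => 0 < a)).getD i 0 = f i := by
  induction m with
  | zero => simp [hi]
  | succ m ih =>
    rw [List.range_succ, List.map_append, List.filter_append]
    by_cases hm : 0 < f m
    · have h1 : ((List.range m).map f).filter (fun a => 0 < a) = (List.range m).map f := by
        rw [List.filter_eq_self]
        intro a ha
        rw [List.mem_map] at ha
        obtain ⟨r, hr, rfl⟩ := ha
        rw [List.mem_range] at hr
        simpa using lt_of_lt_of_le hm (hf hr.le)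
      rw [h1]
      simp only [List.map_cons, List.map_nil, List.filter_cons, hm, decide_true, if_true,
        List.filter_nil]
      rcases lt_trichotomy i m with h | h | h
      · rw [List.getD_append _ _ _ _ (by simpa using h), List.getD_eq_getElem _ _ (by simpa using h)]
        simp
      · subst h
        rw [List.getD_append_right _ _ _ _ (by simp)]
        simp
      · rw [hi h, List.getD_eq_default]
        simpa using h
    · simp only [List.map_cons, List.map_nil, List.filter_cons, hm, decide_false, List.filter_nil,
        Bool.false_eq_true, if_false, List.append_nil]
      exact ih fun h => Nat.eq_zero_of_le_zero ((hf h).trans (not_lt.1 hm))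

theorem exists_partition_of_antitone (f : ℕ → ℕ) (hf : Antitone f) (h0 : ∀ i, n ≤ i → f i = 0)
    (hsum : ∑ i ∈ Finset.range n, f i = n) : ∃ ν : n.Partition, row ν = f := by
  let l := ((List.range n).map f).filter (fun a => 0 < a)
  have hl : l.sum = n := by
    conv_rhs => rw [← hsum]
    rw [← sum_range_getD l n]
    · exact Finset.sum_congr rfl fun i _ => getD_filter_map_range f hf n i (h0 i)
    · calc l.length ≤ ((List.range n).map f).length := List.length_filter_le _ _
        _ = n := by simp
  refine ⟨⟨(l : Multiset ℕ), fun {i} hi => ?_, by rw [Multiset.sum_coe, hl]⟩, ?_⟩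
  · rw [Multiset.mem_coe] at hi
    simpa using (List.mem_filter.1 hi).2
  · funext i
    have hsorted : l.Pairwise (· ≥ ·) := by
      apply List.Pairwise.filter
      rw [List.pairwise_map]
      exact List.pairwise_lt_range.imp fun h => hf h.le
    have hsort : (l : Multiset ℕ).sort (· ≥ ·) = l := by
      rw [Multiset.coe_sort]
      exact List.mergeSort_of_pairwise (by simpa using hsorted)
    change ((l : Multiset ℕ).sort (· ≥ ·)).getD i 0 = f i
    rw [hsort]
    exact getD_filter_map_range f hf n i (h0 i)

/-- The number of labels `< j` in row `i`. -/
def tableauChain (Θ : Cell ν → Fin n) (j i : ℕ) : ℕ :=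
  (Finset.univ.filter fun b : Cell ν => (b.1 : ℕ) = i ∧ (Θ b : ℕ) < j).card

theorem tableauChain_eq (Θ : Cell ν → Fin n) (j : ℕ) (i : Fin n) :
    tableauChain Θ j i =
      (Finset.univ.filter fun x : Fin (row ν i) => (Θ ⟨i, x⟩ : ℕ) < j).card := by
  symm
  refine Finset.card_bij (fun x _ => ⟨i, x⟩) ?_ ?_ ?_
  · intro x hx
    simpa using hx
  · intro x _ y _ h
    simpa using h
  · rintro ⟨i', x⟩ hb
    simp only [Finset.mem_filter, Finset.mem_univ, true_and] at hb
    obtain ⟨h1, h2⟩ := hb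
    obtain rfl : i' = i := Fin.ext h1
    exact ⟨x, by simpa using h2, rfl⟩

theorem sum_tableauChain (Θ : Cell ν → Fin n) (j : ℕ) :
    ∑ i ∈ Finset.range n, tableauChain Θ j i =
      (Finset.univ.filter fun b : Cell ν => (Θ b : ℕ) < j).card := by
  rw [Finset.card_eq_sum_card_fiberwise (f := fun b : Cell ν => (b.1 : ℕ))
    (t := Finset.range n) (by intro b _; simp)]
  refine Finset.sum_congr rfl fun i _ => ?_
  rw [Finset.filter_filter]
  simp only [tableauChain, and_comm]

/-- A box is labelled by the step of the chain that first covers it. Nesting of the shapes gives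
weakly increasing rows, and the horizontal strip condition gives strict columns. -/
theorem exists_tableau_of_chain {c : ℕ → ℕ → ℕ} (hc : ∀ j, HStrip (c j) (c (j + 1)))
    (h0 : c 0 = fun _ => 0) (hn : c n = row ν)
    (hsum : ∀ j ≤ n, ∑ i ∈ Finset.range n, c j i = partialSum κ j) :
    ∃ Θ : SStd ν κ, ∀ j ≤ n, ∀ i < n, tableauChain Θ.1 j i = c j i := by
  have hmono : ∀ i, Monotone fun j => c j i := fun i =>
    monotone_nat_of_le_succ fun j => (hc j i).1
  have hanti : ∀ j, Antitone (c j) := by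
    intro j
    apply antitone_nat_of_succ_le
    intro r
    cases j with
    | zero => rw [h0]
    | succ j => exact (hc j r).2.trans (hc j r).1
  have hex : ∀ b : Cell ν, ∃ j, (b.2 : ℕ) < c (j + 1) b.1 := fun b => ⟨n - 1, by
    have := b.1.2
    rw [Nat.sub_add_cancel (by omega), hn]
    exact b.2.2⟩
  have hfind : ∀ (b : Cell ν) (j : ℕ), Nat.find (hex b) < j ↔ (b.2 : ℕ) < c j b.1 := by
    intro b j
    rw [Nat.find_lt_iff]
    constructor
    · rintro ⟨m, hm, h⟩
      exact lt_of_lt_of_le h (hmono _ hm)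
    · intro h
      cases j with
      | zero => rw [h0] at h; exact absurd h (Nat.not_lt_zero _)
      | succ j => exact ⟨j, Nat.lt_succ_self j, h⟩
  have hlt : ∀ b, Nat.find (hex b) < n := fun b => by
    rw [hfind, hn]
    exact b.2.2
  let Θ : Cell ν → Fin n := fun b => ⟨Nat.find (hex b), hlt b⟩
  have hΘ : ∀ (b : Cell ν) (j : ℕ), (Θ b : ℕ) < j ↔ (b.2 : ℕ) < c j b.1 := hfind
  have hchain : ∀ j ≤ n, ∀ i < n, tableauChain Θ j i = c j i := by
    intro j hj i hi
    have h1 := tableauChain_eq Θ j ⟨i, hi⟩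
    simp only at h1
    rw [h1]
    simp only [hΘ]
    have hle : c j i ≤ row ν i := by
      rw [← hn]
      exact hmono i hj
    rw [Fin.card_filter_val_lt]
    exact min_eq_right hle
  refine ⟨⟨Θ, ⟨?_, ?_⟩, ?_⟩, hchain⟩
  · intro i x y hxy
    have h1 := (hΘ ⟨i, y⟩ (Θ ⟨i, y⟩ + 1)).1 (Nat.lt_succ_self _)
    exact Nat.lt_succ_iff.1 ((hΘ ⟨i, x⟩ _).2 (lt_of_le_of_lt hxy h1))
  · intro i i' x y hi hxy
    have h1 := (hΘ ⟨i', y⟩ (Θ ⟨i', y⟩ + 1)).1 (Nat.lt_succ_self _)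
    refine (hΘ ⟨i, x⟩ _).2 ?_
    obtain ⟨r, hr⟩ : ∃ r, (i' : ℕ) = r + 1 := ⟨i' - 1, by rw [Fin.lt_def] at hi; omega⟩
    simp only at h1 ⊢
    rw [hxy]
    refine lt_of_lt_of_le h1 ?_
    rw [hr]
    exact (hc _ r).2.trans (hanti _ (by rw [Fin.lt_def] at hi; omega))
  · intro j
    have h1 : ∀ j ≤ n, (Finset.univ.filter fun b : Cell ν => (Θ b : ℕ) < j).card =
        partialSum κ j := by
      intro j hj
      rw [← sum_tableauChain, ← hsum j hj]
      exact Finset.sum_congr rfl fun i hi => hchain j hj i (Finset.mem_range.1 hi)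
    have h2 := h1 j j.2.le
    have h3 := h1 (j + 1) j.2
    rw [partialSum_succ, ← h2] at h3
    have h4 : (Finset.univ.filter fun b : Cell ν => (Θ b : ℕ) < j + 1) =
        (Finset.univ.filter fun b : Cell ν => (Θ b : ℕ) < j) ∪
          (Finset.univ.filter fun b => Θ b = j) := by
      ext b
      simp only [Finset.mem_filter, Finset.mem_univ, true_and, Finset.mem_union, Fin.ext_iff]
      omega
    rw [h4, Finset.card_union_of_disjoint] at h3
    · exact Nat.add_left_cancel h3
    · rw [Finset.disjoint_filter]
      intro b _ h h'
      rw [h'] at h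
      exact absurd h (lt_irrefl _)

/-- The injection underlying the Robinson-Schensted-Knuth correspondence: a matrix with row sums
`lam` and column sums `μ` gives a pair of semistandard tableaux of the same shape. -/
theorem exists_tableaux_of_matrix {lam μ : n.Partition} (A : ℕ → ℕ → ℕ)
    (hrow : ∀ i < n, ∑ j ∈ Finset.range n, A i j = row lam i)
    (hcol : ∀ j < n, ∑ i ∈ Finset.range n, A i j = row μ j) :
    ∃ (ν : n.Partition) (Θ₁ : SStd ν lam) (Θ₂ : SStd ν μ),
      (∀ i ≤ n, ∀ r < n, tableauChain Θ₁.1 i r = growth A i n r) ∧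
      (∀ j ≤ n, ∀ r < n, tableauChain Θ₂.1 j r = growth A n j r) := by
  have hsum₁ : ∀ i ≤ n, ∑ r ∈ Finset.range n, growth A i n r = partialSum lam i := by
    intro i hi
    rw [sum_growth A n i n hi]
    exact Finset.sum_congr rfl fun i' hi' => hrow i' (by rw [Finset.mem_range] at hi'; omega)
  have hsum₂ : ∀ j ≤ n, ∑ r ∈ Finset.range n, growth A n j r = partialSum μ j := by
    intro j hj
    rw [sum_growth A n n j le_rfl, Finset.sum_comm]
    exact Finset.sum_congr rfl fun j' hj' => hcol j' (by rw [Finset.mem_range] at hj'; omega)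
  have hanti : Antitone (growth A n n) := by
    apply antitone_nat_of_succ_le
    intro r
    cases n with
    | zero => simp [growth_zero_left]
    | succ n =>
      have h := (hStrip_growth A n (n + 1)).2 r
      exact h.2.trans h.1
  obtain ⟨ν, hν⟩ := exists_partition_of_antitone (n := n) (growth A n n) hanti
    (fun r hr => growth_eq_zero A n n r hr) (by rw [hsum₁ n le_rfl, partialSum_top])
  obtain ⟨Θ₁, h₁⟩ := exists_tableau_of_chain (ν := ν) (κ := lam) (c := fun i => growth A i n)
    (fun i => (hStrip_growth A i n).2) (growth_zero_left A n) hν.symm hsum₁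
  obtain ⟨Θ₂, h₂⟩ := exists_tableau_of_chain (ν := ν) (κ := μ) (c := fun j => growth A n j)
    (fun j => (hStrip_growth A n j).1) (growth_zero_right A n) hν.symm hsum₂
  exact ⟨ν, Θ₁, Θ₂, h₁, h₂⟩

end Chains

/-! ### The basis of the space of homomorphisms -/

section BasisTheorem

variable {k : Type*} [Field k] [Finite k] {n : ℕ} {lam μ : n.Partition}

/-- The intersection matrix of an orbit, extended by zeros. -/
def paddedMatrix (Ω : Orbits k lam μ) (i j : ℕ) : ℕ :=
  if h : i < n ∧ j < n then orbitMatrix Ω ⟨i, h.1⟩ ⟨j, h.2⟩ else 0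

theorem paddedMatrix_coe (Ω : Orbits k lam μ) (i j : Fin n) :
    paddedMatrix Ω i j = orbitMatrix Ω i j := dif_pos ⟨i.2, j.2⟩

theorem sum_orbitMatrix_col (Ω : Orbits k lam μ) (j : Fin n) :
    ∑ i, orbitMatrix Ω i j = row μ j := by
  induction Ω using Quotient.inductionOn' with
  | h p => exact sum_intMatrix p.1 p.2 j

theorem sum_orbitMatrix_row (Ω : Orbits k lam μ) (i : Fin n) :
    ∑ j, orbitMatrix Ω i j = row lam i := by
  simp only [← orbitMatrix_op Ω]
  exact sum_orbitMatrix_col Ω.op i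

theorem exists_index (Ω : Orbits k lam μ) : ∃ i : Index k lam μ,
    (∀ j ≤ n, ∀ r < n, tableauChain (permOrbitsEquiv k i.1.1 lam i.2.1).1 j r =
      growth (paddedMatrix Ω) j n r) ∧
    (∀ j ≤ n, ∀ r < n, tableauChain (permOrbitsEquiv k i.1.1 μ i.2.2).1 j r =
      growth (paddedMatrix Ω) n j r) := by
  obtain ⟨ν, Θ₁, Θ₂, h₁, h₂⟩ := exists_tableaux_of_matrix (lam := lam) (μ := μ) (paddedMatrix Ω)
    (fun i hi => by
      rw [← Fin.sum_univ_eq_sum_range (fun j => paddedMatrix Ω i j)]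
      exact (Finset.sum_congr rfl fun j _ => paddedMatrix_coe Ω ⟨i, hi⟩ j).trans
        (sum_orbitMatrix_row Ω ⟨i, hi⟩))
    (fun j hj => by
      rw [← Fin.sum_univ_eq_sum_range (fun i => paddedMatrix Ω i j)]
      exact (Finset.sum_congr rfl fun i _ => paddedMatrix_coe Ω i ⟨j, hj⟩).trans
        (sum_orbitMatrix_col Ω ⟨j, hj⟩))
  refine ⟨⟨⟨ν, Θ₁.oppDomLE, Θ₂.oppDomLE⟩, (permOrbitsEquiv k ν lam).symm Θ₁,
    (permOrbitsEquiv k ν μ).symm Θ₂⟩, ?_, ?_⟩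
  · simpa only [Equiv.apply_symm_apply] using h₁
  · simpa only [Equiv.apply_symm_apply] using h₂

/-- The two tableaux record the last column and the last row of the growth diagram, and these
determine the matrix. -/
theorem card_orbits_le (lam μ : n.Partition) :
    Nat.card (Orbits k lam μ) ≤ Nat.card (Index k lam μ) := by
  choose f hf₁ hf₂ using fun Ω : Orbits k lam μ => exists_index Ω
  refine Nat.card_le_card_of_injective f fun Ω Ω' h => orbitMatrix_injective ?_
  funext i j
  rw [← paddedMatrix_coe, ← paddedMatrix_coe]
  refine growth_injective n (fun j hj => funext fun r => ?_) (fun i hi => funext fun r => ?_)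
    i j i.2 j.2
  · rcases lt_or_ge r n with hr | hr
    · rw [← hf₂ Ω j hj r hr, h, hf₂ Ω' j hj r hr]
    · rw [growth_eq_zero _ _ _ _ hr, growth_eq_zero _ _ _ _ hr]
  · rcases lt_or_ge r n with hr | hr
    · rw [← hf₁ Ω i hi r hr, h, hf₁ Ω' i hi r hr]
    · rw [growth_eq_zero _ _ _ _ (hi.trans hr), growth_eq_zero _ _ _ _ (hi.trans hr)]

/-- The basis of `Hom_G(F_μ, F_lam)` formed by the maps `c^ν_{Ω₁Ω₂}`. -/
def cBasis (k : Type*) [Field k] [Finite k] {n : ℕ} (lam μ : n.Partition) :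
    Basis (Index k lam μ) ℚ (HomG k μ lam) :=
  Basis.mk (linearIndependent_cMap lam μ) (by
    have : Module.Finite ℚ (HomG k μ lam) := Module.Finite.of_basis (orbitBasis k lam μ)
    -- Independence bounds the number of indices by the dimension, which is the number of orbits;
    -- the growth diagram injection gives the reverse bound.
    refine ((linearIndependent_cMap lam μ).span_eq_top_of_card_eq_finrank' ?_).ge
    refine le_antisymm (linearIndependent_cMap lam μ).fintype_card_le_finrank ?_
    rw [Module.finrank_eq_nat_card_basis (orbitBasis k lam μ), ← Nat.card_eq_fintype_card]
    exact card_orbits_le lam μ)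

theorem cBasis_apply (i : Index k lam μ) : cBasis k lam μ i = cMap i.2.1.1 i.2.2.1 :=
  Basis.mk_apply _ _ i

end BasisTheorem

end FlagHecke

end

theorem theorem3p3 (k : Type*) [Field k] [Finite k] (n : ℕ) (hn : 0 < n)
    (lam μ : n.Partition) :
    -- the family of the `c^ν_{Ω₁Ω₂}` is a `ℚ`-basis of `Hom_G(F_μ, F_lam)`
    ∃ b : Module.Basis (Index k lam μ) ℚ (HomG k μ lam),
      (∀ i : Index k lam μ, b i = cMap i.2.1.1 i.2.2.1) ∧
      -- orbits of permissible embeddings correspond to semistandard tableaux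
      ∃ e : ∀ ν κ : n.Partition, PermOrbits k ν κ ≃ SStd ν κ,
        (∀ (ν κ : n.Partition) (Ω : PermOrbits k ν κ),
          content (e ν κ Ω).1 = orbitMatrix Ω.1) ∧
        -- the Hecke algebra with `q = |k|` is the algebra `End_G(F_{(1^n)})`
        ∃ Φ : Hecke ℚ (Nat.card k : ℚ) n ≃ₐ[ℚ] HomG k (ones n) (ones n),
          (∀ w : Equiv.Perm (Fin n), ∃ Ω : Orbits k (ones n) (ones n),
            (orbitMatrix Ω = fun i j => if w i = j then 1 else 0) ∧
              Φ (T ℚ (Nat.card k : ℚ) w) = gMap Ω) ∧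
          -- compatibly, `m_lam H m_μ` is `Hom_G(F_μ, F_lam)`, and
          -- the family `c` is the Murphy-Dipper-James basis
          ∃ Ψ : heckeModule ℚ (Nat.card k : ℚ) lam μ ≃ₗ[ℚ] HomG k μ lam,
            (∀ h, inflate (Ψ h) = Φ (h : Hecke ℚ (Nat.card k : ℚ) n)) ∧
            ∀ i : Index k lam μ,
              ((Ψ.symm (b i) : heckeModule ℚ (Nat.card k : ℚ) lam μ) :
                  Hecke ℚ (Nat.card k : ℚ) n) =
                murphyElt ℚ (Nat.card k : ℚ) (e i.1 lam i.2.1) (e i.1 μ i.2.2) ∧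
              -- the product formed in the Hecke algebra carries the factor `|P_ν| / |B|`
              inflate (gMap i.2.1.1.op) * inflate (gMap i.2.2.1) =
                ((Nat.card (parabolic k i.1.1) : ℚ) / (Nat.card (upperTriangular k n) : ℚ)) •
                  Φ (murphyElt ℚ (Nat.card k : ℚ) (e i.1 lam i.2.1) (e i.1 μ i.2.2)) := by
  refine ⟨cBasis k lam μ, cBasis_apply, permOrbitsEquiv k, fun ν κ Ω => content_permOrbitsEquiv Ω,
    heckeEquiv k n, fun w => ⟨permOrbit k w, orbitMatrix_permOrbit w, heckeEquiv_T w⟩,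
    (homEquivHeckeModule k lam μ).symm, fun h => ?_, fun i => ?_⟩
  · conv_rhs => rw [← (homEquivHeckeModule k lam μ).apply_symm_apply h]
    rw [coe_homEquivHeckeModule, AlgEquiv.apply_symm_apply]
  · have key := heckeEquiv_murphyElt (content_permOrbitsEquiv i.2.1).symm
      (content_permOrbitsEquiv i.2.2).symm
    refine ⟨?_, ?_⟩
    · rw [LinearEquiv.symm_symm, coe_homEquivHeckeModule, cBasis_apply, ← key,
        AlgEquiv.symm_apply_apply]
    · rw [key, inflate_comp]
      rfl
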